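/- Work over $\mathbb C$. Let $\Sigma\subset G(2,4)$ be a nondegenerate plane congruence in $\mathbb P^4$: an irreducible quasi-projective surface in the Grassmannian of planes of $\mathbb P^4$ such that the projection $p:\{(P,\sigma)\in\mathbb P^4\times\Sigma : P\in\mathbb P^2(\sigma)\}\to\mathbb P^4$ is dominant, where $\mathbb P^2(\sigma)=\mathbb P(W_\sigma)$, $W_\sigma\subset\mathbb C^5$, is the plane corresponding to $\sigma$. For a smooth point $\sigma\in\Sigma$ let $$\chi(\sigma):T_{\Sigma,\sigma}\to H^0(\mathbb P^2(\sigma),\mathcal N_{\mathbb P^2(\sigma),\mathbb P^4})=\operatorname{Hom}(W_\sigma,\mathbb C^5/W_\sigma)$$ be the characteristic map. The focal locus of a tangent direction $\langle w\rangle$, $0\ne w\in T_{\Sigma,\sigma}$, is the linear subspace $\{Q\in\mathbb P^2(\sigma):\chi(\sigma)(w)(Q)=0\}$. If $\chi(\sigma)(w_k)=(f_{k1},f_{k2})$ for a basis $w_1,w_2$ of $T_{\Sigma,\sigma}$ and a basis of $\mathbb C^5/W_\sigma$, the focal conic $C(\sigma)\subset\mathbb P^2(\sigma)$ is $f_{11}f_{22}-f_{12}f_{21}=0$;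 it is a conic if this form is not identically zero, and it is degenerate if moreover the form has rank less than $3$. A (one-dimensional) family through $\mathbb P^2(\sigma)$ is a germ at $\sigma$ of a regular holomorphic curve in $\Sigma$; it is developable if, for its general member $\tau$, the focal locus in $\mathbb P^2(\tau)$ of the tangent direction of the curve at $\tau$ is a line. A focal line direction at $\sigma$ is a tangent direction whose focal locus is a line. Focal line directions are counted with their multiplicity as points of the subscheme of $\mathbb P(T_{\Sigma,\sigma})\cong\mathbb P^1$ defined by the $2\times 2$ minors of $\chi(\sigma)(\lambda w_1+\mu w_2)\in\operatorname{Hom}(W_\sigma,\mathbb C^5/W_\sigma)$. "For general $\sigma$" means: for all $\sigma$ in some nonempty Zariski open subset of $\Sigma$. Proposition. 1. For general $\sigma$, $C(\sigma)$ is a conic. 2. There is a developable family through $\mathbb P^2(\sigma)$ for general $\sigma$ if and only if $C(\sigma)$ is degenerate for general $\sigma$. 3. For general $\sigma$, the developable families through $\mathbb P^2(\sigma)$ correspond to the focal line directions at $\sigma$: the tangent vector at $\sigma$ of each developable family spans a focal line direction, and every focal line direction is the tangent direction of a developable family. If not every tangent direction at $\sigma$ is a focal line direction, two developable families through $\mathbb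 P^2(\sigma)$ with the same tangent direction at $\sigma$ are equal as curve germs; if every tangent direction at $\sigma$ is a focal line direction, every one-dimensional family through $\mathbb P^2(\sigma)$ is developable. 4. If the general focal conic is degenerate, then one of the following holds for general $\sigma$: there is exactly one focal line direction, and it is simple; there are exactly two distinct focal line directions; there are two coincident ones (exactly one focal line direction, which is multiple); or every tangent direction is a focal line direction. -/

import Mathlib

open Filter Topology

noncomputable section

namespace PlaneCongruence

/-- The vector space `ℂ⁵`, whose projectivization is `ℙ⁴`. -/
abbrev V : Type := Fin 5 → ℂ

/-- The Grassmannian `G(2,4)`: a plane of `ℙ⁴` is a three-dimensional subspace of `ℂ⁵`. -/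
@[ext]
structure Plane where
  toSubmodule : Submodule ℂ V
  finrank_eq : Module.finrank ℂ toSubmodule = 3

/-- A frame: three linearly independent vectors of `ℂ⁵`. It carries a plane of `ℙ⁴` together with
homogeneous coordinates on that plane: `c : Fin 3 → ℂ` are the coordinates of `∑ i, c i • vec i`. -/
structure Frame where
  vec : Fin 3 → V
  linearIndependent : LinearIndependent ℂ vec

/-- The subspace spanned by a frame. -/
def Frame.span (A : Frame) : Submodule ℂ V := Submodule.span ℂ (Set.range A.vec)

/-- The plane spanned by a frame. -/
def Frame.plane (A : Frame) : Plane where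
  toSubmodule := A.span
  finrank_eq := (finrank_span_eq_card A.linearIndependent).trans (Fintype.card_fin 3)

/-- The fifteen coordinates of a triple of vectors of `ℂ⁵`. -/
def coords (X : Fin 3 → V) : Fin 3 × Fin 5 → ℂ := fun p => X p.1 p.2

/-- The Zariski topology on the space of frames, a subset of affine space `𝔸¹⁵`. -/
instance : TopologicalSpace Frame :=
  TopologicalSpace.induced
    (fun A => (MvPolynomial.pointToPoint (coords A.vec) :
      PrimeSpectrum (MvPolynomial (Fin 3 × Fin 5) ℂ)))
    inferInstance

/-- The Zariski topology on the Grassmannian. The map `Frame.plane` is the quotient of the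
space of frames by `GL₃(ℂ)` (a Zariski locally trivial principal bundle), so that a set of planes
is closed iff the set of its frames is closed. -/
instance : TopologicalSpace Plane :=
  TopologicalSpace.coinduced Frame.plane inferInstance

/-- The differential at `A` of a polynomial function in the fifteen coordinates of a frame. -/
def dPoly (f : MvPolynomial (Fin 3 × Fin 5) ℂ) (A : Frame) : (Fin 3 → V) →ₗ[ℂ] ℂ :=
  ∑ p : Fin 3 × Fin 5, MvPolynomial.eval (coords A.vec) (MvPolynomial.pderiv p f) •
    ((LinearMap.proj p.2 : V →ₗ[ℂ] ℂ) ∘ₗ (LinearMap.proj p.1 : (Fin 3 → V) →ₗ[ℂ] V))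

/-- The set `S` of planes is, near the plane of `A`, a smooth algebraic surface (Jacobian
criterion): in a Zariski neighbourhood of `A` the frames of the planes in `S` are cut out, in the
fifteen-dimensional space of all frames, by four polynomials whose differentials at `A` are
independent. (Eleven dimensions remain: nine for the choice of a frame of a given plane, and
two for the plane in `S`.) -/
def IsSmoothSurfaceAt (S : Set Plane) (A : Frame) : Prop :=
  ∃ (g : Fin 4 → MvPolynomial (Fin 3 × Fin 5) ℂ) (h : MvPolynomial (Fin 3 × Fin 5) ℂ),
    MvPolynomial.eval (coords A.vec) h ≠ 0 ∧
    (∀ B : Frame, MvPolynomial.eval (coords B.vec) h ≠ 0 →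
      (B.plane ∈ S ↔ ∀ i, MvPolynomial.eval (coords B.vec) (g i) = 0)) ∧
    LinearIndependent ℂ (fun i => dPoly (g i) A)

/-- A plane congruence in `ℙ⁴`: an irreducible quasi-projective (that is, locally closed) subset
of the Grassmannian `G(2,4)`, of dimension two. Since it is irreducible, its dimension can be read
off at a single smooth point; other points may be singular. -/
structure IsPlaneCongruence (S : Set Plane) : Prop where
  isLocallyClosed : IsLocallyClosed S
  isIrreducible : IsIrreducible S
  dim_two : ∃ A : Frame, A.plane ∈ S ∧ IsSmoothSurfaceAt S A

/-- The congruence is nondegenerate: the projection of the incidence variety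
`{(P, σ) | P ∈ ℙ²(σ)}` to `ℙ⁴` is dominant, that is, no nonzero homogeneous polynomial vanishes on
all the planes of the congruence. -/
def IsNondegenerate (S : Set Plane) : Prop :=
  ∀ (d : ℕ) (F : MvPolynomial (Fin 5) ℂ), F.IsHomogeneous d →
    (∀ σ ∈ S, ∀ v ∈ σ.toSubmodule, MvPolynomial.eval v F = 0) → F = 0

/-- A property holds for the general plane of `S`: for all planes in a nonempty Zariski open
subset of `S`, with arbitrary homogeneous coordinates on them. -/
def General (S : Set Plane) (P : Frame → Prop) : Prop :=
  ∃ U : Set Plane, IsOpen U ∧ (S ∩ U).Nonempty ∧ ∀ A : Frame, A.plane ∈ S ∩ U → P A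

/-- Linear maps from `W` to `ℂ⁵ / W`, where the subspace `W` is identified with `ℂ³` by the frame
`A`. This is the tangent space of the Grassmannian at the plane of `A`, and also the space of
sections `H⁰(ℙ²(σ), N)` of the normal bundle `N = O(1) ⊗ (ℂ⁵ / W)` of the plane in `ℙ⁴`. -/
abbrev NormalSection (A : Frame) : Type := (Fin 3 → ℂ) →ₗ[ℂ] (V ⧸ A.span)

/-- The characteristic map, on velocities of frames: if the frame `A` moves with velocity `X`, the
point `Q = ∑ i, c i • A.vec i` of the moving plane moves with velocity `∑ i, c i • X i`, and the
section takes at `Q` the class of this velocity modulo the plane. -/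
def charMap (A : Frame) : (Fin 3 → V) →ₗ[ℂ] NormalSection A where
  toFun X := A.span.mkQ ∘ₗ Fintype.linearCombination ℂ X
  map_add' X Y := by
    ext i
    simp [Fintype.linearCombination_apply, Finset.sum_add_distrib]
  map_smul' a X := by
    ext i
    simp [Fintype.linearCombination_apply]

/-- The Zariski tangent space at `A` of the set of all frames of the planes in `S`. -/
def frameTangentSpace (S : Set Plane) (A : Frame) : Submodule ℂ (Fin 3 → V) :=
  ⨅ (f : MvPolynomial (Fin 3 × Fin 5) ℂ)
    (_ : ∀ B : Frame, B.plane ∈ S → MvPolynomial.eval (coords B.vec) f = 0),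
    LinearMap.ker (dPoly f A)

/-- The tangent space `T_{Σ,σ}` of `S` at the plane `σ` of `A`. It is a subspace of the tangent
space of the Grassmannian, and the characteristic map `χ(σ)` is its inclusion. -/
def tangentSpace (S : Set Plane) (A : Frame) : Submodule ℂ (NormalSection A) :=
  (frameTangentSpace S A).map (charMap A)

/-- The focal locus in the plane of `A` for the direction `φ`: the zero locus of the section, a
linear subspace of the plane. -/
def focalLocus (A : Frame) (φ : NormalSection A) : Submodule ℂ (Fin 3 → ℂ) := LinearMap.ker φ

/-- The focal locus for the direction `φ` is a whole (projective) line. -/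
def IsFocalLine (A : Frame) (φ : NormalSection A) : Prop :=
  Module.finrank ℂ (focalLocus A φ) = 2

/-- `φ` spans a tangent direction of `S` at the plane of `A` whose focal locus is a line. -/
def IsFocalLineDirection (S : Set Plane) (A : Frame) (φ : NormalSection A) : Prop :=
  φ ∈ tangentSpace S A ∧ φ ≠ 0 ∧ IsFocalLine A φ

/-- The quadratic form `f₁₁ f₂₂ - f₁₂ f₂₁`, where `f_{k1}, f_{k2}` are the coordinates of the
section `w k` with respect to a basis `e` of `ℂ⁵ / W`. -/
def focalForm (A : Frame) (w : Fin 2 → NormalSection A) (e : Module.Basis (Fin 2) ℂ (V ⧸ A.span)) :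
    QuadraticForm ℂ (Fin 3 → ℂ) :=
  QuadraticMap.linMulLin (e.coord 0 ∘ₗ w 0) (e.coord 1 ∘ₗ w 1) -
    QuadraticMap.linMulLin (e.coord 1 ∘ₗ w 0) (e.coord 0 ∘ₗ w 1)

/-- The focal locus of `S` in the plane of `A` is the conic with equation `q = 0`. This says in
particular that the tangent space is two-dimensional (the plane is a smooth point of the surface
`S`) and that the equation does not vanish identically. -/
def IsFocalConic (S : Set Plane) (A : Frame) (q : QuadraticForm ℂ (Fin 3 → ℂ)) : Prop :=
  q ≠ 0 ∧ ∃ (b : Module.Basis (Fin 2) ℂ (tangentSpace S A))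
    (e : Module.Basis (Fin 2) ℂ (V ⧸ A.span)),
    q = focalForm A (fun k => (b k : NormalSection A)) e

/-- The conic `q = 0` in `ℙ²` is degenerate: the quadratic form has rank less than three. -/
def IsDegenerateConic (q : QuadraticForm ℂ (Fin 3 → ℂ)) : Prop :=
  ¬ (QuadraticMap.polarBilin q).SeparatingLeft

/-- The focal locus in the plane of `A` is a degenerate conic. -/
def HasDegenerateFocalConic (S : Set Plane) (A : Frame) : Prop :=
  ∃ q, IsFocalConic S A q ∧ IsDegenerateConic q

/-- The section given by the velocity at `t` of a parametrized family of frames. -/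
def velocity (γ : ℂ → Frame) (t : ℂ) : NormalSection (γ t) :=
  charMap (γ t) (deriv (fun s => (γ s).vec) t)

/-- `γ` represents (near `t = 0`) a one-dimensional family of planes contained in `S` and passing
through the plane of `A`: a germ of a regular holomorphic curve in `S`. It is given by a
holomorphic family of frames, starting at `A` without loss of generality; only the values near
`t = 0` matter. -/
structure IsFamilyThrough (S : Set Plane) (A : Frame) (γ : ℂ → Frame) : Prop where
  analyticAt : AnalyticAt ℂ (fun t => (γ t).vec) 0
  start : γ 0 = A
  mem : ∀ᶠ t in 𝓝 (0 : ℂ), (γ t).plane ∈ S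
  regular : velocity γ 0 ≠ 0

/-- The tangent vector at `t = 0` of a family through the plane of `A`. -/
def initialTangent (A : Frame) (γ : ℂ → Frame) : NormalSection A :=
  charMap A (deriv (fun s => (γ s).vec) 0)

/-- The one-dimensional family is developable: the focal locus in its general plane (all members
of the germ, except possibly the one at `t = 0`) is a line. -/
def IsDevelopable (γ : ℂ → Frame) : Prop :=
  ∀ᶠ t in 𝓝[≠] (0 : ℂ), IsFocalLine (γ t) (velocity γ t)

/-- Two families are the same curve germ, up to a change of the parameter. -/
def SameGerm (γ δ : ℂ → Frame) : Prop :=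
  ∃ r : ℂ → ℂ, AnalyticAt ℂ r 0 ∧ r 0 = 0 ∧ deriv r 0 ≠ 0 ∧
    ∀ᶠ t in 𝓝 (0 : ℂ), (δ t).plane = (γ (r t)).plane

/-- The directions whose focal locus is a line form the subscheme of `ℙ(T_{Σ,σ}) ≅ ℙ¹` defined by
the quadrics `φ ↦ ω (φ x, φ y)` (the `2 × 2` minors of `φ`). The direction `φ` is a multiple
point of this subscheme if these quadrics vanish to second order at `φ`, that is, if
the derivatives at `φ` vanish as well. -/
def IsMultipleDirection (S : Set Plane) (A : Frame) (φ : NormalSection A) : Prop :=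
  ∀ (ω : (V ⧸ A.span) [⋀^Fin 2]→ₗ[ℂ] ℂ) (x y : Fin 3 → ℂ),
    ω ![φ x, φ y] = 0 ∧ ∀ ψ ∈ tangentSpace S A, ω ![φ x, ψ y] + ω ![ψ x, φ y] = 0

/-- There is exactly one focal line direction, and it is a simple one. -/
def OneDirection (S : Set Plane) (A : Frame) : Prop :=
  ∃ φ, IsFocalLineDirection S A φ ∧ ¬ IsMultipleDirection S A φ ∧
    ∀ ψ, IsFocalLineDirection S A ψ → ∃ c : ℂ, ψ = c • φ

/-- There are exactly two distinct focal line directions. -/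
def TwoDistinctDirections (S : Set Plane) (A : Frame) : Prop :=
  ∃ φ₁ φ₂, LinearIndependent ℂ ![φ₁, φ₂] ∧
    IsFocalLineDirection S A φ₁ ∧ IsFocalLineDirection S A φ₂ ∧
    ∀ ψ, IsFocalLineDirection S A ψ → (∃ c : ℂ, ψ = c • φ₁) ∨ (∃ c : ℂ, ψ = c • φ₂)

/-- There are two coincident focal line directions: exactly one, which is double. -/
def TwoCoincidentDirections (S : Set Plane) (A : Frame) : Prop :=
  ∃ φ, IsFocalLineDirection S A φ ∧ IsMultipleDirection S A φ ∧
    ∀ ψ, IsFocalLineDirection S A ψ → ∃ c : ℂ, ψ = c • φ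

/-- Every tangent direction is a focal line direction. -/
def AllDirections (S : Set Plane) (A : Frame) : Prop :=
  ∀ φ ∈ tangentSpace S A, φ ≠ 0 → IsFocalLineDirection S A φ

/-- Developable families through the plane of `A` correspond to the tangent directions whose focal
locus is a line. If some tangent direction is not such a direction, the correspondence is
one-to-one; if all tangent directions are, then every one-dimensional family through the
plane is developable. -/
structure DevelopablesCorrespond (S : Set Plane) (A : Frame) : Prop where
  isFocalLineDirection : ∀ γ, IsFamilyThrough S A γ → IsDevelopable γ →
    IsFocalLineDirection S A (initialTangent A γ)
  exists_family : ∀ φ, IsFocalLineDirection S A φ →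
    ∃ γ, IsFamilyThrough S A γ ∧ IsDevelopable γ ∧ initialTangent A γ = φ
  unique : ¬ AllDirections S A → ∀ γ δ,
    IsFamilyThrough S A γ → IsDevelopable γ → IsFamilyThrough S A δ → IsDevelopable δ →
    (∃ c : ℂ, initialTangent A δ = c • initialTangent A γ) → SameGerm γ δ
  all : AllDirections S A → ∀ γ, IsFamilyThrough S A γ → IsDevelopable γ

end PlaneCongruence

end

open PlaneCongruence

/-!
The planes of the congruence are handled through their frames `A`, triples of vectors of `ℂ⁵`.
Near a smooth point, the equations of the congruence and Cramer's rule give two polynomial vector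
fields `w 0`, `w 1` on the space of triples which span the tangent space of the congruence at
every frame outside a hypersurface `f = 0` (`IsTangentChart`,
`IsSmoothSurfaceAt.exists_isTangentChart`). A combination `s w₀ + t w₁` is a focal line direction
iff its `2 × 2` minors vanish, and these are binary quadratic forms in `(s, t)` whose coefficients
are polynomials in the frame. The variety of frames is irreducible (`exists_frame_mul_ne_zero`),
hence these forms, their discriminants and their resultants vanish identically on it or are
generically nonzero. After `f` is enlarged, there are thus four cases: all directions are focal
line directions, or none is, or exactly one, given by polynomials, or exactly the two distinct
roots of one of the forms (`IsTangentChart.exists_kind`). In the third case, the multiplicity is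
generically constant too (`IsTangentChart.general_of_uniqueFocal`).

*The focal locus is a conic.* By nondegeneracy, the five coordinates of the first vector of the
frame are algebraically independent in the function field of the variety of frames. In
characteristic zero the partial derivatives with respect to them extend to derivations of the
function field (`exists_derivation_of_injective`), and clearing denominators gives tangent vectors
at the general frame with an arbitrary first component (`exists_tangent_vector`). The evaluation
of the characteristic map at the first point of the frame is thus a surjective, hence bijective,
linear map between spaces of dimension two, and the point is not focal
(`IsNondegenerate.general_hasNonfocalPoint`).

*Degenerate conics.* The focal conic is degenerate iff some tangent direction has a line as its
focal locus; this is linear algebra of a pencil of maps `ℂ³ → ℂ²`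
(`exists_rank_one_of_degenerate`, `exists_vertex_of_rank_one`).

*Developable families.* The tangent vector of a developable family is a focal line direction since
the minors vanish by continuity. Conversely, where the focal line directions do not branch
(`HasFocalBranches`), they are the values of holomorphic vector fields, and the developable
families are the integral curves of these fields up to their parametrization. Existence and
uniqueness are therefore those of the solutions of a holomorphic differential equation
(`exists_analyticAt_hasDerivAt`, `exists_reparametrization`). If all directions are focal line
directions, every family is developable.
-/

noncomputable section

namespace PlaneCongruence

/-! ### Holomorphic ordinary differential equations -/

section ODE
variable {E : Type*} [NormedAddCommGroup E] [NormedSpace ℂ E] [CompleteSpace E]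

open Metric in
/-- Existence of holomorphic solutions of a Lipschitz holomorphic autonomous equation, by Picard
iteration on a disc. -/
theorem exists_hasDerivAt_of_lipschitz {F : E → E} {x₀ : E} {R : ℝ} (hR : 0 < R) {K : NNReal}
    (hL : LipschitzOnWith K F (closedBall x₀ R))
    (hd : ∀ x ∈ closedBall x₀ R, DifferentiableAt ℂ F x) :
    ∃ u : ℂ → E, u 0 = x₀ ∧ ∃ r > 0, ∀ z ∈ ball (0 : ℂ) r, HasDerivAt u (F (u z)) z := by
  have hx₀ : x₀ ∈ closedBall x₀ R := mem_closedBall_self hR.le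
  set B : ℝ := K * R + ‖F x₀‖ + 1 with hB
  have hB0 : 0 < B := by positivity
  have hFB : ∀ x ∈ closedBall x₀ R, ‖F x‖ ≤ B := by
    intro x hx
    have h1 : ‖F x - F x₀‖ ≤ K * ‖x - x₀‖ := hL.norm_sub_le hx hx₀
    have h2 : ‖x - x₀‖ ≤ R := by simpa [dist_eq_norm] using hx
    have h3 : ‖F x‖ ≤ ‖F x - F x₀‖ + ‖F x₀‖ := norm_le_norm_sub_add _ _
    have h4 : (K : ℝ) * ‖x - x₀‖ ≤ K * R := by gcongr
    linarith
  -- on the disc of this radius the iterates stay in the ball, and the iteration contracts by `1/2`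
  obtain ⟨r, hr, hrB, hrK⟩ : ∃ r : ℝ, 0 < r ∧ B * r ≤ R ∧ K * r ≤ 1 / 2 := by
    refine ⟨min (R / B) (1 / (2 * (K + 1))), by positivity, ?_, ?_⟩
    · calc B * min (R / B) (1 / (2 * (K + 1))) ≤ B * (R / B) := by gcongr; exact min_le_left _ _
        _ = R := by field_simp
    · calc (K : ℝ) * min (R / B) (1 / (2 * (K + 1))) ≤ K * (1 / (2 * (K + 1))) := by
            gcongr; exact min_le_right _ _
        _ ≤ 1 / 2 := by
            rw [mul_one_div, div_le_div_iff₀ (by positivity) (by positivity)]; linarith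
  let D := ball (0 : ℂ) r
  have h0D : (0 : ℂ) ∈ D := mem_ball_self hr
  let Good : (ℂ → E) → Prop := fun u => DifferentiableOn ℂ u D ∧ ∀ z ∈ D, u z ∈ closedBall x₀ R
  have step : ∀ u : {u // Good u}, ∃ v : {u // Good u}, v.1 0 = x₀ ∧
      ∀ z ∈ D, HasDerivAt v.1 (F (u.1 z)) z := by
    rintro ⟨u, hu1, hu2⟩
    have hFu : DifferentiableOn ℂ (fun z => F (u z)) D := fun z hz =>
      ((hd _ (hu2 z hz)).comp z
        (hu1.differentiableAt (isOpen_ball.mem_nhds hz))).differentiableWithinAt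
    obtain ⟨v, hv0, hv⟩ := (hFu.isExactOn_ball).with_val_at 0 x₀
    refine ⟨⟨v, fun z hz => (hv z hz).differentiableAt.differentiableWithinAt, fun z hz => ?_⟩,
      hv0, hv⟩
    have := (convex_ball (0 : ℂ) r).norm_image_sub_le_of_norm_hasDerivWithin_le
      (fun z hz => (hv z hz).hasDerivWithinAt) (fun z hz => hFB _ (hu2 z hz)) h0D hz
    rw [mem_closedBall, dist_eq_norm, ← hv0]
    have hz' : ‖z - 0‖ ≤ r := by simpa using (mem_ball_zero_iff.1 hz).le
    calc _ ≤ B * ‖z - 0‖ := this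
      _ ≤ B * r := by gcongr
      _ ≤ R := hrB
  choose T hT0 hT using step
  let u₀ : {u // Good u} := ⟨fun _ => x₀, differentiableOn_const _, fun _ _ => hx₀⟩
  let u : ℕ → {u // Good u} := fun n => T^[n] u₀
  have hus : ∀ n, u (n + 1) = T (u n) := fun n => Function.iterate_succ_apply' T n u₀
  have hdiff : ∀ n, ∀ z ∈ D, ‖(u (n + 1)).1 z - (u n).1 z‖ ≤ R * (1 / 2) ^ n := by
    intro n
    induction n with
    | zero =>
      intro z hz
      have := (u 1).2.2 z hz
      rw [mem_closedBall, dist_eq_norm] at this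
      simpa [u] using this
    | succ n ih =>
      intro z hz
      have h1 : ∀ z ∈ D, HasDerivWithinAt (fun z => (u (n + 2)).1 z - (u (n + 1)).1 z)
          (F ((u (n + 1)).1 z) - F ((u n).1 z)) D z := by
        intro z hz
        rw [hus (n + 1), hus n]
        exact ((hT _ z hz).sub (hT _ z hz)).hasDerivWithinAt
      have h2 : ∀ z ∈ D, ‖F ((u (n + 1)).1 z) - F ((u n).1 z)‖ ≤ K * (R * (1 / 2) ^ n) := by
        intro z hz
        refine (hL.norm_sub_le ((u (n + 1)).2.2 z hz) ((u n).2.2 z hz)).trans ?_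
        gcongr
        exact ih z hz
      have := (convex_ball (0 : ℂ) r).norm_image_sub_le_of_norm_hasDerivWithin_le h1 h2 h0D hz
      have e0 : (u (n + 2)).1 0 - (u (n + 1)).1 0 = 0 := by
        rw [hus (n + 1), hT0, hus n, hT0, sub_self]
      simp only [e0, sub_zero] at this
      have hz' : ‖z‖ ≤ r := (mem_ball_zero_iff.1 hz).le
      calc _ ≤ K * (R * (1 / 2) ^ n) * ‖z‖ := this
        _ ≤ K * (R * (1 / 2) ^ n) * r := by gcongr
        _ = (K * r) * (R * (1 / 2) ^ n) := by ring
        _ ≤ (1 / 2) * (R * (1 / 2) ^ n) := by gcongr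
        _ = R * (1 / 2) ^ (n + 1) := by ring
  have hcauchy : ∀ z ∈ D, CauchySeq fun n => (u n).1 z := fun z hz =>
    cauchySeq_of_le_geometric (1 / 2) R (by norm_num) fun n => by
      rw [dist_comm, dist_eq_norm]; exact hdiff n z hz
  let U : ℂ → E := fun z => limUnder atTop fun n => (u n).1 z
  have hlim : ∀ z ∈ D, Tendsto (fun n => (u n).1 z) atTop (𝓝 (U z)) := fun z hz =>
    (hcauchy z hz).tendsto_limUnder
  have hunif : TendstoUniformlyOn (fun n => (u n).1) U atTop D := by
    rw [Metric.tendstoUniformlyOn_iff]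
    intro ε hε
    have ht : Tendsto (fun n : ℕ => R * (1 / 2 : ℝ) ^ n / (1 - 1 / 2)) atTop (𝓝 0) := by
      have := (tendsto_pow_atTop_nhds_zero_of_lt_one (r := (1 / 2 : ℝ)) (by norm_num)
        (by norm_num)).const_mul R |>.div_const (1 - 1 / 2)
      simpa using this
    filter_upwards [ht.eventually (gt_mem_nhds hε)] with n hn z hz
    rw [dist_comm]
    refine lt_of_le_of_lt (dist_le_of_le_geometric_of_tendsto (1 / 2) R (by norm_num)
      (fun n => ?_) (hlim z hz) n) hn
    rw [dist_comm, dist_eq_norm]; exact hdiff n z hz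
  have hUD : DifferentiableOn ℂ U D := hunif.tendstoLocallyUniformlyOn.differentiableOn
    (Eventually.of_forall fun n => (u n).2.1) isOpen_ball
  have hUmem : ∀ z ∈ D, U z ∈ closedBall x₀ R := fun z hz =>
    isClosed_closedBall.mem_of_tendsto (hlim z hz) (Eventually.of_forall fun n => (u n).2.2 z hz)
  refine ⟨U, ?_, r, hr, fun z hz => ?_⟩
  · have h1 : Tendsto (fun n => (u (n + 1)).1 0) atTop (𝓝 (U 0)) :=
      (hlim 0 h0D).comp (tendsto_add_atTop_nat 1)
    have h2 : (fun n => (u (n + 1)).1 0) = fun _ => x₀ := by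
      funext n; rw [hus n, hT0]
    rw [h2] at h1
    exact tendsto_nhds_unique h1 tendsto_const_nhds |>.symm ▸ rfl
  · have hda := hUD.differentiableAt (isOpen_ball.mem_nhds hz)
    have h1 : Tendsto (fun n => deriv (u (n + 1)).1 z) atTop (𝓝 (deriv U z)) :=
      ((hunif.tendstoLocallyUniformlyOn.deriv (Eventually.of_forall fun n => (u n).2.1)
        isOpen_ball).tendsto_at hz).comp (tendsto_add_atTop_nat 1)
    have h2 : (fun n => deriv (u (n + 1)).1 z) = fun n => F ((u n).1 z) := by
      funext n; rw [hus n]; exact (hT _ z hz).deriv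
    have h3 : Tendsto (fun n => F ((u n).1 z)) atTop (𝓝 (F (U z))) :=
      ((hd _ (hUmem z hz)).continuousAt.tendsto).comp (hlim z hz)
    rw [h2] at h1
    rw [← tendsto_nhds_unique h1 h3]
    exact hda.hasDerivAt

theorem exists_analyticAt_hasDerivAt {F : E → E} {x₀ : E} (hF : ContDiffAt ℂ 1 F x₀) :
    ∃ u : ℂ → E, AnalyticAt ℂ u 0 ∧ u 0 = x₀ ∧ ∀ᶠ z in 𝓝 (0 : ℂ), HasDerivAt u (F (u z)) z := by
  obtain ⟨K, s, hs, hl⟩ := hF.exists_lipschitzOnWith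
  have hd : ∀ᶠ x in 𝓝 x₀, DifferentiableAt ℂ F x :=
    (hF.eventually (by simp)).mono fun x hx => hx.differentiableAt (by simp)
  obtain ⟨R, hR, hRs⟩ := Metric.nhds_basis_closedBall.mem_iff.1 (inter_mem hs hd)
  obtain ⟨u, hu0, r, hr, hu⟩ := exists_hasDerivAt_of_lipschitz hR
    (hl.mono fun x hx => (hRs hx).1) (fun x hx => (hRs hx).2)
  have hb : Metric.ball (0 : ℂ) r ∈ 𝓝 (0 : ℂ) := Metric.ball_mem_nhds _ hr
  refine ⟨u, ?_, hu0, eventually_of_mem hb hu⟩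
  exact (show DifferentiableOn ℂ u (Metric.ball 0 r) from fun z hz =>
    (hu z hz).differentiableAt.differentiableWithinAt).analyticAt hb

/-- Local uniqueness: two solutions of `γ' = α • F(γ)` with the same initial value agree. Where the
difference does not vanish identically, it has a zero of finite positive order at `0`, and its
derivative is not bounded by a multiple of it. -/
theorem eventuallyEq_of_hasDerivAt {F : E → E} {x₀ : E} (hF : ContDiffAt ℂ 1 F x₀)
    {α : ℂ → ℂ} (hα : ContinuousAt α 0) {u v : ℂ → E} (hu : AnalyticAt ℂ u 0)
    (hv : AnalyticAt ℂ v 0) (hu0 : u 0 = x₀) (hv0 : v 0 = x₀)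
    (hu' : ∀ᶠ z in 𝓝 (0 : ℂ), HasDerivAt u (α z • F (u z)) z)
    (hv' : ∀ᶠ z in 𝓝 (0 : ℂ), HasDerivAt v (α z • F (v z)) z) : u =ᶠ[𝓝 0] v := by
  obtain ⟨K, s, hs, hl⟩ := hF.exists_lipschitzOnWith
  set e : ℂ → E := fun z => u z - v z with he
  have hea : AnalyticAt ℂ e 0 := hu.sub hv
  have hbd : ∀ᶠ z in 𝓝 (0 : ℂ), ‖deriv e z‖ ≤ (‖α 0‖ + 1) * K * ‖e z‖ := by
    have h1 : ∀ᶠ z in 𝓝 (0 : ℂ), u z ∈ s :=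
      hu.continuousAt.eventually (by rw [hu0]; exact hs)
    have h2 : ∀ᶠ z in 𝓝 (0 : ℂ), v z ∈ s :=
      hv.continuousAt.eventually (by rw [hv0]; exact hs)
    have h3 : ∀ᶠ z in 𝓝 (0 : ℂ), ‖α z‖ < ‖α 0‖ + 1 :=
      hα.norm.eventually (gt_mem_nhds (by linarith))
    filter_upwards [h1, h2, h3, hu', hv'] with z h1 h2 h3 h4 h5
    have h6 : deriv e z = α z • F (u z) - α z • F (v z) := (h4.sub h5).deriv
    rw [h6, ← smul_sub, norm_smul, mul_assoc]
    gcongr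
    exact hl.norm_sub_le h1 h2
  by_cases hz : ∀ᶠ z in 𝓝 (0 : ℂ), e z = 0
  · exact hz.mono fun z hz => sub_eq_zero.1 hz
  exfalso
  obtain ⟨n, w, hw, hw0, hew⟩ := hea.exists_eventuallyEq_pow_smul_nonzero_iff.2 hz
  have he0 : e 0 = 0 := by simp [he, hu0, hv0]
  have hn : n ≠ 0 := by
    rintro rfl
    have := hew.self_of_nhds
    simp [he0] at this
    exact hw0 this.symm
  obtain ⟨m, rfl⟩ := Nat.exists_eq_succ_of_ne_zero hn
  -- divide the bound on the derivative by `z ^ m` and let `z` tend to `0`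
  have hd : ∀ᶠ z in 𝓝 (0 : ℂ), deriv e z = z ^ m • ((m + 1 : ℂ) • w z + z • deriv w z) := by
    filter_upwards [hew.eventually_nhds, hw.eventually_analyticAt] with z h1 h2
    have h1' : e =ᶠ[𝓝 z] fun z => z ^ (m + 1) • w z := by
      filter_upwards [h1] with y hy; simpa using hy
    rw [h1'.deriv_eq]
    have := ((hasDerivAt_pow (m + 1) z).smul h2.differentiableAt.hasDerivAt).deriv
    rw [show (fun z => z ^ (m + 1) • w z) = ((fun z : ℂ => z ^ (m + 1)) • w) from rfl, this]
    simp only [Nat.add_sub_cancel, Nat.cast_add, Nat.cast_one, smul_add, smul_smul]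
    rw [add_comm]; congr 1
    ring_nf
  have hq : ∀ᶠ z in 𝓝[≠] (0 : ℂ),
      ‖(m + 1 : ℂ) • w z + z • deriv w z‖ ≤ (‖α 0‖ + 1) * K * (‖z‖ * ‖w z‖) := by
    filter_upwards [hd.filter_mono nhdsWithin_le_nhds, hbd.filter_mono nhdsWithin_le_nhds,
      hew.filter_mono nhdsWithin_le_nhds, self_mem_nhdsWithin] with z h1 h2 h3 h4
    rw [h1, h3, norm_smul, norm_smul] at h2
    have hz0 : 0 < ‖z ^ m‖ := norm_pos_iff.2 (pow_ne_zero _ h4)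
    simp only [sub_zero, pow_succ, norm_mul] at h2
    refine le_of_mul_le_mul_left ?_ hz0
    calc _ ≤ _ := h2
      _ = _ := by ring
  have hc1 : ContinuousAt (fun z => ‖(m + 1 : ℂ) • w z + z • deriv w z‖) 0 :=
    ((hw.continuousAt.const_smul _).add (continuousAt_id.smul hw.deriv.continuousAt)).norm
  have hc2 : ContinuousAt (fun z => (‖α 0‖ + 1) * K * (‖z‖ * ‖w z‖)) 0 :=
    continuousAt_const.mul (continuousAt_id.norm.mul hw.continuousAt.norm)
  have := le_of_tendsto_of_tendsto (hc1.tendsto.mono_left nhdsWithin_le_nhds)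
    (hc2.tendsto.mono_left nhdsWithin_le_nhds) hq
  have h0 : (m + 1 : ℂ) • w 0 ≠ 0 := smul_ne_zero (by exact_mod_cast Nat.succ_ne_zero m) hw0
  simp only [zero_smul, add_zero, norm_zero, zero_mul, mul_zero, norm_le_zero_iff] at this
  exact h0 this

/-- Two curves which are tangent to the same vector field, and start at the same point with
nonzero speed, differ by a change of the parameter. -/
theorem exists_reparametrization {F : E → E} {x₀ : E} (hF : ContDiffAt ℂ 1 F x₀)
    {α β : ℂ → ℂ} (hα : AnalyticAt ℂ α 0) (hβ : AnalyticAt ℂ β 0) (hα0 : α 0 ≠ 0) (hβ0 : β 0 ≠ 0)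
    {u v : ℂ → E} (hu : AnalyticAt ℂ u 0) (hv : AnalyticAt ℂ v 0) (hu0 : u 0 = x₀) (hv0 : v 0 = x₀)
    (hu' : ∀ᶠ z in 𝓝 (0 : ℂ), HasDerivAt u (α z • F (u z)) z)
    (hv' : ∀ᶠ z in 𝓝 (0 : ℂ), HasDerivAt v (β z • F (v z)) z) :
    ∃ r : ℂ → ℂ, AnalyticAt ℂ r 0 ∧ r 0 = 0 ∧ deriv r 0 ≠ 0 ∧ ∀ᶠ t in 𝓝 (0 : ℂ), v t = u (r t) := by
  -- the parameter change solves `r' = β(t) / α(r)`, an autonomous equation for the pair `(t, r)`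
  let G : ℂ × ℂ → ℂ × ℂ := fun p => (1, β p.1 / α p.2)
  have hG : ContDiffAt ℂ 1 G (0, 0) := by
    refine contDiffAt_const.prodMk (ContDiffAt.div ?_ ?_ hα0)
    · exact ContDiffAt.comp (g := β) (0, 0) hβ.contDiffAt contDiffAt_fst
    · exact ContDiffAt.comp (g := α) (0, 0) hα.contDiffAt contDiffAt_snd
  obtain ⟨p, hpa, hp0, hp⟩ := exists_analyticAt_hasDerivAt hG
  have ha1 : AnalyticAt ℂ (fun t => (p t).1) 0 := (analyticAt_fst).comp hpa
  have ha2 : AnalyticAt ℂ (fun t => (p t).2) 0 := (analyticAt_snd).comp hpa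
  have hp1 : ∀ᶠ t in 𝓝 (0 : ℂ), (p t).1 = t := by
    have := eventuallyEq_of_hasDerivAt (F := fun _ : ℂ => (1 : ℂ)) (x₀ := 0) contDiffAt_const
      (α := fun _ => 1) continuousAt_const ha1 analyticAt_id (by simp [hp0]) rfl
      (by filter_upwards [hp] with t ht
          simpa [G, Function.comp_def] using
            ((ContinuousLinearMap.fst ℂ ℂ ℂ).hasFDerivAt.comp_hasDerivAt t ht))
      (by filter_upwards with t; simpa using hasDerivAt_id t)
    exact this
  have hp2 : ∀ᶠ t in 𝓝 (0 : ℂ), HasDerivAt (fun t => (p t).2) (β t / α (p t).2) t := by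
    filter_upwards [hp, hp1] with t ht h1
    have := ((ContinuousLinearMap.snd ℂ ℂ ℂ).hasFDerivAt.comp_hasDerivAt t ht)
    simpa [G, h1, Function.comp_def] using this
  have hr0 : (p 0).2 = 0 := by simp [hp0]
  have hrc : Tendsto (fun t => (p t).2) (𝓝 0) (𝓝 0) := by
    have := ha2.continuousAt.tendsto; rwa [hr0] at this
  refine ⟨fun t => (p t).2, ha2, hr0, ?_, ?_⟩
  · rw [hp2.self_of_nhds.deriv, hr0]; exact div_ne_zero hβ0 hα0
  · refine eventuallyEq_of_hasDerivAt hF hβ.continuousAt hv ?_ hv0 (by simp [hr0, hu0]) hv' ?_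
    · exact AnalyticAt.comp (g := u) (by rwa [hr0]) ha2
    · filter_upwards [hp2, hrc.eventually hu', hrc.eventually (hα.continuousAt.eventually_ne hα0)]
        with t h1 h2 h3
      have := h2.scomp t h1
      rwa [smul_smul, div_mul_cancel₀ _ h3] at this

end ODE

/-! ### Extension of derivations -/

open scoped TensorProduct in
/-- Derivations extend along formally smooth maps to a field, since the cotangent sequence is then
split injective. -/
theorem exists_derivation_extension {k R K : Type} [CommRing k] [CommRing R] [Field K] [Algebra k R]
    [Algebra R K] [Algebra k K] [IsScalarTower k R K] [Algebra.FormallySmooth R K]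
    (d : Derivation k R K) : ∃ D : Derivation k K K, ∀ x : R, D (algebraMap R K x) = d x := by
  have hinj : Function.Injective (KaehlerDifferential.mapBaseChange k R K) := by
    rw [injective_iff_map_eq_zero]
    intro x hx
    obtain ⟨y, rfl⟩ := (Algebra.H1Cotangent.exact_δ_mapBaseChange k R K x).1 hx
    rw [Subsingleton.elim y 0, map_zero]
  let ℓ : K ⊗[R] Ω[R⁄k] →ₗ[K] K := (d.liftKaehlerDifferential).liftBaseChange K
  obtain ⟨p, hp⟩ := LinearMap.exists_leftInverse_of_injective
    (KaehlerDifferential.mapBaseChange k R K) (LinearMap.ker_eq_bot.2 hinj)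
  refine ⟨(ℓ ∘ₗ p).compDer (KaehlerDifferential.D k K), fun x => ?_⟩
  have h1 : KaehlerDifferential.D k K (algebraMap R K x) =
      KaehlerDifferential.mapBaseChange k R K (1 ⊗ₜ KaehlerDifferential.D k R x) := by simp
  have h2 := LinearMap.congr_fun hp (1 ⊗ₜ KaehlerDifferential.D k R x)
  simp only [LinearMap.comp_apply, LinearMap.id_apply] at h2
  change ℓ (p (KaehlerDifferential.D k K (algebraMap R K x))) = d x
  rw [h1, h2]
  simp [ℓ]

/-- In characteristic zero, the partial derivatives extend from a polynomial ring to a finitely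
generated field over it. -/
theorem exists_derivation_of_injective {k K ι : Type} [Field k] [CharZero k] [Field K]
    [Algebra k K] [Algebra.EssFiniteType k K] (φ : MvPolynomial ι k →ₐ[k] K)
    (hφ : Function.Injective φ) (j : ι) :
    ∃ D : Derivation k K K, ∀ x, D (φ x) = φ (MvPolynomial.pderiv j x) := by
  let R := MvPolynomial ι k
  let _ : Algebra R K := φ.toRingHom.toAlgebra
  have : IsScalarTower k R K := IsScalarTower.of_algebraMap_eq fun x => (φ.commutes x).symm
  have : FaithfulSMul R K := (faithfulSMul_iff_algebraMap_injective R K).2 hφ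
  let _ : Algebra (FractionRing R) K := FractionRing.liftAlgebra R K
  have : IsScalarTower R (FractionRing R) K := inferInstance
  have : IsScalarTower k (FractionRing R) K := IsScalarTower.of_algebraMap_eq fun x => by
    rw [IsScalarTower.algebraMap_apply k R K, IsScalarTower.algebraMap_apply k R (FractionRing R),
      ← IsScalarTower.algebraMap_apply R (FractionRing R) K]
  have : CharZero (FractionRing R) := charZero_of_injective_algebraMap
    (FaithfulSMul.algebraMap_injective k (FractionRing R))
  have : Algebra.EssFiniteType (FractionRing R) K := Algebra.EssFiniteType.of_comp k _ _
  have : Algebra.FormallySmooth R (FractionRing R) := .of_isLocalization (nonZeroDivisors R)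
  have : Algebra.FormallySmooth R K := .comp R (FractionRing R) K
  let d : Derivation k R K := (Algebra.linearMap R K).compDer (MvPolynomial.pderiv j)
  obtain ⟨D, hD⟩ := exists_derivation_extension d
  exact ⟨D, hD⟩

/-! ### Polynomial functions of a triple of vectors -/

/-- A polynomial function of the fifteen coordinates of a triple of vectors. -/
def IsPoly (f : (Fin 3 → V) → ℂ) : Prop :=
  ∃ p : MvPolynomial (Fin 3 × Fin 5) ℂ, ∀ X, f X = MvPolynomial.eval (coords X) p

namespace IsPoly

variable {f g : (Fin 3 → V) → ℂ}

theorem eval (p : MvPolynomial (Fin 3 × Fin 5) ℂ) :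
    IsPoly fun X => MvPolynomial.eval (coords X) p := ⟨p, fun _ => rfl⟩

theorem const (c : ℂ) : IsPoly fun _ => c := ⟨MvPolynomial.C c, fun _ => by simp⟩

theorem coord (i : Fin 3) (j : Fin 5) : IsPoly fun X => X i j :=
  ⟨MvPolynomial.X (i, j), fun _ => by simp [coords]⟩

theorem add (hf : IsPoly f) (hg : IsPoly g) : IsPoly fun X => f X + g X := by
  obtain ⟨p, hp⟩ := hf; obtain ⟨q, hq⟩ := hg
  exact ⟨p + q, fun X => by simp [hp, hq]⟩

theorem mul (hf : IsPoly f) (hg : IsPoly g) : IsPoly fun X => f X * g X := by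
  obtain ⟨p, hp⟩ := hf; obtain ⟨q, hq⟩ := hg
  exact ⟨p * q, fun X => by simp [hp, hq]⟩

theorem sub (hf : IsPoly f) (hg : IsPoly g) : IsPoly fun X => f X - g X := by
  obtain ⟨p, hp⟩ := hf; obtain ⟨q, hq⟩ := hg
  exact ⟨p - q, fun X => by simp [hp, hq]⟩

theorem neg (hf : IsPoly f) : IsPoly fun X => -f X := by
  obtain ⟨p, hp⟩ := hf
  exact ⟨-p, fun X => by simp [hp]⟩

theorem sum {ι : Type*} {s : Finset ι} {f : ι → (Fin 3 → V) → ℂ} (h : ∀ i, IsPoly (f i)) :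
    IsPoly fun X => ∑ i ∈ s, f i X := by
  choose p hp using h
  exact ⟨∑ i ∈ s, p i, fun X => by simp [hp]⟩

theorem prod {ι : Type*} {s : Finset ι} {f : ι → (Fin 3 → V) → ℂ} (h : ∀ i, IsPoly (f i)) :
    IsPoly fun X => ∏ i ∈ s, f i X := by
  choose p hp using h
  exact ⟨∏ i ∈ s, p i, fun X => by simp [hp]⟩

theorem det {n : Type*} [Fintype n] [DecidableEq n] {M : (Fin 3 → V) → Matrix n n ℂ}
    (h : ∀ i j, IsPoly fun X => M X i j) : IsPoly fun X => (M X).det := by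
  simp only [Matrix.det_apply']
  exact sum fun σ => (const _).mul (prod fun i => h _ _)

theorem contDiff (hf : IsPoly f) {n : WithTop ℕ∞} : ContDiff ℂ n f := by
  obtain ⟨p, hp⟩ := hf
  rw [show f = _ from funext hp]
  clear hp
  induction p using MvPolynomial.induction_on with
  | C a => simpa using contDiff_const
  | add p q hp hq => simpa using hp.add hq
  | mul_X p n hp =>
    simp only [map_mul, MvPolynomial.eval_X, coords]
    exact hp.mul (contDiff_apply_apply ℂ ℂ n.1 n.2)

/-- The restriction of a polynomial function to a line is a polynomial. -/
theorem line (hf : IsPoly f) (X Y : Fin 3 → V) :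
    ∃ P : Polynomial ℂ, ∀ t : ℂ, f (X + t • Y) = P.eval t := by
  obtain ⟨p, hp⟩ := hf
  refine ⟨MvPolynomial.aeval (fun q : Fin 3 × Fin 5 =>
    Polynomial.C (X q.1 q.2) + Polynomial.X * Polynomial.C (Y q.1 q.2)) p, fun t => ?_⟩
  rw [hp, ← Polynomial.coe_evalRingHom, MvPolynomial.aeval_def, MvPolynomial.hom_eval₂]
  have h1 : (Polynomial.evalRingHom t).comp (algebraMap ℂ (Polynomial ℂ)) = RingHom.id ℂ :=
    RingHom.ext fun a => by simp
  have h2 : (fun q : Fin 3 × Fin 5 => Polynomial.evalRingHom t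
      (Polynomial.C (X q.1 q.2) + Polynomial.X * Polynomial.C (Y q.1 q.2))) = coords (X + t • Y) :=
    funext fun q => by simp [coords, mul_comm t]
  rw [h1, h2]
  rfl

end IsPoly

/-- A polynomial vector field on the space of triples of vectors. -/
def IsPolyField (w : (Fin 3 → V) → (Fin 3 → V)) : Prop := ∀ i j, IsPoly fun X => w X i j

theorem isPolyField_const (Y : Fin 3 → V) : IsPolyField fun _ => Y := fun _ _ => .const _

theorem isPolyField_id : IsPolyField fun X => X := .coord

namespace IsPolyField

variable {w v : (Fin 3 → V) → (Fin 3 → V)}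

theorem add (hw : IsPolyField w) (hv : IsPolyField v) : IsPolyField fun X => w X + v X :=
  fun i j => (hw i j).add (hv i j)

theorem sub (hw : IsPolyField w) (hv : IsPolyField v) : IsPolyField fun X => w X - v X :=
  fun i j => (hw i j).sub (hv i j)

theorem smul {f : (Fin 3 → V) → ℂ} (hf : IsPoly f) (hw : IsPolyField w) :
    IsPolyField fun X => f X • w X := fun i j => hf.mul (hw i j)

theorem sum {ι : Type*} {s : Finset ι} {w : ι → (Fin 3 → V) → (Fin 3 → V)}
    (h : ∀ k, IsPolyField (w k)) : IsPolyField fun X => ∑ k ∈ s, w k X := fun i j => by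
  simpa [Finset.sum_apply] using IsPoly.sum (s := s) fun k => h k i j

theorem linear (hw : IsPolyField w) (ℓ : (Fin 3 → V) →ₗ[ℂ] ℂ) : IsPoly fun X => ℓ (w X) := by
  have : ∀ Y : Fin 3 → V, ℓ Y = ∑ i, ∑ j, Y i j * ℓ (Pi.single i (Pi.single j 1)) := by
    intro Y
    have hY : Y = ∑ i, ∑ j, Y i j • (Pi.single i (Pi.single j 1) : Fin 3 → V) := by
      ext i j
      simp [Finset.sum_apply, Pi.single_apply, ite_apply]
    conv_lhs => rw [hY]
    simp
  rw [show (fun X => ℓ (w X)) = _ from funext fun X => this (w X)]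
  exact IsPoly.sum fun i => IsPoly.sum fun j => (hw i j).mul (.const _)

theorem linear_apply (hw : IsPolyField w) (ℓ : V →ₗ[ℂ] ℂ) (i : Fin 3) :
    IsPoly fun X => ℓ (w X i) := hw.linear (ℓ ∘ₗ LinearMap.proj i)

theorem contDiff (hw : IsPolyField w) {n : WithTop ℕ∞} : ContDiff ℂ n w :=
  contDiff_pi.2 fun i => contDiff_pi.2 fun j => (hw i j).contDiff

end IsPolyField

theorem IsPoly.comp_field {f : (Fin 3 → V) → ℂ} (hf : IsPoly f) {w : (Fin 3 → V) → (Fin 3 → V)}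
    (hw : IsPolyField w) : IsPoly fun X => f (w X) := by
  obtain ⟨p, hp⟩ := hf
  simp only [hp]
  clear hp
  induction p using MvPolynomial.induction_on with
  | C a => simpa using IsPoly.const a
  | add p q hp hq => simpa using hp.add hq
  | mul_X p n hp =>
    simp only [map_mul, MvPolynomial.eval_X, coords]
    exact hp.mul (hw _ _)

/-- The differential at `A` of a polynomial function on the space of triples. It extends `dPoly`
to triples which are not frames. -/
def differential (f : MvPolynomial (Fin 3 × Fin 5) ℂ) (X : Fin 3 → V) : (Fin 3 → V) →ₗ[ℂ] ℂ :=
  ∑ p : Fin 3 × Fin 5, MvPolynomial.eval (coords X) (MvPolynomial.pderiv p f) •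
    ((LinearMap.proj p.2 : V →ₗ[ℂ] ℂ) ∘ₗ (LinearMap.proj p.1 : (Fin 3 → V) →ₗ[ℂ] V))

theorem dPoly_eq_differential (f : MvPolynomial (Fin 3 × Fin 5) ℂ) (A : Frame) :
    dPoly f A = differential f A.vec := rfl

theorem differential_apply (f : MvPolynomial (Fin 3 × Fin 5) ℂ) (X Y : Fin 3 → V) :
    differential f X Y =
      ∑ p : Fin 3 × Fin 5, MvPolynomial.eval (coords X) (MvPolynomial.pderiv p f) * Y p.1 p.2 := by
  simp [differential]

theorem isPoly_differential (f : MvPolynomial (Fin 3 × Fin 5) ℂ)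
    {w : (Fin 3 → V) → (Fin 3 → V)} (hw : IsPolyField w) :
    IsPoly fun X => differential f X (w X) := by
  simp only [differential_apply]
  exact .sum fun p => (IsPoly.eval _).mul (hw _ _)

theorem hasDerivAt_eval (f : MvPolynomial (Fin 3 × Fin 5) ℂ) {u : ℂ → (Fin 3 → V)}
    {u' : Fin 3 → V} {t : ℂ} (hu : HasDerivAt u u' t) :
    HasDerivAt (fun s => MvPolynomial.eval (coords (u s)) f) (differential f (u t) u') t := by
  have hc : ∀ i j, HasDerivAt (fun s => u s i j) (u' i j) t := fun i j =>
    hasDerivAt_pi.1 (hasDerivAt_pi.1 hu i) j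
  simp only [differential_apply]
  induction f using MvPolynomial.induction_on with
  | C a => simpa using hasDerivAt_const t a
  | add p q hp hq =>
    simp only [map_add, add_mul, Finset.sum_add_distrib]
    exact hp.add hq
  | mul_X p n hp =>
    simp only [map_mul, MvPolynomial.eval_X]
    refine (hp.mul (hc n.1 n.2)).congr_deriv ?_
    symm
    simp only [Derivation.leibniz, smul_eq_mul, map_add, map_mul, MvPolynomial.eval_X, coords,
      MvPolynomial.pderiv_X, add_mul, Finset.sum_add_distrib, Finset.sum_mul]
    rw [add_comm]
    congr 1
    · exact Finset.sum_congr rfl fun _ _ => by ring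
    · rw [Finset.sum_eq_single n]
      · simp
      · intro b _ hb; simp [hb.symm]
      · simp

/-! ### Frames of a plane -/

/-- The triple `g X` obtained from `X` by a change of coordinates `g`. -/
def act (g : Matrix (Fin 3) (Fin 3) ℂ) : (Fin 3 → V) →ₗ[ℂ] (Fin 3 → V) where
  toFun X i := ∑ j, g i j • X j
  map_add' X Y := by ext i k; simp [Finset.sum_apply, Finset.sum_add_distrib]
  map_smul' c X := by
    ext i k; simp [Finset.sum_apply, Finset.mul_sum, mul_left_comm]

theorem act_apply (g : Matrix (Fin 3) (Fin 3) ℂ) (X : Fin 3 → V) (i : Fin 3) :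
    act g X i = ∑ j, g i j • X j := rfl

theorem act_one (X : Fin 3 → V) : act 1 X = X := by
  ext i k; simp [act_apply, Matrix.one_apply, Finset.sum_apply, ite_apply]

theorem act_mul (g h : Matrix (Fin 3) (Fin 3) ℂ) (X : Fin 3 → V) :
    act (g * h) X = act g (act h X) := by
  ext i k
  simp only [act_apply, Matrix.mul_apply, Finset.sum_smul, Finset.smul_sum, smul_smul]
  rw [Finset.sum_comm]

theorem isPolyField_act (g : Matrix (Fin 3) (Fin 3) ℂ) : IsPolyField (act g) := fun i j => by
  simp only [act_apply, Finset.sum_apply, Pi.smul_apply, smul_eq_mul]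
  exact .sum fun k => (IsPoly.const _).mul (.coord _ _)

theorem act_inv_act (g : GL (Fin 3) ℂ) (X : Fin 3 → V) : act ↑g⁻¹ (act g X) = X := by
  rw [← act_mul, ← Units.val_mul, inv_mul_cancel, Units.val_one, act_one]

theorem act_act_inv (g : GL (Fin 3) ℂ) (X : Fin 3 → V) : act g (act ↑g⁻¹ X) = X := by
  rw [← act_mul, ← Units.val_mul, mul_inv_cancel, Units.val_one, act_one]

theorem linearCombination_act (g : Matrix (Fin 3) (Fin 3) ℂ) (X : Fin 3 → V) (c : Fin 3 → ℂ) :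
    Fintype.linearCombination ℂ (act g X) c =
      Fintype.linearCombination ℂ X (Matrix.vecMul c g) := by
  simp only [Fintype.linearCombination_apply, act_apply, Finset.smul_sum, smul_smul,
    Matrix.vecMul, dotProduct, Finset.sum_smul]
  rw [Finset.sum_comm]

theorem act_mem_span (g : Matrix (Fin 3) (Fin 3) ℂ) (X : Fin 3 → V) (i : Fin 3) :
    act g X i ∈ Submodule.span ℂ (Set.range X) := by
  rw [act_apply]
  exact Submodule.sum_mem _ fun j _ => Submodule.smul_mem _ _
    (Submodule.subset_span (Set.mem_range_self j))

theorem span_act (g : GL (Fin 3) ℂ) (X : Fin 3 → V) :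
    Submodule.span ℂ (Set.range (act g X)) = Submodule.span ℂ (Set.range X) := by
  apply le_antisymm
  · exact Submodule.span_le.2 (Set.range_subset_iff.2 (act_mem_span (g : Matrix _ _ ℂ) X))
  · refine Submodule.span_le.2 (Set.range_subset_iff.2 fun i => ?_)
    have := act_mem_span ↑g⁻¹ (act g X) i
    rwa [act_inv_act] at this

theorem linearIndependent_iff_finrank (X : Fin 3 → V) :
    LinearIndependent ℂ X ↔ Module.finrank ℂ (Submodule.span ℂ (Set.range X)) = 3 := by
  rw [linearIndependent_iff_card_eq_finrank_span, Fintype.card_fin, Set.finrank, eq_comm]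

/-- The frame `g A` of the plane of `A`. -/
def Frame.act (g : GL (Fin 3) ℂ) (A : Frame) : Frame where
  vec := PlaneCongruence.act g A.vec
  linearIndependent := by
    rw [linearIndependent_iff_finrank, span_act]
    exact (linearIndependent_iff_finrank _).1 A.linearIndependent

@[simp] theorem Frame.act_vec (g : GL (Fin 3) ℂ) (A : Frame) :
    (A.act g).vec = PlaneCongruence.act g A.vec := rfl

theorem Frame.span_act (g : GL (Fin 3) ℂ) (A : Frame) : (A.act g).span = A.span :=
  PlaneCongruence.span_act g A.vec

theorem Frame.plane_act (g : GL (Fin 3) ℂ) (A : Frame) : (A.act g).plane = A.plane :=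
  Plane.ext (A.span_act g)

theorem Frame.vec_injective : Function.Injective Frame.vec := by
  rintro ⟨_, _⟩ ⟨_, _⟩ h
  cases h; rfl

theorem Frame.act_inv_act (g : GL (Fin 3) ℂ) (A : Frame) : (A.act g).act g⁻¹ = A :=
  Frame.vec_injective (PlaneCongruence.act_inv_act g A.vec)

theorem Frame.act_act_inv (g : GL (Fin 3) ℂ) (A : Frame) : (A.act g⁻¹).act g = A :=
  Frame.vec_injective (PlaneCongruence.act_act_inv g A.vec)

theorem Frame.vec_mem_span (A : Frame) (i : Fin 3) : A.vec i ∈ A.span :=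
  Submodule.subset_span ⟨i, rfl⟩

theorem Frame.plane_eq_of_mem_span {A B : Frame} (h : ∀ i, B.vec i ∈ A.span) : B.plane = A.plane :=
  Plane.ext (Submodule.eq_of_le_of_finrank_eq (Submodule.span_le.2 (Set.range_subset_iff.2 h))
    (B.plane.finrank_eq.trans A.plane.finrank_eq.symm))

theorem exists_act_of_mem_span (A : Frame) {X : Fin 3 → V} (hX : ∀ i, X i ∈ A.span) :
    ∃ g, X = act g A.vec := by
  choose c hc using fun i => (Submodule.mem_span_range_iff_exists_fun ℂ).1 (hX i)
  exact ⟨Matrix.of c, funext fun i => (hc i).symm⟩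

theorem Frame.exists_act_eq {A B : Frame} (h : B.plane = A.plane) :
    ∃ g : GL (Fin 3) ℂ, B = A.act g := by
  have hs : B.span = A.span := congrArg Plane.toSubmodule h
  obtain ⟨g, hg⟩ := exists_act_of_mem_span A (X := B.vec) fun i => hs ▸ B.vec_mem_span i
  obtain ⟨k, hk⟩ := exists_act_of_mem_span B (X := A.vec) fun i => hs ▸ A.vec_mem_span i
  have hkg : k * g = 1 := by
    have h1 : PlaneCongruence.act (k * g) A.vec = A.vec := by rw [act_mul, ← hg, ← hk]
    ext i j
    have h2 := congrFun h1 i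
    have h3 : ∑ j, ((k * g) i j - (1 : Matrix (Fin 3) (Fin 3) ℂ) i j) • A.vec j = 0 := by
      simp only [sub_smul, Finset.sum_sub_distrib]
      rw [← act_apply, ← act_apply, h2, act_one, sub_self]
    exact sub_eq_zero.1 (Fintype.linearIndependent_iff.1 A.linearIndependent _ h3 j)
  refine ⟨⟨g, k, mul_eq_one_comm.1 hkg, hkg⟩, Frame.vec_injective hg⟩

/-- A linear projection which sends a frame to the standard basis. -/
theorem Frame.exists_leftInverse (A : Frame) :
    ∃ P : V →ₗ[ℂ] (Fin 3 → ℂ), ∀ i, P (A.vec i) = Pi.single i 1 := by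
  obtain ⟨P, hP⟩ := LinearMap.exists_leftInverse_of_injective
    (Fintype.linearCombination ℂ A.vec) (LinearMap.ker_eq_bot.2
      A.linearIndependent.fintypeLinearCombination_injective)
  refine ⟨P, fun i => ?_⟩
  have := LinearMap.congr_fun hP (Pi.single i 1)
  simpa [Fintype.linearCombination_apply_single] using this

/-- The matrix of the images of a triple under a linear map to `ℂ³`. -/
def projMatrix (P : V →ₗ[ℂ] (Fin 3 → ℂ)) (X : Fin 3 → V) : Matrix (Fin 3) (Fin 3) ℂ :=
  Matrix.of fun i => P (X i)

theorem isPoly_det_projMatrix (P : V →ₗ[ℂ] (Fin 3 → ℂ)) : IsPoly fun X => (projMatrix P X).det :=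
  .det fun i j => isPolyField_id.linear_apply (LinearMap.proj j ∘ₗ P) i

theorem projMatrix_act (P : V →ₗ[ℂ] (Fin 3 → ℂ)) (g : Matrix (Fin 3) (Fin 3) ℂ) (X : Fin 3 → V) :
    projMatrix P (act g X) = g * projMatrix P X := by
  ext i j
  simp [projMatrix, act_apply, Matrix.mul_apply, Finset.sum_apply]

theorem linearIndependent_of_det_ne_zero {P : V →ₗ[ℂ] (Fin 3 → ℂ)} {X : Fin 3 → V}
    (h : (projMatrix P X).det ≠ 0) : LinearIndependent ℂ X :=
  LinearIndependent.of_comp P (Matrix.linearIndependent_rows_iff_isUnit.2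
    ((Matrix.isUnit_iff_isUnit_det _).2 (isUnit_iff_ne_zero.2 h)))

theorem projMatrix_eq_one {P : V →ₗ[ℂ] (Fin 3 → ℂ)} {X : Fin 3 → V}
    (h : ∀ i, P (X i) = Pi.single i 1) : projMatrix P X = 1 := by
  ext i j
  simp [projMatrix, h, Pi.single_apply, Matrix.one_apply, eq_comm]

/-! ### Properties of the general plane -/

/-- A polynomial function on the frames defines a Zariski open set of planes, also if it is not
invariant under a change of frame. -/
theorem isOpen_setOf_exists_frame {f : (Fin 3 → V) → ℂ} (hf : IsPoly f) :
    IsOpen {σ : Plane | ∃ B : Frame, B.plane = σ ∧ f B.vec ≠ 0} := by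
  rw [isOpen_coinduced]
  have : Frame.plane ⁻¹' {σ : Plane | ∃ B : Frame, B.plane = σ ∧ f B.vec ≠ 0} =
      ⋃ g : GL (Fin 3) ℂ, {A : Frame | f (act g A.vec) ≠ 0} := by
    ext A
    simp only [Set.mem_preimage, Set.mem_ofPred_eq, Set.mem_iUnion]
    constructor
    · rintro ⟨B, hB, h⟩
      obtain ⟨g, rfl⟩ := Frame.exists_act_eq hB
      exact ⟨g, h⟩
    · rintro ⟨g, h⟩
      exact ⟨A.act g, A.plane_act g, h⟩
  rw [this]
  refine isOpen_iUnion fun g => ?_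
  obtain ⟨p, hp⟩ := hf.comp_field (isPolyField_act g)
  refine isOpen_induced_iff.2 ⟨PrimeSpectrum.basicOpen p, PrimeSpectrum.isOpen_basicOpen, ?_⟩
  ext A
  simp [hp, MvPolynomial.pointToPoint, MvPolynomial.aeval_eq_eval]

/-- The usual way to establish a property of the general plane: by a polynomial function which does
not vanish identically, for a property which is independent of the frame. -/
theorem general_of_isPoly {S : Set Plane} {P : Frame → Prop} {f : (Fin 3 → V) → ℂ} (hf : IsPoly f)
    (hne : ∃ A : Frame, A.plane ∈ S ∧ f A.vec ≠ 0)
    (hP : ∀ A : Frame, A.plane ∈ S → f A.vec ≠ 0 → P A)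
    (hinv : ∀ (A : Frame) (g : GL (Fin 3) ℂ), P A → P (A.act g)) : General S P := by
  obtain ⟨A₀, hA₀, hfA₀⟩ := hne
  refine ⟨_, isOpen_setOf_exists_frame hf, ⟨A₀.plane, hA₀, A₀, rfl, hfA₀⟩, ?_⟩
  rintro A ⟨hAS, B, hB, hfB⟩
  obtain ⟨g, rfl⟩ := Frame.exists_act_eq hB.symm
  exact hinv B g (hP B (hB ▸ hAS) hfB)

theorem General.and {S : Set Plane} (hS : IsIrreducible S) {P Q : Frame → Prop}
    (hP : General S P) (hQ : General S Q) : General S fun A => P A ∧ Q A := by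
  obtain ⟨U, hU, hUS, hUP⟩ := hP
  obtain ⟨U', hU', hUS', hUQ⟩ := hQ
  exact ⟨U ∩ U', hU.inter hU', hS.2 U U' hU hU' hUS hUS', fun A hA =>
    ⟨hUP A ⟨hA.1, hA.2.1⟩, hUQ A ⟨hA.1, hA.2.2⟩⟩⟩

theorem General.mono {S : Set Plane} {P Q : Frame → Prop}
    (hP : General S P) (h : ∀ A : Frame, A.plane ∈ S → P A → Q A) : General S Q := by
  obtain ⟨U, hU, hUS, hUP⟩ := hP
  exact ⟨U, hU, hUS, fun A hA => h A hA.1 (hUP A hA)⟩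

theorem Plane.exists_frame (σ : Plane) : ∃ A : Frame, A.plane = σ := by
  obtain ⟨W, hW⟩ := σ
  let b := Module.finBasisOfFinrankEq ℂ W hW
  refine ⟨⟨fun i => b i, b.linearIndependent.map' W.subtype W.ker_subtype⟩, Plane.ext ?_⟩
  change Submodule.span ℂ (Set.range (W.subtype ∘ b)) = W
  rw [Set.range_comp, Submodule.span_image, b.span_eq, Submodule.map_top, Submodule.range_subtype]

theorem General.exists {S : Set Plane} {P : Frame → Prop} (hP : General S P) :
    ∃ A : Frame, A.plane ∈ S ∧ P A := by
  obtain ⟨U, -, ⟨σ, hσ⟩, h⟩ := hP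
  obtain ⟨A, rfl⟩ := σ.exists_frame
  exact ⟨A, hσ.1, h A hσ⟩

/-- The set of frames of the planes in an irreducible set is irreducible: two polynomial
functions which do not vanish identically on it are nonzero at a common frame. The frames of a given
plane are an open subset of the space of triples of its vectors, and a line in this space joins a
frame where the first function does not vanish to one where the second does not. -/
theorem exists_frame_mul_ne_zero {S : Set Plane} (hS : IsIrreducible S) {f g : (Fin 3 → V) → ℂ}
    (hf : IsPoly f) (hg : IsPoly g) (hfS : ∃ A : Frame, A.plane ∈ S ∧ f A.vec ≠ 0)
    (hgS : ∃ A : Frame, A.plane ∈ S ∧ g A.vec ≠ 0) :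
    ∃ A : Frame, A.plane ∈ S ∧ f A.vec * g A.vec ≠ 0 := by
  obtain ⟨A₁, h₁, hf₁⟩ := hfS
  obtain ⟨A₂, h₂, hg₂⟩ := hgS
  obtain ⟨σ, hσS, ⟨B, rfl, hB⟩, C, hC, hgC⟩ := hS.2 _ _ (isOpen_setOf_exists_frame hf)
    (isOpen_setOf_exists_frame hg) ⟨_, h₁, A₁, rfl, hf₁⟩ ⟨_, h₂, A₂, rfl, hg₂⟩
  obtain ⟨P, hP⟩ := B.exists_leftInverse
  obtain ⟨p, hp⟩ := hf.line B.vec (C.vec - B.vec)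
  obtain ⟨q, hq⟩ := hg.line B.vec (C.vec - B.vec)
  obtain ⟨d, hd⟩ := (isPoly_det_projMatrix P).line B.vec (C.vec - B.vec)
  have hp0 : p ≠ 0 := by
    rintro rfl; have := hp 0; simp at this; exact hB this
  have hq0 : q ≠ 0 := by
    rintro rfl; have := hq 1; simp at this; exact hgC this
  have hd0 : d ≠ 0 := by
    rintro rfl; have := hd 0; simp [projMatrix_eq_one hP] at this
  obtain ⟨t, ht⟩ : ∃ t, (p * q * d).eval t ≠ 0 := by
    by_contra! h
    exact mul_ne_zero (mul_ne_zero hp0 hq0) hd0 (Polynomial.funext fun t => by simpa using h t)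
  simp only [Polynomial.eval_mul, ← hp, ← hq, ← hd] at ht
  let D : Frame := ⟨_, linearIndependent_of_det_ne_zero (right_ne_zero_of_mul ht)⟩
  have hCB : C.span = B.span := congrArg Plane.toSubmodule hC
  have hD : D.plane = B.plane := Frame.plane_eq_of_mem_span fun i =>
    B.span.add_mem (B.vec_mem_span i) (B.span.smul_mem _
      (B.span.sub_mem (hCB ▸ C.vec_mem_span i) (B.vec_mem_span i)))
  exact ⟨D, hD ▸ hσS, left_ne_zero_of_mul ht⟩

/-! ### Pencils of linear maps from a three-dimensional to a two-dimensional space -/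

/-- The determinant of two vectors of `ℂ²`. -/
def det2 (u v : Fin 2 → ℂ) : ℂ := u 0 * v 1 - u 1 * v 0

theorem det2_add_left (u u' v : Fin 2 → ℂ) : det2 (u + u') v = det2 u v + det2 u' v := by
  simp [det2]; ring

theorem det2_add_right (u v v' : Fin 2 → ℂ) : det2 u (v + v') = det2 u v + det2 u v' := by
  simp [det2]; ring

theorem det2_smul_left (c : ℂ) (u v : Fin 2 → ℂ) : det2 (c • u) v = c * det2 u v := by
  simp [det2]; ring

theorem det2_smul_right (c : ℂ) (u v : Fin 2 → ℂ) : det2 u (c • v) = c * det2 u v := by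
  simp [det2]; ring

@[simp] theorem det2_zero_left (v : Fin 2 → ℂ) : det2 0 v = 0 := by simp [det2]

@[simp] theorem det2_zero_right (u : Fin 2 → ℂ) : det2 u 0 = 0 := by simp [det2]

@[simp] theorem det2_self (u : Fin 2 → ℂ) : det2 u u = 0 := by simp [det2]; ring

/-- `det2` as a bilinear form. -/
def det2Bilin : (Fin 2 → ℂ) →ₗ[ℂ] (Fin 2 → ℂ) →ₗ[ℂ] ℂ :=
  LinearMap.mk₂ ℂ det2 det2_add_left det2_smul_left det2_add_right det2_smul_right

@[simp] theorem det2Bilin_apply (u v : Fin 2 → ℂ) : det2Bilin u v = det2 u v := rfl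

theorem exists_eq_smul_of_det2_eq_zero {u v : Fin 2 → ℂ} (hu : u ≠ 0) (h : det2 u v = 0) :
    ∃ c : ℂ, v = c • u := by
  simp only [det2] at h
  by_cases h0 : u 0 = 0
  · have h1 : u 1 ≠ 0 := fun h1 => hu (by ext i; fin_cases i <;> simp [h0, h1])
    refine ⟨v 1 / u 1, ?_⟩
    have hv : v 0 = 0 := by
      rw [h0, zero_mul, zero_sub, neg_eq_zero] at h
      exact (mul_eq_zero.1 h).resolve_left h1
    ext i; fin_cases i
    · simp [h0, hv]
    · simp [h1]
  · refine ⟨v 0 / u 0, ?_⟩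
    ext i; fin_cases i
    · simp [h0]
    · simp only [Fin.mk_one, Fin.isValue, Pi.smul_apply, smul_eq_mul]
      field_simp
      linear_combination h

theorem exists_smul_add_smul_eq_zero {u v : Fin 2 → ℂ} (h : det2 u v = 0) :
    ∃ s t : ℂ, (s ≠ 0 ∨ t ≠ 0) ∧ s • u + t • v = 0 := by
  by_cases hu : u = 0
  · exact ⟨1, 0, by simp, by simp [hu]⟩
  · obtain ⟨c, rfl⟩ := exists_eq_smul_of_det2_eq_zero hu h
    exact ⟨c, -1, by simp, by simp⟩

theorem eq_zero_of_det2_ne_zero {u v : Fin 2 → ℂ} (h : det2 u v ≠ 0) {s t : ℂ}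
    (hst : s • u + t • v = 0) : s = 0 ∧ t = 0 := by
  have h1 : s * det2 u v = 0 := by
    have := congrArg (fun w => det2 w v) hst
    simpa [det2_add_left, det2_smul_left] using this
  have h2 : t * det2 u v = 0 := by
    have := congrArg (fun w => det2 u w) hst
    simpa [det2_add_right, det2_smul_right] using this
  exact ⟨(mul_eq_zero.1 h1).resolve_right h, (mul_eq_zero.1 h2).resolve_right h⟩

/-- A binary quadratic form over `ℂ` has a nontrivial zero. -/
theorem exists_binary_quadratic_zero (a b c : ℂ) :
    ∃ s t : ℂ, (s ≠ 0 ∨ t ≠ 0) ∧ a * s ^ 2 + b * (s * t) + c * t ^ 2 = 0 := by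
  by_cases ha : a = 0
  · exact ⟨1, 0, by simp, by simp [ha]⟩
  · obtain ⟨d, hd⟩ := IsAlgClosed.exists_pow_nat_eq (b ^ 2 - 4 * a * c) (n := 2) (by norm_num)
    refine ⟨(-b + d) / (2 * a), 1, by simp, ?_⟩
    field_simp
    linear_combination hd

/-- A linear map `ℂ³ → ℂ²` has a kernel of dimension two iff it is nonzero and its minors vanish. -/
theorem finrank_ker_eq_two_iff (f : (Fin 3 → ℂ) →ₗ[ℂ] (Fin 2 → ℂ)) :
    Module.finrank ℂ (LinearMap.ker f) = 2 ↔ f ≠ 0 ∧ ∀ x y, det2 (f x) (f y) = 0 := by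
  have hrk := LinearMap.finrank_range_add_finrank_ker f
  rw [Module.finrank_fin_fun] at hrk
  have h1 : Module.finrank ℂ (LinearMap.ker f) = 2 ↔ Module.finrank ℂ (LinearMap.range f) = 1 := by
    omega
  rw [h1]
  constructor
  · intro h
    obtain ⟨v, hv0, hv⟩ := finrank_eq_one_iff'.1 h
    refine ⟨?_, fun x y => ?_⟩
    · rintro rfl
      obtain ⟨x, hx⟩ := v.2
      exact hv0 (Subtype.ext hx.symm)
    · obtain ⟨c, hc⟩ := hv ⟨f x, x, rfl⟩
      obtain ⟨d, hd⟩ := hv ⟨f y, y, rfl⟩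
      have hc' : f x = c • (v : Fin 2 → ℂ) := (congrArg Subtype.val hc).symm
      have hd' : f y = d • (v : Fin 2 → ℂ) := (congrArg Subtype.val hd).symm
      rw [hc', hd', det2_smul_left, det2_smul_right, det2_self, mul_zero, mul_zero]
  · rintro ⟨h0, h⟩
    obtain ⟨x, hx⟩ : ∃ x, f x ≠ 0 := by
      by_contra! h'; exact h0 (LinearMap.ext h')
    refine finrank_eq_one_iff'.2 ⟨⟨f x, x, rfl⟩, fun h' => hx (congrArg Subtype.val h'), ?_⟩
    rintro ⟨_, y, rfl⟩
    obtain ⟨c, hc⟩ := exists_eq_smul_of_det2_eq_zero hx (h x y)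
    exact ⟨c, Subtype.ext hc.symm⟩

/-- If the quadratic form `det (f x, g x)` is degenerate, with vertex `x₀`, then the pencil spanned
by `f` and `g` contains a map of rank at most one. A member of the pencil vanishing at `x₀` has this
property, unless the whole pencil vanishes at `x₀`; in that case the members are maps between
two-dimensional spaces, and some determinant vanishes. -/
theorem exists_rank_one_of_degenerate {f g : (Fin 3 → ℂ) →ₗ[ℂ] (Fin 2 → ℂ)} {x₀ : Fin 3 → ℂ}
    (hx₀ : x₀ ≠ 0) (h : ∀ y, det2 (f x₀) (g y) + det2 (f y) (g x₀) = 0) :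
    ∃ s t : ℂ, (s ≠ 0 ∨ t ≠ 0) ∧ ∀ x y, det2 ((s • f + t • g) x) ((s • f + t • g) y) = 0 := by
  have hq : det2 (f x₀) (g x₀) = 0 := by
    have := h x₀; rw [← two_mul] at this; simpa using this
  by_cases hv : f x₀ = 0 ∧ g x₀ = 0
  · obtain ⟨hf, hg⟩ := hv
    obtain ⟨k, hk⟩ : ∃ k, x₀ k ≠ 0 := by
      by_contra! h'; exact hx₀ (funext h')
    -- modulo `x₀`, every vector is a combination of two of the standard basis vectors
    have hdec : ∀ F : (Fin 3 → ℂ) →ₗ[ℂ] (Fin 2 → ℂ), F x₀ = 0 → ∀ x, ∃ c d : ℂ,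
        F x = c • F (Pi.single (k + 1) 1) + d • F (Pi.single (k + 2) 1) := by
      intro F hF x
      refine ⟨x (k + 1) - x k / x₀ k * x₀ (k + 1), x (k + 2) - x k / x₀ k * x₀ (k + 2), ?_⟩
      have hx : x = (x k / x₀ k) • x₀ + ((x (k + 1) - x k / x₀ k * x₀ (k + 1)) •
          (Pi.single (k + 1) 1 : Fin 3 → ℂ) +
          (x (k + 2) - x k / x₀ k * x₀ (k + 2)) • (Pi.single (k + 2) 1 : Fin 3 → ℂ)) := by
        ext i
        fin_cases k <;> fin_cases i <;> simp_all
      conv_lhs => rw [hx]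
      simp [hF]
    set e₁ : Fin 3 → ℂ := Pi.single (k + 1) 1
    set e₂ : Fin 3 → ℂ := Pi.single (k + 2) 1
    obtain ⟨s, t, hst, h0⟩ := exists_binary_quadratic_zero (det2 (f e₁) (f e₂))
      (det2 (f e₁) (g e₂) + det2 (g e₁) (f e₂)) (det2 (g e₁) (g e₂))
    refine ⟨s, t, hst, fun x y => ?_⟩
    have hF : (s • f + t • g) x₀ = 0 := by simp [hf, hg]
    obtain ⟨c, d, hx⟩ := hdec _ hF x
    obtain ⟨c', d', hy⟩ := hdec _ hF y
    have h1 : det2 ((s • f + t • g) e₁) ((s • f + t • g) e₂) = 0 := by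
      rw [← h0]
      simp only [LinearMap.add_apply, LinearMap.smul_apply, det2_add_left, det2_add_right,
        det2_smul_left, det2_smul_right]
      ring
    have h2 : det2 ((s • f + t • g) e₂) ((s • f + t • g) e₁) = 0 := by
      simp only [det2] at h1 ⊢
      linear_combination -h1
    rw [hx, hy]
    simp only [det2_add_left, det2_add_right, det2_smul_left, det2_smul_right, det2_self, h1, h2]
    ring
  · obtain ⟨s, t, hst, h0⟩ := exists_smul_add_smul_eq_zero hq
    refine ⟨s, t, hst, ?_⟩
    have h1 : ∀ y, det2 ((s • f + t • g) y) (f x₀) = 0 ∧ det2 ((s • f + t • g) y) (g x₀) = 0 := by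
      intro y
      have h2 := h y
      have e0 := congrFun h0 0
      have e1 := congrFun h0 1
      simp only [det2, LinearMap.add_apply, LinearMap.smul_apply, Pi.add_apply, Pi.smul_apply,
        smul_eq_mul, Pi.zero_apply] at h2 e0 e1 ⊢
      constructor
      · linear_combination (f y 0) * e1 - (f y 1) * e0 - t * h2
      · linear_combination (g y 0) * e1 - (g y 1) * e0 + s * h2
    have h3 : ∃ w : Fin 2 → ℂ, w ≠ 0 ∧ ∀ y, det2 w ((s • f + t • g) y) = 0 := by
      by_cases hf : f x₀ = 0
      · refine ⟨g x₀, fun hg => hv ⟨hf, hg⟩, fun y => ?_⟩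
        have := (h1 y).2; simp only [det2] at this ⊢; linear_combination -this
      · refine ⟨f x₀, hf, fun y => ?_⟩
        have := (h1 y).1; simp only [det2] at this ⊢; linear_combination -this
    obtain ⟨w, hw, hwy⟩ := h3
    intro x y
    obtain ⟨c, hc⟩ := exists_eq_smul_of_det2_eq_zero hw (hwy x)
    obtain ⟨d, hd⟩ := exists_eq_smul_of_det2_eq_zero hw (hwy y)
    rw [hc, hd, det2_smul_left, det2_smul_right, det2_self, mul_zero, mul_zero]

/-- If `f` has rank one, then the quadratic form `det (f x, g x)` is degenerate. -/
theorem exists_vertex_of_rank_one {f : (Fin 3 → ℂ) →ₗ[ℂ] (Fin 2 → ℂ)}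
    (g : (Fin 3 → ℂ) →ₗ[ℂ] (Fin 2 → ℂ)) (hf : Module.finrank ℂ (LinearMap.ker f) = 2) :
    ∃ x₀ ≠ 0, ∀ y, det2 (f x₀) (g y) + det2 (f y) (g x₀) = 0 := by
  obtain ⟨h0, h⟩ := (finrank_ker_eq_two_iff f).1 hf
  obtain ⟨z, hz⟩ : ∃ z, f z ≠ 0 := by
    by_contra! h'; exact h0 (LinearMap.ext h')
  have hk : LinearMap.ker ((det2Bilin (f z) ∘ₗ g).domRestrict (LinearMap.ker f)) ≠ ⊥ :=
    LinearMap.ker_ne_bot_of_finrank_lt (by rw [hf, Module.finrank_self]; norm_num)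
  obtain ⟨⟨x₀, hx₀⟩, hx, hne⟩ := Submodule.exists_mem_ne_zero_of_ne_bot hk
  refine ⟨x₀, fun h' => hne (Subtype.ext h'), fun y => ?_⟩
  obtain ⟨c, hc⟩ := exists_eq_smul_of_det2_eq_zero hz (h z y)
  have hx' : det2 (f z) (g x₀) = 0 := hx
  rw [LinearMap.mem_ker.1 hx₀, hc, det2_smul_left, hx']
  simp

/-! ### The characteristic map and the focal conic -/

theorem charMap_apply (A : Frame) (X : Fin 3 → V) (c : Fin 3 → ℂ) :
    charMap A X c = A.span.mkQ (Fintype.linearCombination ℂ X c) := rfl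

theorem charMap_single (A : Frame) (X : Fin 3 → V) (i : Fin 3) :
    charMap A X (Pi.single i 1) = A.span.mkQ (X i) := by
  rw [charMap_apply, Fintype.linearCombination_apply_single, one_smul]

theorem smul_charMap_combination (A : Frame) (c s t : ℂ) (X Y : Fin 3 → V) :
    c • charMap A (s • X + t • Y) = charMap A ((c * s) • X + (c * t) • Y) := by
  rw [← map_smul, smul_add, smul_smul, smul_smul]

theorem charMap_eq_zero_iff (A : Frame) (X : Fin 3 → V) :
    charMap A X = 0 ↔ ∀ i, X i ∈ A.span := by
  constructor
  · intro h i
    have := charMap_single A X i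
    rw [h, LinearMap.zero_apply] at this
    exact (Submodule.Quotient.mk_eq_zero _).1 this.symm
  · intro h
    refine LinearMap.pi_ext' fun i => LinearMap.ext_ring ?_
    simpa [charMap_single] using h i

theorem mem_frameTangentSpace {S : Set Plane} {A : Frame} {X : Fin 3 → V} :
    X ∈ frameTangentSpace S A ↔ ∀ f : MvPolynomial (Fin 3 × Fin 5) ℂ,
      (∀ B : Frame, B.plane ∈ S → MvPolynomial.eval (coords B.vec) f = 0) →
        differential f A.vec X = 0 := by
  simp [frameTangentSpace, dPoly_eq_differential]

/-- The velocity of a curve of frames of planes of `S` is a tangent vector. -/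
theorem mem_frameTangentSpace_of_hasDerivAt {S : Set Plane} {A : Frame} {u : ℂ → (Fin 3 → V)}
    {u' : Fin 3 → V} {t : ℂ} (hu : HasDerivAt u u' t) (h0 : u t = A.vec)
    (hS : ∀ᶠ s in 𝓝 t, ∃ B : Frame, B.vec = u s ∧ B.plane ∈ S) : u' ∈ frameTangentSpace S A := by
  refine mem_frameTangentSpace.2 fun f hf => ?_
  have h1 := hasDerivAt_eval f hu
  have h2 : (fun s => MvPolynomial.eval (coords (u s)) f) =ᶠ[𝓝 t] fun _ => 0 := by
    filter_upwards [hS] with s ⟨B, hB, hBS⟩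
    rw [← hB]; exact hf B hBS
  rw [← h0]
  exact h1.unique ((hasDerivAt_const t (0 : ℂ)).congr_of_eventuallyEq h2)

theorem hasDerivAt_line (X Y : Fin 3 → V) : HasDerivAt (fun t : ℂ => X + t • Y) Y 0 := by
  simpa using ((hasDerivAt_id (0 : ℂ)).smul_const Y).const_add X

theorem mem_frameTangentSpace_of_mem_span {S : Set Plane} {A : Frame} (hA : A.plane ∈ S)
    {X : Fin 3 → V} (hX : ∀ i, X i ∈ A.span) : X ∈ frameTangentSpace S A := by
  obtain ⟨P, hP⟩ := A.exists_leftInverse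
  have hd := hasDerivAt_line A.vec X
  refine mem_frameTangentSpace_of_hasDerivAt hd (by simp) ?_
  have hc : ContinuousAt (fun t : ℂ => (projMatrix P (A.vec + t • X)).det) 0 :=
    (isPoly_det_projMatrix P).contDiff (n := 0).continuous.continuousAt.comp
      (f := fun t : ℂ => A.vec + t • X)
      hd.continuousAt
  filter_upwards [hc.eventually_ne (y := (0 : ℂ)) (by simp [projMatrix_eq_one hP])] with t ht
  refine ⟨⟨_, linearIndependent_of_det_ne_zero ht⟩, rfl, ?_⟩
  rwa [Frame.plane_eq_of_mem_span (A := A)]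
  exact fun i => A.span.add_mem (A.vec_mem_span i) (A.span.smul_mem _ (hX i))

theorem Frame.finrank_quotient (A : Frame) : Module.finrank ℂ (V ⧸ A.span) = 2 := by
  have h1 := A.span.finrank_quotient_add_finrank
  have h2 : Module.finrank ℂ A.span = 3 := A.plane.finrank_eq
  rw [h2, Module.finrank_fin_fun] at h1
  omega

/-- Some coordinates on the quotient `ℂ⁵ / W`. -/
def Frame.quotientEquiv (A : Frame) : (V ⧸ A.span) ≃ₗ[ℂ] (Fin 2 → ℂ) :=
  (Module.finBasisOfFinrankEq ℂ _ A.finrank_quotient).equivFun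

theorem isFocalLine_iff {A : Frame} (κ : (V ⧸ A.span) ≃ₗ[ℂ] (Fin 2 → ℂ)) (φ : NormalSection A) :
    IsFocalLine A φ ↔ φ ≠ 0 ∧ ∀ x y, det2 (κ (φ x)) (κ (φ y)) = 0 := by
  have h1 : LinearMap.ker φ = LinearMap.ker (κ.toLinearMap ∘ₗ φ) := by
    rw [LinearEquiv.ker_comp]
  have h2 : φ = 0 ↔ κ.toLinearMap ∘ₗ φ = 0 := by
    constructor
    · rintro rfl; simp
    · intro h; exact LinearMap.ext fun x => κ.injective (by simpa using LinearMap.congr_fun h x)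
  rw [IsFocalLine, focalLocus, h1, finrank_ker_eq_two_iff, Ne, Ne, h2]
  rfl

theorem isFocalLineDirection_iff {S : Set Plane} {A : Frame} (κ : (V ⧸ A.span) ≃ₗ[ℂ] (Fin 2 → ℂ))
    (φ : NormalSection A) : IsFocalLineDirection S A φ ↔
      φ ∈ tangentSpace S A ∧ φ ≠ 0 ∧ ∀ x y, det2 (κ (φ x)) (κ (φ y)) = 0 := by
  rw [IsFocalLineDirection, isFocalLine_iff κ]
  tauto

/-- `det2` in coordinates on `ℂ⁵ / W`, as an alternating form. -/
theorem exists_alternatingMap_eq_det2 {A : Frame} (κ : (V ⧸ A.span) ≃ₗ[ℂ] (Fin 2 → ℂ)) :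
    ∃ ω : (V ⧸ A.span) [⋀^Fin 2]→ₗ[ℂ] ℂ, ∀ u v, ω ![u, v] = det2 (κ u) (κ v) := by
  refine ⟨(Matrix.detRowAlternating (R := ℂ) (n := Fin 2)).compLinearMap κ.toLinearMap,
    fun u v => ?_⟩
  change Matrix.det (Matrix.of fun i => κ (![u, v] i)) = _
  rw [Matrix.det_fin_two]
  simp [det2]

theorem exists_alternatingMap_eq_mul_det2 {A : Frame} (κ : (V ⧸ A.span) ≃ₗ[ℂ] (Fin 2 → ℂ))
    (ω : (V ⧸ A.span) [⋀^Fin 2]→ₗ[ℂ] ℂ) : ∃ c, ∀ u v, ω ![u, v] = c * det2 (κ u) (κ v) := by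
  let e := Module.Basis.ofEquivFun κ
  refine ⟨ω e, fun u v => ?_⟩
  conv_lhs => rw [AlternatingMap.eq_smul_basis_det e ω]
  rw [AlternatingMap.smul_apply, Module.Basis.det_apply, Matrix.det_fin_two, smul_eq_mul]
  simp [Module.Basis.toMatrix_apply, e, det2]
  ring_nf
  simp

theorem isMultipleDirection_iff {S : Set Plane} {A : Frame} (κ : (V ⧸ A.span) ≃ₗ[ℂ] (Fin 2 → ℂ))
    (φ : NormalSection A) : IsMultipleDirection S A φ ↔
      ∀ x y, det2 (κ (φ x)) (κ (φ y)) = 0 ∧ ∀ ψ ∈ tangentSpace S A,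
        det2 (κ (φ x)) (κ (ψ y)) + det2 (κ (ψ x)) (κ (φ y)) = 0 := by
  constructor
  · intro h x y
    obtain ⟨ω, hω⟩ := exists_alternatingMap_eq_det2 κ
    simpa [hω] using h ω x y
  · intro h ω x y
    obtain ⟨c, hc⟩ := exists_alternatingMap_eq_mul_det2 κ ω
    simp only [hc]
    refine ⟨by rw [(h x y).1, mul_zero], fun ψ hψ => ?_⟩
    rw [← mul_add, (h x y).2 ψ hψ, mul_zero]

theorem focalForm_apply (A : Frame) (w : Fin 2 → NormalSection A)
    (e : Module.Basis (Fin 2) ℂ (V ⧸ A.span)) (x : Fin 3 → ℂ) :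
    focalForm A w e x = det2 (e.equivFun (w 0 x)) (e.equivFun (w 1 x)) := by
  simp [focalForm, det2]

theorem polarBilin_focalForm_apply (A : Frame) (w : Fin 2 → NormalSection A)
    (e : Module.Basis (Fin 2) ℂ (V ⧸ A.span)) (x y : Fin 3 → ℂ) :
    QuadraticMap.polarBilin (focalForm A w e) x y = det2 (e.equivFun (w 0 x)) (e.equivFun (w 1 y)) +
      det2 (e.equivFun (w 0 y)) (e.equivFun (w 1 x)) := by
  rw [QuadraticMap.polarBilin_apply_apply, QuadraticMap.polar]
  simp only [focalForm_apply, map_add, det2_add_left, det2_add_right]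
  ring

/-- The tangent space is two-dimensional and there is a point of the plane which is not focal: at
this point, the characteristic map is injective. -/
def HasNonfocalPoint (S : Set Plane) (A : Frame) : Prop :=
  Module.finrank ℂ (tangentSpace S A) = 2 ∧
    ∃ c : Fin 3 → ℂ, ∀ φ ∈ tangentSpace S A, φ c = 0 → φ = 0

theorem nonempty_basis_of_finrank_eq_two {N : Type*} [AddCommGroup N] [Module ℂ N]
    (T : Submodule ℂ N) (h : Module.finrank ℂ T = 2) : Nonempty (Module.Basis (Fin 2) ℂ T) :=
  have : Module.Finite ℂ T := Module.finite_of_finrank_pos (by omega)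
  ⟨Module.finBasisOfFinrankEq ℂ T h⟩

theorem exists_eq_combination {N : Type*} [AddCommGroup N] [Module ℂ N]
    {T : Submodule ℂ N} (b : Module.Basis (Fin 2) ℂ T) {x : N} (hx : x ∈ T) :
    ∃ s t : ℂ, x = s • (b 0 : N) + t • (b 1 : N) := by
  have h1 := b.sum_repr ⟨x, hx⟩
  rw [Fin.sum_univ_two] at h1
  exact ⟨_, _, (congrArg Subtype.val h1).symm⟩

theorem combination_eq_zero {N : Type*} [AddCommGroup N] [Module ℂ N]
    {T : Submodule ℂ N} (b : Module.Basis (Fin 2) ℂ T) {s t : ℂ}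
    (h : s • (b 0 : N) + t • (b 1 : N) = 0) : s = 0 ∧ t = 0 := by
  have h1 := Fintype.linearIndependent_iff.1 b.linearIndependent ![s, t] (by
    rw [Fin.sum_univ_two]; exact Subtype.ext h)
  exact ⟨h1 0, h1 1⟩

theorem combination_mem {N : Type*} [AddCommGroup N] [Module ℂ N]
    {T : Submodule ℂ N} (b : Module.Basis (Fin 2) ℂ T) (s t : ℂ) :
    s • (b 0 : N) + t • (b 1 : N) ∈ T :=
  T.add_mem (T.smul_mem _ (b 0).2) (T.smul_mem _ (b 1).2)

theorem map_combination {A : Frame} (κ : (V ⧸ A.span) ≃ₗ[ℂ] (Fin 2 → ℂ)) (φ ψ : NormalSection A)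
    (s t : ℂ) (x : Fin 3 → ℂ) : κ ((s • φ + t • ψ) x) = s • κ (φ x) + t • κ (ψ x) := by
  rw [LinearMap.add_apply, LinearMap.smul_apply, LinearMap.smul_apply, map_add, map_smul, map_smul]

theorem IsFocalConic.hasNonfocalPoint {S : Set Plane} {A : Frame}
    {q : QuadraticForm ℂ (Fin 3 → ℂ)} (hq : IsFocalConic S A q) : HasNonfocalPoint S A := by
  obtain ⟨hq0, b, e, rfl⟩ := hq
  refine ⟨(Module.finrank_eq_card_basis b).trans (Fintype.card_fin 2), ?_⟩
  obtain ⟨c, hc⟩ : ∃ c, focalForm A (fun k => (b k : NormalSection A)) e c ≠ 0 := by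
    by_contra! h; exact hq0 (QuadraticMap.ext h)
  refine ⟨c, fun φ hφ hφc => ?_⟩
  obtain ⟨s, t, rfl⟩ := exists_eq_combination b hφ
  rw [focalForm_apply] at hc
  obtain ⟨rfl, rfl⟩ := eq_zero_of_det2_ne_zero hc (s := s) (t := t) (by
    rw [← map_combination, hφc, map_zero])
  rw [zero_smul, zero_smul, add_zero]

theorem HasNonfocalPoint.isFocalConic {S : Set Plane} {A : Frame} (h : HasNonfocalPoint S A)
    (b : Module.Basis (Fin 2) ℂ (tangentSpace S A)) (e : Module.Basis (Fin 2) ℂ (V ⧸ A.span)) :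
    IsFocalConic S A (focalForm A (fun k => (b k : NormalSection A)) e) := by
  obtain ⟨-, c, hc⟩ := h
  refine ⟨fun h0 => ?_, b, e, rfl⟩
  have h1 := focalForm_apply A (fun k => (b k : NormalSection A)) e c
  rw [h0, zero_apply] at h1
  obtain ⟨s, t, hst, h2⟩ := exists_smul_add_smul_eq_zero h1.symm
  rw [← map_combination] at h2
  have h4 := combination_eq_zero b
    (hc _ (combination_mem b s t) (e.equivFun.map_eq_zero_iff.1 h2))
  rcases hst with h5 | h5
  · exact h5 h4.1
  · exact h5 h4.2

/-- The equation of the focal locus does not vanish at a point iff the characteristic map is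
injective there, so that the focal locus is a conic iff some point is not focal. -/
theorem exists_isFocalConic_iff {S : Set Plane} {A : Frame} :
    (∃ q, IsFocalConic S A q) ↔ HasNonfocalPoint S A := by
  refine ⟨fun ⟨_, hq⟩ => hq.hasNonfocalPoint, fun h => ?_⟩
  obtain ⟨b⟩ := nonempty_basis_of_finrank_eq_two _ h.1
  exact ⟨_, h.isFocalConic b (Module.finBasisOfFinrankEq ℂ _ A.finrank_quotient)⟩

theorem isDegenerateConic_iff (q : QuadraticForm ℂ (Fin 3 → ℂ)) :
    IsDegenerateConic q ↔ ∃ x ≠ 0, ∀ y, QuadraticMap.polarBilin q x y = 0 := by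
  rw [IsDegenerateConic, LinearMap.SeparatingLeft]
  push Not
  exact ⟨fun ⟨x, h, h'⟩ => ⟨x, h', h⟩, fun ⟨x, h, h'⟩ => ⟨x, h', h⟩⟩

/-- The focal conic is degenerate iff some tangent direction has a line as its focal locus. -/
theorem hasDegenerateFocalConic_iff {S : Set Plane} {A : Frame} :
    HasDegenerateFocalConic S A ↔
      HasNonfocalPoint S A ∧ ∃ φ, IsFocalLineDirection S A φ := by
  constructor
  · rintro ⟨q, hq, hdeg⟩
    refine ⟨hq.hasNonfocalPoint, ?_⟩
    obtain ⟨-, b, e, rfl⟩ := hq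
    obtain ⟨x₀, hx₀, h⟩ := (isDegenerateConic_iff _).1 hdeg
    simp only [polarBilin_focalForm_apply] at h
    obtain ⟨s, t, hst, hrk⟩ := exists_rank_one_of_degenerate
      (f := e.equivFun.toLinearMap ∘ₗ (b 0 : NormalSection A))
      (g := e.equivFun.toLinearMap ∘ₗ (b 1 : NormalSection A)) hx₀ h
    refine ⟨s • (b 0 : NormalSection A) + t • (b 1 : NormalSection A),
      (isFocalLineDirection_iff e.equivFun _).2
        ⟨combination_mem b s t, fun h3 => ?_, fun x y => ?_⟩⟩
    · have h4 := combination_eq_zero b h3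
      rcases hst with h5 | h5
      · exact h5 h4.1
      · exact h5 h4.2
    · rw [map_combination, map_combination]
      exact hrk x y
  · rintro ⟨hN, φ, hφT, hφ0, hφ⟩
    obtain ⟨b⟩ := nonempty_basis_of_finrank_eq_two _ hN.1
    let e := Module.finBasisOfFinrankEq ℂ _ A.finrank_quotient
    refine ⟨_, hN.isFocalConic b e, (isDegenerateConic_iff _).2 ?_⟩
    simp only [polarBilin_focalForm_apply]
    have hf : Module.finrank ℂ (LinearMap.ker (e.equivFun.toLinearMap ∘ₗ φ)) = 2 := by
      rw [LinearEquiv.ker_comp]; exact hφ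
    obtain ⟨s, t, hst⟩ := exists_eq_combination b hφT
    generalize (b 0 : NormalSection A) = f at hst ⊢
    generalize (b 1 : NormalSection A) = g at hst ⊢
    have hev : ∀ x, e.equivFun (φ x) = s • e.equivFun (f x) + t • e.equivFun (g x) := fun x => by
      rw [hst, map_combination]
    by_cases hs : s = 0
    · have ht : t ≠ 0 := fun ht => hφ0 (by rw [hst, hs, ht, zero_smul, zero_smul, add_zero])
      obtain ⟨x₀, hx₀, h⟩ := exists_vertex_of_rank_one (e.equivFun.toLinearMap ∘ₗ f) hf
      refine ⟨x₀, hx₀, fun y => mul_left_cancel₀ ht ?_⟩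
      have := h y
      simp only [LinearMap.comp_apply, LinearEquiv.coe_coe, hev, hs, zero_smul, zero_add, det2,
        Pi.smul_apply, smul_eq_mul] at this ⊢
      linear_combination -this
    · obtain ⟨x₀, hx₀, h⟩ := exists_vertex_of_rank_one (e.equivFun.toLinearMap ∘ₗ g) hf
      refine ⟨x₀, hx₀, fun y => mul_left_cancel₀ hs ?_⟩
      have := h y
      simp only [LinearMap.comp_apply, LinearEquiv.coe_coe, hev, det2, Pi.smul_apply, Pi.add_apply,
        smul_eq_mul] at this ⊢
      linear_combination this

/-! ### Invariance under a change of frame -/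

theorem eval_act_eq (g : Matrix (Fin 3) (Fin 3) ℂ) (f : MvPolynomial (Fin 3 × Fin 5) ℂ) :
    ∃ f' : MvPolynomial (Fin 3 × Fin 5) ℂ,
      ∀ X, MvPolynomial.eval (coords (act g X)) f = MvPolynomial.eval (coords X) f' :=
  (IsPoly.eval f).comp_field (isPolyField_act g)

theorem act_mem_frameTangentSpace {S : Set Plane} {A : Frame} (g : GL (Fin 3) ℂ) {X : Fin 3 → V}
    (hX : X ∈ frameTangentSpace S A) : act g X ∈ frameTangentSpace S (A.act g) := by
  refine mem_frameTangentSpace.2 fun f hf => ?_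
  obtain ⟨f', hf'⟩ := eval_act_eq g f
  have h1 := mem_frameTangentSpace.1 hX f' fun B hB => by
    rw [← hf', ← Frame.act_vec]
    exact hf _ ((B.plane_act g).symm ▸ hB)
  have h2 := hasDerivAt_eval f' (hasDerivAt_line A.vec X)
  have h3 := hasDerivAt_eval f (hasDerivAt_line (act g A.vec) (act g X))
  simp only [← map_smul, ← map_add, hf'] at h3
  have h4 := h3.unique h2
  rw [zero_smul, add_zero] at h4
  rw [Frame.act_vec, h4, h1]

/-- The change of coordinates in the spaces of sections caused by a change of frame. -/
def transport (g : GL (Fin 3) ℂ) (A : Frame) : NormalSection A ≃ₗ[ℂ] NormalSection (A.act g) :=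
  LinearEquiv.arrowCongr
    (LinearEquiv.ofLinearMap (Matrix.vecMulLinear (↑g⁻¹ : Matrix (Fin 3) (Fin 3) ℂ))
      (Matrix.vecMulLinear (g : Matrix (Fin 3) (Fin 3) ℂ))
      (LinearMap.ext fun x => by
        simp [Matrix.vecMul_vecMul])
      (LinearMap.ext fun x => by
        simp [Matrix.vecMul_vecMul]))
    (Submodule.quotEquivOfEq _ _ (A.span_act g).symm)

theorem transport_apply (g : GL (Fin 3) ℂ) (A : Frame) (φ : NormalSection A) (x : Fin 3 → ℂ) :
    transport g A φ x =
      Submodule.quotEquivOfEq _ _ (A.span_act g).symm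
        (φ (Matrix.vecMul x (g : Matrix _ _ ℂ))) := rfl

theorem transport_charMap (g : GL (Fin 3) ℂ) (A : Frame) (X : Fin 3 → V) :
    transport g A (charMap A X) = charMap (A.act g) (act g X) := by
  refine LinearMap.ext fun x => ?_
  rw [transport_apply, charMap_apply, charMap_apply, linearCombination_act]
  rfl

theorem transport_mem_tangentSpace {S : Set Plane} {A : Frame} (g : GL (Fin 3) ℂ)
    {φ : NormalSection A} :
    transport g A φ ∈ tangentSpace S (A.act g) ↔ φ ∈ tangentSpace S A := by
  constructor
  · rintro ⟨Y, hY, h⟩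
    have h1 := act_mem_frameTangentSpace g⁻¹ hY
    rw [A.act_inv_act] at h1
    refine ⟨_, h1, (transport g A).injective ?_⟩
    rw [transport_charMap, act_act_inv, h]
  · rintro ⟨X, hX, rfl⟩
    exact ⟨act g X, act_mem_frameTangentSpace g hX, (transport_charMap g A X).symm⟩

/-- Coordinates on `ℂ⁵ / W` do not depend on the frame of `W`. -/
def transportCoord (g : GL (Fin 3) ℂ) {A : Frame} (κ : (V ⧸ A.span) ≃ₗ[ℂ] (Fin 2 → ℂ)) :
    (V ⧸ (A.act g).span) ≃ₗ[ℂ] (Fin 2 → ℂ) :=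
  (Submodule.quotEquivOfEq _ _ (A.span_act g)).trans κ

theorem transportCoord_transport (g : GL (Fin 3) ℂ) {A : Frame}
    (κ : (V ⧸ A.span) ≃ₗ[ℂ] (Fin 2 → ℂ)) (φ : NormalSection A) (x : Fin 3 → ℂ) :
    transportCoord g κ (transport g A φ x) = κ (φ (Matrix.vecMul x (g : Matrix _ _ ℂ))) := by
  rw [transport_apply, transportCoord, LinearEquiv.trans_apply]
  congr 1
  obtain ⟨v, hv⟩ := A.span.mkQ_surjective (φ (Matrix.vecMul x (g : Matrix _ _ ℂ)))
  rw [← hv]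
  rfl

theorem vecMul_surjective (g : GL (Fin 3) ℂ) :
    Function.Surjective fun x : Fin 3 → ℂ => Matrix.vecMul x (g : Matrix (Fin 3) (Fin 3) ℂ) :=
  fun x => ⟨Matrix.vecMul x (↑g⁻¹ : Matrix (Fin 3) (Fin 3) ℂ), by
    simp [Matrix.vecMul_vecMul]⟩

theorem isFocalLine_transport (g : GL (Fin 3) ℂ) {A : Frame} {φ : NormalSection A} :
    IsFocalLine (A.act g) (transport g A φ) ↔ IsFocalLine A φ := by
  rw [isFocalLine_iff A.quotientEquiv, isFocalLine_iff (transportCoord g A.quotientEquiv)]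
  simp only [transportCoord_transport, ne_eq, EmbeddingLike.map_eq_zero_iff]
  refine and_congr_right fun _ => ⟨fun h x y => ?_, fun h x y => h _ _⟩
  obtain ⟨x, rfl⟩ := vecMul_surjective g x
  obtain ⟨y, rfl⟩ := vecMul_surjective g y
  exact h x y

theorem isFocalLineDirection_transport {S : Set Plane} (g : GL (Fin 3) ℂ) {A : Frame}
    {φ : NormalSection A} :
    IsFocalLineDirection S (A.act g) (transport g A φ) ↔ IsFocalLineDirection S A φ := by
  rw [IsFocalLineDirection, IsFocalLineDirection, transport_mem_tangentSpace,
    isFocalLine_transport, ne_eq, EmbeddingLike.map_eq_zero_iff]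

theorem isMultipleDirection_transport {S : Set Plane} (g : GL (Fin 3) ℂ) {A : Frame}
    {φ : NormalSection A} :
    IsMultipleDirection S (A.act g) (transport g A φ) ↔ IsMultipleDirection S A φ := by
  rw [isMultipleDirection_iff A.quotientEquiv,
    isMultipleDirection_iff (transportCoord g A.quotientEquiv)]
  simp only [(transport g A).surjective.forall, transportCoord_transport,
    transport_mem_tangentSpace]
  refine ⟨fun h x y => ?_, fun h x y => h _ _⟩
  obtain ⟨x, rfl⟩ := vecMul_surjective g x
  obtain ⟨y, rfl⟩ := vecMul_surjective g y
  exact h x y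

theorem OneDirection.act {S : Set Plane} {A : Frame} (h : OneDirection S A) (g : GL (Fin 3) ℂ) :
    OneDirection S (A.act g) := by
  obtain ⟨φ, h1, h2, h3⟩ := h
  refine ⟨transport g A φ, (isFocalLineDirection_transport g).2 h1,
    fun h => h2 ((isMultipleDirection_transport g).1 h), (transport g A).surjective.forall.2
    fun ψ hψ => ?_⟩
  obtain ⟨c, rfl⟩ := h3 ψ ((isFocalLineDirection_transport g).1 hψ)
  exact ⟨c, map_smul _ _ _⟩

theorem TwoCoincidentDirections.act {S : Set Plane} {A : Frame} (h : TwoCoincidentDirections S A)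
    (g : GL (Fin 3) ℂ) : TwoCoincidentDirections S (A.act g) := by
  obtain ⟨φ, h1, h2, h3⟩ := h
  refine ⟨transport g A φ, (isFocalLineDirection_transport g).2 h1,
    (isMultipleDirection_transport g).2 h2, (transport g A).surjective.forall.2
    fun ψ hψ => ?_⟩
  obtain ⟨c, rfl⟩ := h3 ψ ((isFocalLineDirection_transport g).1 hψ)
  exact ⟨c, map_smul _ _ _⟩

theorem TwoDistinctDirections.act {S : Set Plane} {A : Frame} (h : TwoDistinctDirections S A)
    (g : GL (Fin 3) ℂ) : TwoDistinctDirections S (A.act g) := by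
  obtain ⟨φ₁, φ₂, h0, h1, h2, h3⟩ := h
  refine ⟨transport g A φ₁, transport g A φ₂, ?_, (isFocalLineDirection_transport g).2 h1,
    (isFocalLineDirection_transport g).2 h2, (transport g A).surjective.forall.2
    fun ψ hψ => ?_⟩
  · rw [LinearIndependent.pair_iff] at h0 ⊢
    intro s t hst
    refine h0 s t ((transport g A).injective ?_)
    rw [map_add, map_smul, map_smul, hst, map_zero]
  · rcases h3 ψ ((isFocalLineDirection_transport g).1 hψ) with ⟨c, rfl⟩ | ⟨c, rfl⟩
    · exact .inl ⟨c, map_smul _ _ _⟩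
    · exact .inr ⟨c, map_smul _ _ _⟩

theorem allDirections_act {S : Set Plane} {A : Frame} (g : GL (Fin 3) ℂ) :
    AllDirections S (A.act g) ↔ AllDirections S A := by
  rw [AllDirections, (transport g A).surjective.forall]
  simp only [transport_mem_tangentSpace, isFocalLineDirection_transport, ne_eq,
    EmbeddingLike.map_eq_zero_iff]
  rfl

theorem HasNonfocalPoint.act {S : Set Plane} {A : Frame} (h : HasNonfocalPoint S A)
    (g : GL (Fin 3) ℂ) : HasNonfocalPoint S (A.act g) := by
  obtain ⟨h1, c, hc⟩ := h
  have hmap : tangentSpace S (A.act g) = (tangentSpace S A).map (transport g A).toLinearMap := by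
    ext ψ
    obtain ⟨φ, rfl⟩ := (transport g A).surjective ψ
    rw [transport_mem_tangentSpace]
    exact ⟨fun h => ⟨φ, h, rfl⟩, fun ⟨φ', h, h'⟩ => (transport g A).injective h' ▸ h⟩
  refine ⟨?_, ?_⟩
  · rw [hmap]
    exact (LinearEquiv.finrank_map_eq (transport g A) _).trans h1
  · obtain ⟨d, hd⟩ := vecMul_surjective g c
    refine ⟨d, (transport g A).surjective.forall.2 fun φ hφ h => ?_⟩
    rw [transport_apply, EmbeddingLike.map_eq_zero_iff] at h
    rw [hc φ ((transport_mem_tangentSpace g).1 hφ) (hd ▸ h), map_zero]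

/-! ### Invariance of the correspondence -/

/-- A family of planes with all frames changed by the same matrix. -/
def actFamily (g : GL (Fin 3) ℂ) (γ : ℂ → Frame) : ℂ → Frame := fun t => (γ t).act g

/-- `act g` as a continuous linear map. -/
def actCLM (g : Matrix (Fin 3) (Fin 3) ℂ) : (Fin 3 → V) →L[ℂ] (Fin 3 → V) :=
  LinearMap.toContinuousLinearMap (act g)

theorem deriv_act (g : GL (Fin 3) ℂ) (u : ℂ → (Fin 3 → V)) (t : ℂ) :
    deriv (fun s => act g (u s)) t = act g (deriv u t) := by
  by_cases hu : DifferentiableAt ℂ u t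
  · exact ((actCLM g).hasFDerivAt.comp_hasDerivAt t hu.hasDerivAt).deriv
  · have : ¬ DifferentiableAt ℂ (fun s => act g (u s)) t := fun h => hu (by
      have := (actCLM ↑g⁻¹).differentiableAt.comp t h
      exact this.congr_of_eventuallyEq (Eventually.of_forall fun s => (act_inv_act g (u s)).symm))
    rw [deriv_zero_of_not_differentiableAt hu, deriv_zero_of_not_differentiableAt this, map_zero]

theorem velocity_actFamily (g : GL (Fin 3) ℂ) (γ : ℂ → Frame) (t : ℂ) :
    velocity (actFamily g γ) t = transport g (γ t) (velocity γ t) := by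
  rw [velocity, velocity, transport_charMap, ← deriv_act]
  rfl

theorem IsFamilyThrough.act {S : Set Plane} {A : Frame} {γ : ℂ → Frame}
    (h : IsFamilyThrough S A γ) (g : GL (Fin 3) ℂ) :
    IsFamilyThrough S (A.act g) (actFamily g γ) where
  analyticAt := ((actCLM g).analyticAt _).comp h.analyticAt
  start := by rw [actFamily, h.start]
  mem := h.mem.mono fun t ht => by rwa [actFamily, Frame.plane_act]
  regular := by
    rw [velocity_actFamily]
    exact (transport g (γ 0)).map_ne_zero_iff.2 h.regular

theorem isDevelopable_actFamily (g : GL (Fin 3) ℂ) (γ : ℂ → Frame) :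
    IsDevelopable (actFamily g γ) ↔ IsDevelopable γ := by
  unfold IsDevelopable
  simp only [velocity_actFamily]
  exact eventually_congr (Eventually.of_forall fun t => isFocalLine_transport g)

theorem initialTangent_actFamily (g : GL (Fin 3) ℂ) (A : Frame) (γ : ℂ → Frame) :
    initialTangent (A.act g) (actFamily g γ) = transport g A (initialTangent A γ) := by
  rw [initialTangent, initialTangent, transport_charMap, ← deriv_act]
  rfl

theorem actFamily_inv_actFamily (g : GL (Fin 3) ℂ) (γ : ℂ → Frame) :
    actFamily g (actFamily g⁻¹ γ) = γ := funext fun t => (γ t).act_act_inv g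

theorem sameGerm_actFamily (g : GL (Fin 3) ℂ) (γ δ : ℂ → Frame) :
    SameGerm (actFamily g γ) (actFamily g δ) ↔ SameGerm γ δ := by
  simp only [SameGerm, actFamily, Frame.plane_act]

theorem IsFamilyThrough.of_act {S : Set Plane} {A : Frame} {γ : ℂ → Frame} {g : GL (Fin 3) ℂ}
    (h : IsFamilyThrough S (A.act g) γ) : IsFamilyThrough S A (actFamily g⁻¹ γ) := by
  simpa only [Frame.act_inv_act] using h.act g⁻¹

theorem DevelopablesCorrespond.act {S : Set Plane} {A : Frame} (h : DevelopablesCorrespond S A)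
    (g : GL (Fin 3) ℂ) : DevelopablesCorrespond S (A.act g) where
  isFocalLineDirection γ hγ hd := by
    have := h.isFocalLineDirection _ hγ.of_act ((isDevelopable_actFamily _ _).2 hd)
    rw [← isFocalLineDirection_transport g, ← initialTangent_actFamily,
      actFamily_inv_actFamily] at this
    exact this
  exists_family := (transport g A).surjective.forall.2 fun φ hφ => by
    obtain ⟨γ, h1, h2, h3⟩ := h.exists_family φ ((isFocalLineDirection_transport g).1 hφ)
    exact ⟨actFamily g γ, h1.act g, (isDevelopable_actFamily _ _).2 h2, by
      rw [initialTangent_actFamily, h3]⟩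
  unique hA γ δ hγ hγd hδ hδd hc := by
    have key : ∀ γ, initialTangent (A.act g) γ =
        transport g A (initialTangent A (actFamily g⁻¹ γ)) := fun γ => by
      rw [← initialTangent_actFamily, actFamily_inv_actFamily]
    rw [← sameGerm_actFamily g⁻¹]
    refine h.unique (fun h' => hA ((allDirections_act g).2 h')) _ _ hγ.of_act
      ((isDevelopable_actFamily _ _).2 hγd) hδ.of_act ((isDevelopable_actFamily _ _).2 hδd) ?_
    obtain ⟨c, hc⟩ := hc
    rw [key, key, ← map_smul] at hc
    exact ⟨c, (transport g A).injective hc⟩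
  all hA γ hγ := (isDevelopable_actFamily g⁻¹ _).1
    (h.all ((allDirections_act g).1 hA) _ hγ.of_act)

/-! ### Tangent fields near a smooth point -/

/-- Polynomial vector fields `w 0`, `w 1` on the space of triples which span the tangent space
of `S`, as a subspace of the Grassmannian, at all frames where the polynomial function `f` does not
vanish. The frames are normalized by `P`: the fields have values in triples of vectors of `ker P`,
which is a complement of the spaces `W`, and for which `Q` gives coordinates. -/
structure IsTangentChart (S : Set Plane) (P : V →ₗ[ℂ] (Fin 3 → ℂ)) (Q : V →ₗ[ℂ] (Fin 2 → ℂ))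
    (f : (Fin 3 → V) → ℂ) (w : Fin 2 → (Fin 3 → V) → (Fin 3 → V)) : Prop where
  isPoly : IsPoly f
  isPolyField : ∀ k, IsPolyField (w k)
  eq_zero : ∀ v, P v = 0 → Q v = 0 → v = 0
  surjective : ∀ c, ∃ v, P v = 0 ∧ Q v = c
  det_ne_zero : ∀ X, f X ≠ 0 → (projMatrix P X).det ≠ 0
  proj_field : ∀ k X i, P (w k X i) = 0
  exists_frame_of_hasDerivAt : ∀ A : Frame, A.plane ∈ S → f A.vec ≠ 0 → ∀ (c : ℂ → Fin 2 → ℂ)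
    (u : ℂ → (Fin 3 → V)), u 0 = A.vec →
    (∀ᶠ t in 𝓝 (0 : ℂ), HasDerivAt u (c t 0 • w 0 (u t) + c t 1 • w 1 (u t)) t) →
    ∀ᶠ t in 𝓝 (0 : ℂ), ∃ B : Frame, B.vec = u t ∧ B.plane ∈ S
  exists_coordinates : ∃ (ξ : Fin 2 → (Fin 3 → V) →ₗ[ℂ] ℂ) (δ : (Fin 3 → V) → ℂ), IsPoly δ ∧
    (∀ X, f X ≠ 0 → δ X ≠ 0) ∧
    (∀ X, ξ 0 (w 0 X) = δ X ∧ ξ 0 (w 1 X) = 0 ∧ ξ 1 (w 0 X) = 0 ∧ ξ 1 (w 1 X) = δ X) ∧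
    ∀ A : Frame, A.plane ∈ S → f A.vec ≠ 0 → ∀ X ∈ frameTangentSpace S A, (∀ i, P (X i) = 0) →
      δ A.vec • X = ξ 0 X • w 0 A.vec + ξ 1 X • w 1 A.vec

theorem eventually_eq_of_hasDerivAt_zero {u : ℂ → ℂ}
    (h : ∀ᶠ t in 𝓝 (0 : ℂ), HasDerivAt u 0 t) : ∀ᶠ t in 𝓝 (0 : ℂ), u t = u 0 := by
  obtain ⟨r, hr, hu⟩ := Metric.eventually_nhds_iff_ball.1 h
  filter_upwards [Metric.ball_mem_nhds (0 : ℂ) hr] with t ht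
  have := (convex_ball (0 : ℂ) r).norm_image_sub_le_of_norm_hasDerivWithin_le (C := 0)
    (fun z hz => (hu z hz).hasDerivWithinAt) (fun z hz => by simp) (Metric.mem_ball_self hr) ht
  rw [zero_mul] at this
  exact sub_eq_zero.1 (norm_le_zero_iff.1 this)

theorem differential_mul (p q : MvPolynomial (Fin 3 × Fin 5) ℂ) (X Y : Fin 3 → V) :
    differential (p * q) X Y = MvPolynomial.eval (coords X) p * differential q X Y +
      MvPolynomial.eval (coords X) q * differential p X Y := by
  simp only [differential_apply, Derivation.leibniz, smul_eq_mul, map_add, map_mul, add_mul,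
    Finset.sum_add_distrib, Finset.mul_sum, mul_assoc]

/-- Near a smooth point of `S`, tangent vectors are killed by the differentials of the equations. -/
theorem differential_eq_zero {S : Set Plane} {g : Fin 4 → MvPolynomial (Fin 3 × Fin 5) ℂ}
    {h : MvPolynomial (Fin 3 × Fin 5) ℂ} (hS : ∀ B : Frame, MvPolynomial.eval (coords B.vec) h ≠ 0 →
      (B.plane ∈ S ↔ ∀ i, MvPolynomial.eval (coords B.vec) (g i) = 0)) {A : Frame}
    (hA : A.plane ∈ S) (hh : MvPolynomial.eval (coords A.vec) h ≠ 0) {X : Fin 3 → V}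
    (hX : X ∈ frameTangentSpace S A) (i : Fin 4) : differential (g i) A.vec X = 0 := by
  have h1 := mem_frameTangentSpace.1 hX (h * g i) fun B hB => by
    rw [map_mul]
    by_cases hB' : MvPolynomial.eval (coords B.vec) h = 0
    · rw [hB', zero_mul]
    · rw [((hS B hB').1 hB) i, mul_zero]
  rw [differential_mul, ((hS A hh).1 hA) i, zero_mul, add_zero] at h1
  exact (mul_eq_zero.1 h1).resolve_left hh

/-- A complement of the space of a frame, and coordinates on it. -/
theorem exists_complement_coordinates {P : V →ₗ[ℂ] (Fin 3 → ℂ)} {A : Frame}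
    (hP : ∀ i, P (A.vec i) = Pi.single i 1) : ∃ Q : V →ₗ[ℂ] (Fin 2 → ℂ),
      (∀ v, P v = 0 → Q v = 0 → v = 0) ∧ ∀ c, ∃ v, P v = 0 ∧ Q v = c := by
  have hsurj : Function.Surjective P := fun c => ⟨∑ i, c i • A.vec i, by
    ext j; simp [hP, Finset.sum_apply, Pi.single_apply]⟩
  have hk : Module.finrank ℂ (LinearMap.ker P) = 2 := by
    have := LinearMap.finrank_range_add_finrank_ker P
    rw [LinearMap.range_eq_top.2 hsurj, finrank_top, Module.finrank_fin_fun,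
      Module.finrank_fin_fun] at this
    omega
  let e := (Module.finBasisOfFinrankEq ℂ _ hk).equivFun
  obtain ⟨Q, hQ⟩ := LinearMap.exists_extend e.toLinearMap
  have hQ' : ∀ v (hv : P v = 0), Q v = e ⟨v, hv⟩ := fun v hv => LinearMap.congr_fun hQ ⟨v, hv⟩
  refine ⟨Q, fun v hv hv' => ?_, fun c => ⟨e.symm c, (e.symm c).2, ?_⟩⟩
  · rw [hQ' v hv, LinearEquiv.map_eq_zero_iff] at hv'
    exact congrArg Subtype.val hv'
  · rw [hQ' _ (e.symm c).2]
    exact e.apply_symm_apply c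

/-- A linear system of four independent equations, killing the triples in the space of `A`,
restricted to the triples of vectors in the complement `ker P`: the solutions have a basis of two
elements, the values of the equations are arbitrary, and both together give coordinates. -/
theorem exists_splitting {P : V →ₗ[ℂ] (Fin 3 → ℂ)} {A : Frame}
    (hP : ∀ i, P (A.vec i) = Pi.single i 1) (L : (Fin 3 → V) →ₗ[ℂ] (Fin 4 → ℂ))
    (hL : Function.Surjective L) (hLA : ∀ N, L (act N A.vec) = 0) :
    ∃ (R : Fin 4 → (Fin 3 → V)) (E : Fin 2 → (Fin 3 → V)) (ξ : Fin 2 → (Fin 3 → V) →ₗ[ℂ] ℂ),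
      (∀ j i, P (R j i) = 0) ∧ (∀ k i, P (E k i) = 0) ∧ (∀ j, L (R j) = Pi.single j 1) ∧
      (∀ k j, ξ k (R j) = 0) ∧ (∀ k l, ξ k (E l) = (Pi.single k 1 : Fin 2 → ℂ) l) ∧
      ∀ X, (∀ i, P (X i) = 0) → X = ∑ k, ξ k X • E k + ∑ j, L X j • R j := by
  have hPA : ∀ N, projMatrix P (act N A.vec) = N := fun N => by
    rw [projMatrix_act, projMatrix_eq_one hP, mul_one]
  have hsub : ∀ X i, P ((X - act (projMatrix P X) A.vec) i) = 0 := fun X i => by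
    have := congrFun (hPA (projMatrix P X)) i
    rw [Pi.sub_apply, map_sub, sub_eq_zero]
    exact this.symm
  have hR : ∀ j, ∃ X : Fin 3 → V, (∀ i, P (X i) = 0) ∧ L X = Pi.single j 1 := fun j => by
    obtain ⟨X, hX⟩ := hL (Pi.single j 1)
    exact ⟨_, hsub X, by rw [map_sub, hLA, sub_zero, hX]⟩
  choose R hRP hRL using hR
  let T : (Fin 3 → V) →ₗ[ℂ] (Fin 4 → ℂ) × (Fin 3 → Fin 3 → ℂ) :=
    L.prod (LinearMap.pi fun i => P ∘ₗ LinearMap.proj i)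
  have hTapp : ∀ X, T X = (L X, fun i => P (X i)) := fun X => rfl
  have hT : Function.Surjective T := by
    rintro ⟨a, m⟩
    refine ⟨act (Matrix.of m) A.vec + ∑ j, a j • R j, ?_⟩
    rw [hTapp, map_add, hLA, zero_add]
    refine Prod.ext ?_ (funext fun i => ?_)
    · ext l; simp [hRL, Finset.sum_apply, Pi.single_apply]
    · have := congrFun (hPA (Matrix.of m)) i
      have h2 : P (act (Matrix.of m) A.vec i) = m i := this
      simp [h2, Finset.sum_apply, hRP]
  have hk : Module.finrank ℂ (LinearMap.ker T) = 2 := by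
    have := LinearMap.finrank_range_add_finrank_ker T
    rw [LinearMap.range_eq_top.2 hT, finrank_top] at this
    simp only [Module.finrank_prod, Module.finrank_pi_fintype, Module.finrank_self,
      Finset.sum_const, Finset.card_univ, Fintype.card_fin, smul_eq_mul] at this
    omega
  have hker : ∀ X, X ∈ LinearMap.ker T ↔ L X = 0 ∧ ∀ i, P (X i) = 0 := fun X => by
    rw [LinearMap.mem_ker, hTapp, Prod.ext_iff]
    exact and_congr_right fun _ => ⟨fun h i => congrFun h i, fun h => funext h⟩
  let b := Module.finBasisOfFinrankEq ℂ _ hk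
  have hex : ∀ k, ∃ ℓ : (Fin 3 → V) →ₗ[ℂ] ℂ, ∀ X : LinearMap.ker T, ℓ X = b.coord k X := fun k => by
    obtain ⟨ℓ, hℓ⟩ := LinearMap.exists_extend (b.coord k)
    exact ⟨ℓ, fun X => LinearMap.congr_fun hℓ X⟩
  choose ℓ hℓ using hex
  let π : (Fin 3 → V) →ₗ[ℂ] (Fin 3 → V) :=
    LinearMap.id - (Fintype.linearCombination ℂ R) ∘ₗ L
  have hπ : ∀ X, π X = X - ∑ j, L X j • R j := fun X => rfl
  have hπk : ∀ X, (∀ i, P (X i) = 0) → π X ∈ LinearMap.ker T := fun X hX => by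
    rw [hker, hπ]
    constructor
    · ext l; simp [hRL, Finset.sum_apply, Pi.single_apply]
    · intro i; simp [hX, hRP, Finset.sum_apply]
  refine ⟨R, fun k => b k, fun k => ℓ k ∘ₗ π, hRP, fun k => ((hker _).1 (b k).2).2, hRL,
    fun k j => ?_, fun k l => ?_, fun X hX => ?_⟩
  · have : π (R j) = 0 := by
      rw [hπ, hRL, Finset.sum_eq_single j] <;> simp +contextual
    rw [LinearMap.comp_apply, this, map_zero]
  · have : π (b l) = b l := by rw [hπ, ((hker _).1 (b l).2).1]; simp
    rw [LinearMap.comp_apply, this, hℓ]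
    simp [Finsupp.single_apply, Pi.single_apply, eq_comm]
  · have h1 := congrArg Subtype.val (b.sum_repr ⟨π X, hπk X hX⟩)
    have h2 : ∑ k, ℓ k (π X) • (b k : Fin 3 → V) = π X := by
      refine Eq.trans ?_ h1
      simp only [AddSubmonoidClass.coe_finsetSum, Submodule.coe_smul]
      refine Finset.sum_congr rfl fun k _ => ?_
      rw [hℓ k ⟨π X, hπk X hX⟩]
      rfl
    simp only [LinearMap.comp_apply]
    rw [h2, hπ, sub_add_cancel]

/-- A surface has a tangent chart at each smooth point. The fields are given by Cramer's rule. -/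
theorem IsSmoothSurfaceAt.exists_isTangentChart {S : Set Plane} {A : Frame} (hAS : A.plane ∈ S)
    (hA : IsSmoothSurfaceAt S A) : ∃ P Q f w, IsTangentChart S P Q f w ∧ f A.vec ≠ 0 := by
  obtain ⟨g, h, hh, hS, hg⟩ := hA
  obtain ⟨P, hP⟩ := A.exists_leftInverse
  obtain ⟨Q, hQ1, hQ2⟩ := exists_complement_coordinates hP
  let L : (Fin 3 → V) →ₗ[ℂ] (Fin 4 → ℂ) := LinearMap.pi fun i => differential (g i) A.vec
  have hL : Function.Surjective L := by
    rw [← LinearMap.range_eq_top]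
    by_contra hne
    obtain ⟨ℓ, hℓ0, hℓ⟩ := Submodule.exists_le_ker_of_lt_top _ (lt_top_iff_ne_top.2 hne)
    apply hℓ0
    have hsum : ∑ i, ℓ (fun j => if i = j then 1 else 0) • dPoly (g i) A = 0 := by
      refine LinearMap.ext fun X => ?_
      have h1 : ℓ (L X) = 0 := hℓ ⟨X, rfl⟩
      rw [LinearMap.pi_apply_eq_sum_univ] at h1
      simp only [LinearMap.sum_apply, LinearMap.smul_apply, smul_eq_mul, LinearMap.zero_apply]
      refine Eq.trans ?_ h1
      exact Finset.sum_congr rfl fun i _ => mul_comm _ _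
    have h0 := Fintype.linearIndependent_iff.1 hg _ hsum
    refine LinearMap.ext fun v => ?_
    rw [LinearMap.pi_apply_eq_sum_univ]
    simp [h0]
  have hLA : ∀ N, L (act N A.vec) = 0 := fun N => funext fun i =>
    differential_eq_zero hS hAS hh
      (mem_frameTangentSpace_of_mem_span hAS fun j => act_mem_span N A.vec j) i
  obtain ⟨R, E, ξ, hRP, hEP, hRL, hξR, hξE, hdec⟩ := exists_splitting hP L hL hLA
  let G : (Fin 3 → V) → Matrix (Fin 4) (Fin 4) ℂ := fun X =>
    Matrix.of fun i j => differential (g i) X (R j)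
  let a : Fin 2 → (Fin 3 → V) → (Fin 4 → ℂ) := fun k X =>
    (G X).adjugate.mulVec fun i => differential (g i) X (E k)
  let w : Fin 2 → (Fin 3 → V) → (Fin 3 → V) := fun k X => (G X).det • E k - ∑ j, a k X j • R j
  have hG : ∀ i j, IsPoly fun X => G X i j := fun i j => isPoly_differential _ (isPolyField_const _)
  have hδ : IsPoly fun X => (G X).det := .det hG
  have ha : ∀ k j, IsPoly fun X => a k X j := fun k j => by
    change IsPoly fun X => ∑ i, (G X).adjugate j i * differential (g i) X (E k)
    refine .sum fun i => IsPoly.mul ?_ (isPoly_differential _ (isPolyField_const _))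
    simp only [Matrix.adjugate_apply]
    refine .det fun i' j' => ?_
    by_cases hi : i' = i
    · subst hi; simpa using IsPoly.const _
    · simpa [Matrix.updateRow_ne hi] using hG _ _
  have hwP : ∀ k X i, P (w k X i) = 0 := fun k X i => by
    simp [w, hEP, hRP, Finset.sum_apply]
  have hdw : ∀ k X i, differential (g i) X (w k X) = 0 := fun k X i => by
    have h1 : (G X).mulVec (a k X) i = (G X).det * differential (g i) X (E k) := by
      simp [a, Matrix.mulVec_mulVec, Matrix.mul_adjugate, Matrix.smul_mulVec]
    have h2 : (G X).mulVec (a k X) i = ∑ j, differential (g i) X (R j) * a k X j := rfl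
    simp only [w, map_sub, map_smul, map_sum, smul_eq_mul]
    rw [← h1, h2, sub_eq_zero]
    exact Finset.sum_congr rfl fun j _ => mul_comm _ _
  have hξw : ∀ k l X, ξ k (w l X) = (G X).det * (Pi.single k 1 : Fin 2 → ℂ) l := fun k l X => by
    simp [w, hξE, hξR]
  have hGA : G A.vec = 1 := by
    ext i j
    have : L (R j) i = (Pi.single j 1 : Fin 4 → ℂ) i := congrFun (hRL j) i
    simpa [G, L, Matrix.one_apply, Pi.single_apply] using this
  refine ⟨P, Q, fun X => MvPolynomial.eval (coords X) h * (projMatrix P X).det * (G X).det, w,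
    ⟨((IsPoly.eval h).mul (isPoly_det_projMatrix P)).mul hδ, fun k =>
      (IsPolyField.smul hδ (isPolyField_const _)).sub
        (.sum fun j => .smul (ha k j) (isPolyField_const _)),
      hQ1, hQ2, fun X hX => right_ne_zero_of_mul (left_ne_zero_of_mul hX), hwP, ?_, ?_⟩, ?_⟩
  · intro B hB hfB c u hu0 hu
    have hc : ContinuousAt u 0 := hu.self_of_nhds.continuousAt
    have h1 : ∀ᶠ t in 𝓝 (0 : ℂ), MvPolynomial.eval (coords (u t)) h ≠ 0 :=
      (((IsPoly.eval h).contDiff (n := 0)).continuous.continuousAt.comp hc).eventually_ne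
        (by simpa [hu0] using left_ne_zero_of_mul (left_ne_zero_of_mul hfB))
    have h2 : ∀ᶠ t in 𝓝 (0 : ℂ), (projMatrix P (u t)).det ≠ 0 :=
      (((isPoly_det_projMatrix P).contDiff (n := 0)).continuous.continuousAt.comp hc).eventually_ne
        (by simpa [hu0] using right_ne_zero_of_mul (left_ne_zero_of_mul hfB))
    have h3 : ∀ᶠ t in 𝓝 (0 : ℂ), ∀ i, MvPolynomial.eval (coords (u t)) (g i) = 0 := by
      refine eventually_all.2 fun i => ?_
      have h4 : ∀ᶠ t in 𝓝 (0 : ℂ),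
          HasDerivAt (fun t => MvPolynomial.eval (coords (u t)) (g i)) 0 t := by
        filter_upwards [hu] with t ht
        have := hasDerivAt_eval (g i) ht
        rwa [map_add, map_smul, map_smul, hdw, hdw, smul_zero, smul_zero, add_zero] at this
      filter_upwards [eventually_eq_of_hasDerivAt_zero h4] with t ht
      rw [ht, hu0]
      exact (hS B (left_ne_zero_of_mul (left_ne_zero_of_mul hfB))).1 hB i
    filter_upwards [h1, h2, h3] with t h1 h2 h3
    let C : Frame := ⟨u t, linearIndependent_of_det_ne_zero h2⟩
    exact ⟨C, rfl, (hS C h1).2 h3⟩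
  · refine ⟨ξ, fun X => (G X).det, hδ, fun X hX => right_ne_zero_of_mul hX,
      fun X => by simp [hξw], fun B hB hfB X hX hXP => ?_⟩
    have hhB := left_ne_zero_of_mul (left_ne_zero_of_mul hfB)
    have hδB : (G B.vec).det ≠ 0 := right_ne_zero_of_mul hfB
    set Y := (G B.vec).det • X - (ξ 0 X • w 0 B.vec + ξ 1 X • w 1 B.vec) with hY
    have hYP : ∀ i, P (Y i) = 0 := fun i => by simp [hY, hXP, hwP]
    have hξY : ∀ k, ξ k Y = 0 := fun k => by
      fin_cases k <;> simp [hY, hξw, mul_comm]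
    have hdY : ∀ i, differential (g i) B.vec Y = 0 := fun i => by
      simp [hY, hdw, differential_eq_zero hS hB hhB hX]
    have hYR : Y = ∑ j, L Y j • R j := by
      have := hdec Y hYP
      simpa [hξY] using this
    have hGL : (G B.vec).mulVec (L Y) = 0 := by
      ext i
      have h1 := hdY i
      rw [hYR, map_sum] at h1
      simp only [map_smul, smul_eq_mul] at h1
      refine Eq.trans ?_ h1
      change ∑ j, differential (g i) B.vec (R j) * L Y j = _
      exact Finset.sum_congr rfl fun j _ => mul_comm _ _
    have hLY := Matrix.eq_zero_of_mulVec_eq_zero hδB hGL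
    have hY0 : Y = 0 := hYR.trans (Finset.sum_eq_zero fun j _ => by
      rw [hLY, Pi.zero_apply, zero_smul])
    exact sub_eq_zero.1 hY0
  · simp only [hGA, projMatrix_eq_one hP, Matrix.det_one, mul_one]
    exact hh

/-! ### Focal line directions in a tangent chart -/

theorem act_mul_inv_of_det_ne_zero {P : V →ₗ[ℂ] (Fin 3 → ℂ)} {X : Fin 3 → V}
    (h : (projMatrix P X).det ≠ 0) (N : Matrix (Fin 3) (Fin 3) ℂ) (i : Fin 3) :
    P (act (N * (projMatrix P X)⁻¹) X i) = N i := by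
  have h1 : projMatrix P (act (N * (projMatrix P X)⁻¹) X) = N := by
    rw [projMatrix_act, mul_assoc, Matrix.nonsing_inv_mul _ (isUnit_iff_ne_zero.2 h), mul_one]
  exact congrFun h1 i

theorem eq_zero_of_mem_span_of_proj_eq_zero {P : V →ₗ[ℂ] (Fin 3 → ℂ)} {A : Frame}
    (h : (projMatrix P A.vec).det ≠ 0) {v : V} (hv : v ∈ A.span) (hP : P v = 0) : v = 0 := by
  obtain ⟨c, rfl⟩ := (Submodule.mem_span_range_iff_exists_fun ℂ).1 hv
  have h1 : Matrix.vecMul c (projMatrix P A.vec) = 0 := by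
    rw [← hP, map_sum]
    ext j
    simp [Matrix.vecMul, dotProduct, projMatrix, Finset.sum_apply]
  rw [Matrix.eq_zero_of_vecMul_eq_zero h h1]
  simp

namespace IsTangentChart

variable {S : Set Plane} {P : V →ₗ[ℂ] (Fin 3 → ℂ)} {Q : V →ₗ[ℂ] (Fin 2 → ℂ)}
  {f : (Fin 3 → V) → ℂ} {w : Fin 2 → (Fin 3 → V) → (Fin 3 → V)}

/-- A field `s w₀ + t w₁` with variable coefficients is tangent to `S`. -/
theorem exists_curve (hw : IsTangentChart S P Q f w) {A : Frame} (hA : A.plane ∈ S)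
    (hf : f A.vec ≠ 0) {s t : (Fin 3 → V) → ℂ} (hs : ContDiffAt ℂ 1 s A.vec)
    (ht : ContDiffAt ℂ 1 t A.vec) : ∃ u : ℂ → (Fin 3 → V), AnalyticAt ℂ u 0 ∧ u 0 = A.vec ∧
      (∀ᶠ z in 𝓝 (0 : ℂ), HasDerivAt u (s (u z) • w 0 (u z) + t (u z) • w 1 (u z)) z) ∧
      ∀ᶠ z in 𝓝 (0 : ℂ), ∃ B : Frame, B.vec = u z ∧ B.plane ∈ S := by
  obtain ⟨u, hua, hu0, hu⟩ := exists_analyticAt_hasDerivAt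
    ((hs.smul (hw.isPolyField 0).contDiff.contDiffAt).add
      (ht.smul (hw.isPolyField 1).contDiff.contDiffAt))
  exact ⟨u, hua, hu0, hu, hw.exists_frame_of_hasDerivAt A hA hf
    (fun z => ![s (u z), t (u z)]) u hu0 hu⟩

theorem combination_mem_frameTangentSpace (hw : IsTangentChart S P Q f w) {A : Frame}
    (hA : A.plane ∈ S) (hf : f A.vec ≠ 0) (s t : ℂ) :
    s • w 0 A.vec + t • w 1 A.vec ∈ frameTangentSpace S A := by
  obtain ⟨u, hua, hu0, hu, huS⟩ := hw.exists_curve hA hf (s := fun _ => s) (t := fun _ => t)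
    contDiffAt_const contDiffAt_const
  have := mem_frameTangentSpace_of_hasDerivAt hu.self_of_nhds hu0 huS
  rwa [hu0] at this

theorem proj_combination (hw : IsTangentChart S P Q f w) (s t : ℂ) (X : Fin 3 → V) (i : Fin 3) :
    P ((s • w 0 X + t • w 1 X) i) = 0 := by
  simp [hw.proj_field]

theorem combination_eq_zero_iff (hw : IsTangentChart S P Q f w) {X : Fin 3 → V} (hf : f X ≠ 0)
    {s t : ℂ} : s • w 0 X + t • w 1 X = 0 ↔ s = 0 ∧ t = 0 := by
  refine ⟨fun h => ?_, fun ⟨h1, h2⟩ => by simp [h1, h2]⟩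
  obtain ⟨ξ, δ, -, hδ, hξ, -⟩ := hw.exists_coordinates
  obtain ⟨h1, h2, h3, h4⟩ := hξ X
  have e0 := congrArg (ξ 0) h
  have e1 := congrArg (ξ 1) h
  simp only [map_add, map_smul, map_zero, h1, h2, h3, h4, smul_eq_mul, mul_zero, add_zero,
    zero_add] at e0 e1
  exact ⟨(mul_eq_zero.1 e0).resolve_right (hδ X hf), (mul_eq_zero.1 e1).resolve_right (hδ X hf)⟩

theorem charMap_eq_zero_iff_of_proj (hw : IsTangentChart S P Q f w) {A : Frame}
    (hf : f A.vec ≠ 0) {X : Fin 3 → V} (hX : ∀ i, P (X i) = 0) : charMap A X = 0 ↔ X = 0 := by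
  refine ⟨fun h => funext fun i => ?_, fun h => by rw [h, map_zero]⟩
  exact eq_zero_of_mem_span_of_proj_eq_zero (hw.det_ne_zero _ hf)
    ((charMap_eq_zero_iff A X).1 h i) (hX i)

theorem exists_eq_charMap (hw : IsTangentChart S P Q f w) {A : Frame} (hA : A.plane ∈ S)
    (hf : f A.vec ≠ 0) {φ : NormalSection A} (hφ : φ ∈ tangentSpace S A) :
    ∃ s t : ℂ, φ = charMap A (s • w 0 A.vec + t • w 1 A.vec) := by
  obtain ⟨X, hX, rfl⟩ := hφ
  obtain ⟨ξ, δ, -, hδ, -, hspan⟩ := hw.exists_coordinates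
  set N := projMatrix P X * (projMatrix P A.vec)⁻¹ with hN
  have hK : ∀ i, act N A.vec i ∈ A.span := fun i => act_mem_span _ _ i
  have hY := hspan A hA hf (X - act N A.vec)
    (Submodule.sub_mem _ hX (mem_frameTangentSpace_of_mem_span hA hK)) fun i => by
      rw [Pi.sub_apply, map_sub, hN, act_mul_inv_of_det_ne_zero (hw.det_ne_zero _ hf), sub_eq_zero]
      rfl
  have hd := hδ _ hf
  refine ⟨ξ 0 (X - act N A.vec) / δ A.vec, ξ 1 (X - act N A.vec) / δ A.vec, ?_⟩
  have h1 : charMap A X = charMap A (X - act N A.vec) := by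
    rw [map_sub, (charMap_eq_zero_iff A _).2 hK, sub_zero]
  rw [h1]
  congr 1
  refine smul_right_injective _ hd ?_
  simp only [hY, smul_add, smul_smul, mul_div_cancel₀ _ hd]

/-- The coordinates on `ℂ⁵ / W` given by `Q` on the complement `ker P` of `W`. -/
theorem exists_quotient_coordinates (hw : IsTangentChart S P Q f w) {A : Frame}
    (hf : f A.vec ≠ 0) : ∃ κ : (V ⧸ A.span) ≃ₗ[ℂ] (Fin 2 → ℂ), ∀ v, P v = 0 →
      κ (A.span.mkQ v) = Q v := by
  have hdet := hw.det_ne_zero _ hf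
  let q : LinearMap.ker P →ₗ[ℂ] (Fin 2 → ℂ) := Q ∘ₗ (LinearMap.ker P).subtype
  have hq : Function.Bijective q := by
    constructor
    · rw [← LinearMap.ker_eq_bot, LinearMap.ker_eq_bot']
      exact fun v hv => Subtype.ext (hw.eq_zero v v.2 hv)
    · intro c
      obtain ⟨v, hv, rfl⟩ := hw.surjective c
      exact ⟨⟨v, hv⟩, rfl⟩
  let e := LinearEquiv.ofBijective q hq
  let π : LinearMap.ker P →ₗ[ℂ] (V ⧸ A.span) := A.span.mkQ ∘ₗ (LinearMap.ker P).subtype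
  have hinj : Function.Injective π := by
    rw [← LinearMap.ker_eq_bot, LinearMap.ker_eq_bot']
    exact fun v hv => Subtype.ext (eq_zero_of_mem_span_of_proj_eq_zero hdet
      ((Submodule.Quotient.mk_eq_zero _).1 hv) v.2)
  have hfr : Module.finrank ℂ (LinearMap.ker P) = Module.finrank ℂ (V ⧸ A.span) := by
    rw [A.finrank_quotient, e.finrank_eq, Module.finrank_fin_fun]
  let e' := LinearEquiv.ofBijective π
    ⟨hinj, (LinearMap.injective_iff_surjective_of_finrank_eq_finrank hfr).1 hinj⟩
  refine ⟨e'.symm.trans e, fun v hv => ?_⟩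
  have : e'.symm (A.span.mkQ v) = ⟨v, hv⟩ := by
    rw [LinearEquiv.symm_apply_eq]; rfl
  rw [LinearEquiv.trans_apply, this]
  rfl

end IsTangentChart

theorem coord_charMap {P : V →ₗ[ℂ] (Fin 3 → ℂ)} {Q : V →ₗ[ℂ] (Fin 2 → ℂ)} {A : Frame}
    {κ : (V ⧸ A.span) ≃ₗ[ℂ] (Fin 2 → ℂ)} (hκ : ∀ v, P v = 0 → κ (A.span.mkQ v) = Q v)
    {X : Fin 3 → V} (hX : ∀ i, P (X i) = 0) (x : Fin 3 → ℂ) :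
    κ (charMap A X x) = ∑ i, x i • Q (X i) := by
  rw [charMap_apply, hκ, Fintype.linearCombination_apply, map_sum]
  · simp only [map_smul]
  · rw [Fintype.linearCombination_apply, map_sum]
    exact Finset.sum_eq_zero fun i _ => by rw [map_smul, hX, smul_zero]

theorem det2_sum_smul (x y : Fin 3 → ℂ) (u v : Fin 3 → (Fin 2 → ℂ)) :
    det2 (∑ i, x i • u i) (∑ j, y j • v j) = ∑ i, ∑ j, x i * y j * det2 (u i) (v j) := by
  rw [← det2Bilin_apply]
  simp only [map_sum, map_smul, LinearMap.sum_apply, LinearMap.smul_apply, det2Bilin_apply,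
    smul_eq_mul, Finset.mul_sum, mul_assoc]
  rw [Finset.sum_comm]
  exact Finset.sum_congr rfl fun i _ => Finset.sum_congr rfl fun j _ => by ring

theorem forall_bilinear_eq_zero_iff (m : Fin 3 → Fin 3 → ℂ) :
    (∀ x y : Fin 3 → ℂ, ∑ i, ∑ j, x i * y j * m i j = 0) ↔ ∀ i j, m i j = 0 := by
  refine ⟨fun h i j => ?_, fun h x y => by simp [h]⟩
  have := h (Pi.single i 1) (Pi.single j 1)
  rw [Finset.sum_eq_single i, Finset.sum_eq_single j] at this
  · simpa using this
  · intro k _ hk; simp [hk]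
  · simp
  · intro k _ hk; simp [hk]
  · simp

/-- The coefficient of `s ^ 2` in the `2 × 2` minors of `s X + t Y`. -/
def minorA (Q : V →ₗ[ℂ] (Fin 2 → ℂ)) (X : Fin 3 → V) (p : Fin 3 × Fin 3) : ℂ :=
  det2 (Q (X p.1)) (Q (X p.2))

/-- The coefficient of `s t` in the `2 × 2` minors of `s X + t Y`. -/
def minorB (Q : V →ₗ[ℂ] (Fin 2 → ℂ)) (X Y : Fin 3 → V) (p : Fin 3 × Fin 3) : ℂ :=
  det2 (Q (X p.1)) (Q (Y p.2)) + det2 (Q (Y p.1)) (Q (X p.2))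

/-- The pair `(s, t)` is nonzero, and the `2 × 2` minors of `s w₀ + t w₁` vanish at `X`: this
combination is a focal line direction. -/
def IsFocal (Q : V →ₗ[ℂ] (Fin 2 → ℂ)) (w : Fin 2 → (Fin 3 → V) → (Fin 3 → V)) (X : Fin 3 → V)
    (s t : ℂ) : Prop := (s ≠ 0 ∨ t ≠ 0) ∧ ∀ p, minorA Q (s • w 0 X + t • w 1 X) p = 0

theorem minorA_combination (Q : V →ₗ[ℂ] (Fin 2 → ℂ)) (X Y : Fin 3 → V) (s t : ℂ)
    (p : Fin 3 × Fin 3) : minorA Q (s • X + t • Y) p =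
      minorA Q X p * s ^ 2 + minorB Q X Y p * (s * t) + minorA Q Y p * t ^ 2 := by
  simp only [minorA, minorB, Pi.add_apply, Pi.smul_apply, map_add, map_smul, det2_add_left,
    det2_add_right, det2_smul_left, det2_smul_right]
  ring

theorem minorB_combination_left (Q : V →ₗ[ℂ] (Fin 2 → ℂ)) (X Y Z : Fin 3 → V) (s t : ℂ)
    (p : Fin 3 × Fin 3) :
    minorB Q (s • X + t • Y) Z p = s * minorB Q X Z p + t * minorB Q Y Z p := by
  simp only [minorB, Pi.add_apply, Pi.smul_apply, map_add, map_smul, det2_add_left,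
    det2_add_right, det2_smul_left, det2_smul_right]
  ring

theorem minorB_comm (Q : V →ₗ[ℂ] (Fin 2 → ℂ)) (X Y : Fin 3 → V) (p : Fin 3 × Fin 3) :
    minorB Q X Y p = minorB Q Y X p := add_comm _ _

theorem minorB_self (Q : V →ₗ[ℂ] (Fin 2 → ℂ)) (X : Fin 3 → V) (p : Fin 3 × Fin 3) :
    minorB Q X X p = 2 * minorA Q X p := (two_mul _).symm

namespace IsTangentChart

variable {S : Set Plane} {P : V →ₗ[ℂ] (Fin 3 → ℂ)} {Q : V →ₗ[ℂ] (Fin 2 → ℂ)}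
  {f : (Fin 3 → V) → ℂ} {w : Fin 2 → (Fin 3 → V) → (Fin 3 → V)}

theorem isPoly_minorA (hw : IsTangentChart S P Q f w) (k : Fin 2) (p : Fin 3 × Fin 3) :
    IsPoly fun X => minorA Q (w k X) p := by
  have h : ∀ i l, IsPoly fun X => Q (w k X i) l := fun i l =>
    (hw.isPolyField k).linear_apply (LinearMap.proj l ∘ₗ Q) i
  exact ((h _ _).mul (h _ _)).sub ((h _ _).mul (h _ _))

theorem isPoly_minorB (hw : IsTangentChart S P Q f w) (p : Fin 3 × Fin 3) :
    IsPoly fun X => minorB Q (w 0 X) (w 1 X) p := by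
  have h : ∀ k i l, IsPoly fun X => Q (w k X i) l := fun k i l =>
    (hw.isPolyField k).linear_apply (LinearMap.proj l ∘ₗ Q) i
  exact (((h _ _ _).mul (h _ _ _)).sub ((h _ _ _).mul (h _ _ _))).add
    (((h _ _ _).mul (h _ _ _)).sub ((h _ _ _).mul (h _ _ _)))

theorem isFocalLine_charMap_iff (hw : IsTangentChart S P Q f w) {A : Frame} (hf : f A.vec ≠ 0)
    {X : Fin 3 → V} (hX : ∀ i, P (X i) = 0) :
    IsFocalLine A (charMap A X) ↔ X ≠ 0 ∧ ∀ p, minorA Q X p = 0 := by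
  obtain ⟨κ, hκ⟩ := hw.exists_quotient_coordinates hf
  rw [isFocalLine_iff κ, Ne, hw.charMap_eq_zero_iff_of_proj hf hX]
  simp only [coord_charMap hκ hX, det2_sum_smul, forall_bilinear_eq_zero_iff, Prod.forall, minorA]

theorem isFocalLine_combination_iff (hw : IsTangentChart S P Q f w) {A : Frame}
    (hf : f A.vec ≠ 0) (s t : ℂ) :
    IsFocalLine A (charMap A (s • w 0 A.vec + t • w 1 A.vec)) ↔ IsFocal Q w A.vec s t := by
  rw [hw.isFocalLine_charMap_iff hf (hw.proj_combination s t _), Ne,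
    hw.combination_eq_zero_iff hf, IsFocal, not_and_or]

theorem isFocalLineDirection_iff (hw : IsTangentChart S P Q f w) {A : Frame} (hA : A.plane ∈ S)
    (hf : f A.vec ≠ 0) (s t : ℂ) :
    IsFocalLineDirection S A (charMap A (s • w 0 A.vec + t • w 1 A.vec)) ↔
      IsFocal Q w A.vec s t := by
  have h1 : charMap A (s • w 0 A.vec + t • w 1 A.vec) ∈ tangentSpace S A :=
    ⟨_, hw.combination_mem_frameTangentSpace hA hf s t, rfl⟩
  rw [IsFocalLineDirection, hw.isFocalLine_combination_iff hf, Ne,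
    hw.charMap_eq_zero_iff_of_proj hf (hw.proj_combination s t _), hw.combination_eq_zero_iff hf,
    not_and_or]
  exact ⟨fun h => h.2.2, fun h => ⟨h1, h.1, h⟩⟩

theorem isMultipleDirection_iff (hw : IsTangentChart S P Q f w) {A : Frame} (hA : A.plane ∈ S)
    (hf : f A.vec ≠ 0) (s t : ℂ) :
    IsMultipleDirection S A (charMap A (s • w 0 A.vec + t • w 1 A.vec)) ↔
      ∀ p, 2 * minorA Q (w 0 A.vec) p * s + minorB Q (w 0 A.vec) (w 1 A.vec) p * t = 0 ∧
        minorB Q (w 0 A.vec) (w 1 A.vec) p * s + 2 * minorA Q (w 1 A.vec) p * t = 0 := by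
  obtain ⟨κ, hκ⟩ := hw.exists_quotient_coordinates hf
  have key : ∀ X Y : Fin 3 → V, (∀ i, P (X i) = 0) → (∀ i, P (Y i) = 0) →
      ((∀ x y, det2 (κ (charMap A X x)) (κ (charMap A Y y)) +
        det2 (κ (charMap A Y x)) (κ (charMap A X y)) = 0) ↔ ∀ p, minorB Q X Y p = 0) := by
    intro X Y hX hY
    simp only [coord_charMap hκ hX, coord_charMap hκ hY, det2_sum_smul, ← Finset.sum_add_distrib,
      ← mul_add, forall_bilinear_eq_zero_iff, Prod.forall, minorB]
  rw [PlaneCongruence.isMultipleDirection_iff κ]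
  set X := s • w 0 A.vec + t • w 1 A.vec with hXdef
  have hX : ∀ i, P (X i) = 0 := hw.proj_combination s t _
  have hB : ∀ p, minorB Q X (w 0 A.vec) p = 2 * minorA Q (w 0 A.vec) p * s +
      minorB Q (w 0 A.vec) (w 1 A.vec) p * t ∧ minorB Q X (w 1 A.vec) p =
      minorB Q (w 0 A.vec) (w 1 A.vec) p * s + 2 * minorA Q (w 1 A.vec) p * t := fun p => by
    rw [hXdef, minorB_combination_left, minorB_combination_left, minorB_self, minorB_self,
      minorB_comm Q (w 1 A.vec)]
    constructor <;> ring
  simp only [← (hB _).1, ← (hB _).2]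
  constructor
  · intro h p
    have h0 : ∀ s' t' : ℂ, ∀ p, minorB Q X (s' • w 0 A.vec + t' • w 1 A.vec) p = 0 := fun s' t' =>
      (key _ _ hX (hw.proj_combination s' t' _)).1 fun x y =>
        (h x y).2 _ ⟨_, hw.combination_mem_frameTangentSpace hA hf s' t', rfl⟩
    exact ⟨by simpa using h0 1 0 p, by simpa using h0 0 1 p⟩
  · intro h
    have h1 : ∀ s' t' : ℂ, ∀ p, minorB Q X (s' • w 0 A.vec + t' • w 1 A.vec) p = 0 :=
      fun s' t' p => by
        rw [minorB_comm, minorB_combination_left, minorB_comm, (h p).1, minorB_comm, (h p).2]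
        ring
    have h2 : ∀ φ ∈ tangentSpace S A, ∀ x y, det2 (κ (charMap A X x)) (κ (φ y)) +
        det2 (κ (φ x)) (κ (charMap A X y)) = 0 := by
      intro φ hφ
      obtain ⟨s', t', rfl⟩ := hw.exists_eq_charMap hA hf hφ
      exact (key _ _ hX (hw.proj_combination s' t' _)).2 (h1 s' t')
    refine fun x y => ⟨?_, fun φ hφ => h2 φ hφ x y⟩
    have := h2 _ ⟨X, hw.combination_mem_frameTangentSpace hA hf s t, rfl⟩ x y
    rw [← two_mul] at this
    simpa using this

end IsTangentChart

/-! ### The number of focal line directions of the general plane -/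

theorem IsFocal.smul {Q : V →ₗ[ℂ] (Fin 2 → ℂ)} {w : Fin 2 → (Fin 3 → V) → (Fin 3 → V)}
    {X : Fin 3 → V} {s t : ℂ} (h : IsFocal Q w X s t) {c : ℂ} (hc : c ≠ 0) :
    IsFocal Q w X (c * s) (c * t) := by
  refine ⟨h.1.imp (mul_ne_zero hc) (mul_ne_zero hc), fun p => ?_⟩
  have := h.2 p
  rw [minorA_combination] at this ⊢
  linear_combination c ^ 2 * this

namespace IsTangentChart

variable {S : Set Plane} {P : V →ₗ[ℂ] (Fin 3 → ℂ)} {Q : V →ₗ[ℂ] (Fin 2 → ℂ)}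
  {f : (Fin 3 → V) → ℂ} {w : Fin 2 → (Fin 3 → V) → (Fin 3 → V)}

/-- A tangent chart may be restricted to the complement of a hypersurface. -/
theorem mul (hw : IsTangentChart S P Q f w) {g : (Fin 3 → V) → ℂ} (hg : IsPoly g) :
    IsTangentChart S P Q (fun X => f X * g X) w where
  isPoly := hw.isPoly.mul hg
  isPolyField := hw.isPolyField
  eq_zero := hw.eq_zero
  surjective := hw.surjective
  det_ne_zero X hX := hw.det_ne_zero X (left_ne_zero_of_mul hX)
  proj_field := hw.proj_field
  exists_frame_of_hasDerivAt A hA hf := hw.exists_frame_of_hasDerivAt A hA (left_ne_zero_of_mul hf)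
  exists_coordinates := by
    obtain ⟨ξ, δ, h1, h2, h3, h4⟩ := hw.exists_coordinates
    exact ⟨ξ, δ, h1, fun X hX => h2 X (left_ne_zero_of_mul hX), h3,
      fun A hA hf => h4 A hA (left_ne_zero_of_mul hf)⟩

/-- A linear change of the two fields of a tangent chart. -/
theorem changeBasis (hw : IsTangentChart S P Q f w) {s t r q : ℂ} (h : s * q - r * t ≠ 0) :
    IsTangentChart S P Q f
      ![fun X => s • w 0 X + t • w 1 X, fun X => r • w 0 X + q • w 1 X] where
  isPoly := hw.isPoly
  isPolyField k := by
    have h : ∀ c k, IsPolyField fun X => (c : ℂ) • w k X := fun c k =>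
      .smul (IsPoly.const c) (hw.isPolyField k)
    fin_cases k
    · exact (h s 0).add (h t 1)
    · exact (h r 0).add (h q 1)
  eq_zero := hw.eq_zero
  surjective := hw.surjective
  det_ne_zero := hw.det_ne_zero
  proj_field k X i := by
    fin_cases k
    · exact hw.proj_combination _ _ _ _
    · exact hw.proj_combination _ _ _ _
  exists_frame_of_hasDerivAt A hA hf c u hu0 hu :=
    hw.exists_frame_of_hasDerivAt A hA hf
      (fun z => ![c z 0 * s + c z 1 * r, c z 0 * t + c z 1 * q]) u hu0 <| hu.mono fun z hz => by
        convert hz using 1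
        simp only [Matrix.cons_val_zero, Matrix.cons_val_one]
        module
  exists_coordinates := by
    obtain ⟨ξ, δ, h1, h2, h3, h4⟩ := hw.exists_coordinates
    refine ⟨![q • ξ 0 - r • ξ 1, s • ξ 1 - t • ξ 0], fun X => (s * q - r * t) * δ X,
      (IsPoly.const _).mul h1, fun X hX => mul_ne_zero h (h2 X hX), fun X => ?_,
      fun A hA hf X hX hXP => ?_⟩
    · obtain ⟨e1, e2, e3, e4⟩ := h3 X
      simp only [Matrix.cons_val_zero, Matrix.cons_val_one, LinearMap.sub_apply,
        LinearMap.smul_apply, map_add, map_smul, e1, e2, e3, e4, smul_eq_mul]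
      refine ⟨?_, ?_, ?_, ?_⟩ <;> ring
    · have := h4 A hA hf X hX hXP
      simp only [Matrix.cons_val_zero, Matrix.cons_val_one, LinearMap.sub_apply,
        LinearMap.smul_apply, smul_eq_mul]
      rw [mul_smul, this]
      module

end IsTangentChart

/-- All tangent directions are focal line directions, at the frames where `f` does not vanish. -/
def AllFocal (S : Set Plane) (Q : V →ₗ[ℂ] (Fin 2 → ℂ)) (f : (Fin 3 → V) → ℂ)
    (w : Fin 2 → (Fin 3 → V) → (Fin 3 → V)) : Prop :=
  ∀ A : Frame, A.plane ∈ S → f A.vec ≠ 0 → ∀ s t, s ≠ 0 ∨ t ≠ 0 → IsFocal Q w A.vec s t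

/-- There are no focal line directions, at the frames where `f` does not vanish. -/
def NoFocal (S : Set Plane) (Q : V →ₗ[ℂ] (Fin 2 → ℂ)) (f : (Fin 3 → V) → ℂ)
    (w : Fin 2 → (Fin 3 → V) → (Fin 3 → V)) : Prop :=
  ∀ A : Frame, A.plane ∈ S → f A.vec ≠ 0 → ∀ s t, ¬ IsFocal Q w A.vec s t

/-- At the frames where `f` does not vanish, the only focal line direction is that of
`n w₀ + d w₁`, where `n`, `d` are polynomials. -/
def UniqueFocal (S : Set Plane) (Q : V →ₗ[ℂ] (Fin 2 → ℂ)) (f : (Fin 3 → V) → ℂ)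
    (w : Fin 2 → (Fin 3 → V) → (Fin 3 → V)) (n d : (Fin 3 → V) → ℂ) : Prop :=
  IsPoly n ∧ IsPoly d ∧ ∀ A : Frame, A.plane ∈ S → f A.vec ≠ 0 → d A.vec ≠ 0 ∧
    ∀ s t, IsFocal Q w A.vec s t ↔ (s ≠ 0 ∨ t ≠ 0) ∧ s * d A.vec = t * n A.vec

/-- At the frames where `f` does not vanish, the focal line directions are given by the vanishing of
the minor with index `p`, and this binary quadratic form has two distinct roots. -/
def TwoFocal (S : Set Plane) (Q : V →ₗ[ℂ] (Fin 2 → ℂ)) (f : (Fin 3 → V) → ℂ)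
    (w : Fin 2 → (Fin 3 → V) → (Fin 3 → V)) (p : Fin 3 × Fin 3) : Prop :=
  ∀ A : Frame, A.plane ∈ S → f A.vec ≠ 0 → minorA Q (w 0 A.vec) p ≠ 0 ∧
    minorB Q (w 0 A.vec) (w 1 A.vec) p ^ 2 -
      4 * minorA Q (w 0 A.vec) p * minorA Q (w 1 A.vec) p ≠ 0 ∧
    ∀ s t, IsFocal Q w A.vec s t ↔ (s ≠ 0 ∨ t ≠ 0) ∧ minorA Q (s • w 0 A.vec + t • w 1 A.vec) p = 0

/-- The polynomial function `f` does not vanish identically on the frames of planes of `S`. -/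
def IsNonzeroOn (S : Set Plane) (f : (Fin 3 → V) → ℂ) : Prop :=
  ∃ A : Frame, A.plane ∈ S ∧ f A.vec ≠ 0

/-- A function vanishes identically where `f` does not vanish, or else its product with `f` is not
identically zero. -/
theorem forall_eq_zero_or_isNonzeroOn (S : Set Plane) (f g : (Fin 3 → V) → ℂ) :
    (∀ A : Frame, A.plane ∈ S → f A.vec ≠ 0 → g A.vec = 0) ∨ IsNonzeroOn S fun X => f X * g X := by
  by_cases h : ∀ A : Frame, A.plane ∈ S → f A.vec ≠ 0 → g A.vec = 0
  · exact .inl h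
  · push Not at h
    obtain ⟨A, h1, h2, h3⟩ := h
    exact .inr ⟨A, h1, mul_ne_zero h2 h3⟩

namespace IsTangentChart

variable {S : Set Plane} {P : V →ₗ[ℂ] (Fin 3 → ℂ)} {Q : V →ₗ[ℂ] (Fin 2 → ℂ)}
  {f : (Fin 3 → V) → ℂ} {w : Fin 2 → (Fin 3 → V) → (Fin 3 → V)}

/-- If there is at most one candidate `n w₀ + d w₁` for a focal line direction, then it is
generically a focal line direction, or generically none. -/
theorem exists_of_candidate (hw : IsTangentChart S P Q f w) (hf : IsNonzeroOn S f)
    {n d : (Fin 3 → V) → ℂ} (hn : IsPoly n) (hd : IsPoly d)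
    (h : ∀ A : Frame, A.plane ∈ S → f A.vec ≠ 0 → d A.vec ≠ 0 ∧
      ∀ s t, IsFocal Q w A.vec s t → s * d A.vec = t * n A.vec) :
    ∃ f', IsTangentChart S P Q f' w ∧ IsNonzeroOn S f' ∧
      (NoFocal S Q f' w ∨ UniqueFocal S Q f' w n d) := by
  -- either all minors vanish identically at the candidate, or one of them is generically nonzero
  by_cases hall : ∀ p, ∀ A : Frame, A.plane ∈ S → f A.vec ≠ 0 →
      minorA Q (n A.vec • w 0 A.vec + d A.vec • w 1 A.vec) p = 0
  · refine ⟨f, hw, hf, .inr ⟨hn, hd, fun A hA hfA => ⟨(h A hA hfA).1, fun s t =>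
      ⟨fun hst => ⟨hst.1, (h A hA hfA).2 s t hst⟩, fun ⟨h0, h1⟩ => ?_⟩⟩⟩⟩
    have hd0 := (h A hA hfA).1
    have ht : t ≠ 0 := by
      rintro rfl
      rw [zero_mul] at h1
      exact h0.elim (fun hs => mul_ne_zero hs hd0 h1) fun ht => ht rfl
    have h2 : IsFocal Q w A.vec (n A.vec) (d A.vec) := ⟨.inr hd0, fun p => hall p A hA hfA⟩
    have h3 := h2.smul (c := t / d A.vec) (div_ne_zero ht hd0)
    have h4 : t / d A.vec * n A.vec = s := by field_simp; rw [← h1, mul_comm]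
    rwa [div_mul_cancel₀ _ hd0, h4] at h3
  · push Not at hall
    obtain ⟨p, A₀, hA₀, hf₀, h₀⟩ := hall
    have hpoly : IsPoly fun X => minorA Q (n X • w 0 X + d X • w 1 X) p := by
      simp only [minorA_combination, pow_two]
      exact (((hw.isPoly_minorA 0 p).mul (hn.mul hn)).add
        ((hw.isPoly_minorB p).mul (hn.mul hd))).add
        ((hw.isPoly_minorA 1 p).mul (hd.mul hd))
    refine ⟨_, hw.mul hpoly, ⟨A₀, hA₀, mul_ne_zero hf₀ h₀⟩, .inl fun A hA hfA s t hst => ?_⟩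
    obtain ⟨hd0, h1⟩ := h A hA (left_ne_zero_of_mul hfA)
    have h2 := h1 s t hst
    have ht : t ≠ 0 := by
      rintro rfl
      rw [zero_mul] at h2
      exact hst.1.elim (fun hs => mul_ne_zero hs hd0 h2) fun ht => ht rfl
    have h3 := (hst.smul (c := d A.vec / t) (div_ne_zero hd0 ht)).2 p
    have h4 : d A.vec / t * s = n A.vec := by field_simp; rw [mul_comm, h2, mul_comm]
    rw [div_mul_cancel₀ _ ht, h4] at h3
    exact right_ne_zero_of_mul hfA h3

/-- If the leading coefficient of some minor is generically nonzero, the focal line directions of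
the general plane are of one of three kinds. -/
theorem exists_kind_of_leading_coeff (hw : IsTangentChart S P Q f w) {p : Fin 3 × Fin 3}
    (hf : IsNonzeroOn S fun X => f X * minorA Q (w 0 X) p) :
    ∃ f', IsTangentChart S P Q f' w ∧ IsNonzeroOn S f' ∧
      (NoFocal S Q f' w ∨ (∃ n d, UniqueFocal S Q f' w n d) ∨ TwoFocal S Q f' w p) := by
  have hA := fun p => hw.isPoly_minorA 0 p
  have hB := fun p => hw.isPoly_minorB p
  have hC := fun p => hw.isPoly_minorA 1 p
  have hw1 := hw.mul (hA p)
  have hΔ : IsPoly fun X => minorB Q (w 0 X) (w 1 X) p * minorB Q (w 0 X) (w 1 X) p -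
      4 * (minorA Q (w 0 X) p * minorA Q (w 1 X) p) :=
    ((hB p).mul (hB p)).sub ((IsPoly.const 4).mul ((hA p).mul (hC p)))
  rcases forall_eq_zero_or_isNonzeroOn S (fun X => f X * minorA Q (w 0 X) p)
    (fun X => minorB Q (w 0 X) (w 1 X) p * minorB Q (w 0 X) (w 1 X) p -
      4 * (minorA Q (w 0 X) p * minorA Q (w 1 X) p)) with h0 | h0
  · -- the minor is a square
    obtain ⟨f', h1, h2, h3⟩ := hw1.exists_of_candidate hf
      (n := fun X => -minorB Q (w 0 X) (w 1 X) p)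
      (d := fun X => 2 * minorA Q (w 0 X) p) (hB p).neg ((IsPoly.const 2).mul (hA p))
      fun A hAS hfA => ⟨mul_ne_zero two_ne_zero (right_ne_zero_of_mul hfA), fun s t hst => by
        have e1 := h0 A hAS hfA
        have e2 := hst.2 p
        rw [minorA_combination] at e2
        rw [← sub_eq_zero, ← sq_eq_zero_iff]
        linear_combination 4 * minorA Q (w 0 A.vec) p * e2 + t ^ 2 * e1⟩
    exact ⟨f', h1, h2, h3.imp id fun h => .inl ⟨_, _, h⟩⟩
  have hw2 := hw1.mul hΔ
  -- the resultants of the given minor and another one, with the common factor `t` divided out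
  let β : Fin 3 × Fin 3 → (Fin 3 → V) → ℂ := fun p' X =>
    minorA Q (w 0 X) p * minorB Q (w 0 X) (w 1 X) p' -
      minorA Q (w 0 X) p' * minorB Q (w 0 X) (w 1 X) p
  let c : Fin 3 × Fin 3 → (Fin 3 → V) → ℂ := fun p' X =>
    minorA Q (w 0 X) p * minorA Q (w 1 X) p' - minorA Q (w 0 X) p' * minorA Q (w 1 X) p
  have hβ : ∀ p', IsPoly (β p') := fun p' => ((hA p).mul (hB p')).sub ((hA p').mul (hB p))
  have hc : ∀ p', IsPoly (c p') := fun p' => ((hA p).mul (hC p')).sub ((hA p').mul (hC p))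
  have hlin : ∀ p' X s t, minorA Q (w 0 X) p * minorA Q (s • w 0 X + t • w 1 X) p' =
      minorA Q (w 0 X) p' * minorA Q (s • w 0 X + t • w 1 X) p + t * (s * β p' X + t * c p' X) :=
    fun p' X s t => by simp only [minorA_combination, β, c]; ring
  have hne : ∀ {X s t}, minorA Q (w 0 X) p ≠ 0 → IsFocal Q w X s t → t ≠ 0 := by
    rintro X s t ha hst rfl
    have := hst.2 p
    rw [minorA_combination] at this
    simp only [mul_zero, add_zero, zero_pow two_ne_zero] at this
    exact hst.1.elim (fun hs => mul_ne_zero ha (pow_ne_zero 2 hs) this) fun ht => ht rfl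
  by_cases hβ0 : ∃ p', IsNonzeroOn S fun X => (f X * minorA Q (w 0 X) p) *
      (minorB Q (w 0 X) (w 1 X) p * minorB Q (w 0 X) (w 1 X) p -
      4 * (minorA Q (w 0 X) p * minorA Q (w 1 X) p)) * β p' X
  · obtain ⟨p', hp'⟩ := hβ0
    obtain ⟨f', h1, h2, h3⟩ := (hw2.mul (hβ p')).exists_of_candidate hp' (hc p').neg (hβ p')
      fun A hAS hfA => ⟨right_ne_zero_of_mul hfA, fun s t hst => by
        have ht := hne (right_ne_zero_of_mul (left_ne_zero_of_mul (left_ne_zero_of_mul hfA))) hst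
        have e := hlin p' A.vec s t
        rw [hst.2 p, hst.2 p', mul_zero, mul_zero, zero_add] at e
        have := (mul_eq_zero.1 e.symm).resolve_left ht
        linear_combination this⟩
    exact ⟨f', h1, h2, h3.imp id fun h => .inl ⟨_, _, h⟩⟩
  have hβ1 := fun p' => (forall_eq_zero_or_isNonzeroOn S _ (β p')).resolve_right
    fun h => hβ0 ⟨p', h⟩
  by_cases hc0 : ∃ p', IsNonzeroOn S fun X => (f X * minorA Q (w 0 X) p) *
      (minorB Q (w 0 X) (w 1 X) p * minorB Q (w 0 X) (w 1 X) p -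
      4 * (minorA Q (w 0 X) p * minorA Q (w 1 X) p)) * c p' X
  · obtain ⟨p', hp'⟩ := hc0
    refine ⟨_, hw2.mul (hc p'), hp', .inl fun A hAS hfA s t hst => ?_⟩
    have ht := hne (right_ne_zero_of_mul (left_ne_zero_of_mul (left_ne_zero_of_mul hfA))) hst
    have e := hlin p' A.vec s t
    rw [hst.2 p, hst.2 p', hβ1 p' A hAS (left_ne_zero_of_mul hfA), mul_zero, mul_zero, mul_zero,
      zero_add, zero_add] at e
    exact mul_ne_zero ht (mul_ne_zero ht (right_ne_zero_of_mul hfA)) e.symm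
  have hc1 := fun p' => (forall_eq_zero_or_isNonzeroOn S _ (c p')).resolve_right
    fun h => hc0 ⟨p', h⟩
  refine ⟨_, hw2, h0, .inr (.inr fun A hAS hfA =>
    ⟨right_ne_zero_of_mul (left_ne_zero_of_mul hfA), ?_, fun s t =>
      ⟨fun h => ⟨h.1, h.2 p⟩, fun h => ⟨h.1, fun p' => ?_⟩⟩⟩)⟩
  · rw [pow_two, mul_assoc 4]; exact right_ne_zero_of_mul hfA
  · have e := hlin p' A.vec s t
    rw [h.2, hβ1 p' A hAS hfA, hc1 p' A hAS hfA, mul_zero, mul_zero, mul_zero, add_zero, mul_zero,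
      add_zero] at e
    exact (mul_eq_zero.1 e).resolve_left (right_ne_zero_of_mul (left_ne_zero_of_mul hfA))

/-- The focal line directions of the general plane are of one of four kinds. -/
theorem exists_kind (hw : IsTangentChart S P Q f w) (hf : IsNonzeroOn S f) :
    ∃ f' w', IsTangentChart S P Q f' w' ∧ IsNonzeroOn S f' ∧
      (AllFocal S Q f' w' ∨ NoFocal S Q f' w' ∨ (∃ n d, UniqueFocal S Q f' w' n d) ∨
        ∃ p, TwoFocal S Q f' w' p) := by
  have lead : ∀ {w'} p, IsTangentChart S P Q f w' →
      (IsNonzeroOn S fun X => f X * minorA Q (w' 0 X) p) →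
      ∃ f' w', IsTangentChart S P Q f' w' ∧ IsNonzeroOn S f' ∧
      (AllFocal S Q f' w' ∨ NoFocal S Q f' w' ∨ (∃ n d, UniqueFocal S Q f' w' n d) ∨
        ∃ p, TwoFocal S Q f' w' p) := fun p hw' h => by
    obtain ⟨f', h1, h2, h3⟩ := hw'.exists_kind_of_leading_coeff h
    exact ⟨f', _, h1, h2, .inr (h3.imp id (.imp id fun h => ⟨p, h⟩))⟩
  -- a linear change of `w 0` and `w 1` makes the leading coefficient of a nonzero minor nonzero
  by_cases ha : ∃ p, IsNonzeroOn S fun X => f X * minorA Q (w 0 X) p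
  · obtain ⟨p, hp⟩ := ha
    exact lead p hw hp
  by_cases hc : ∃ p, IsNonzeroOn S fun X => f X * minorA Q (w 1 X) p
  · obtain ⟨p, hp⟩ := hc
    refine lead p (hw.changeBasis (s := 0) (t := 1) (r := 1) (q := 0) (by norm_num)) ?_
    simpa using hp
  have ha' := fun p => (forall_eq_zero_or_isNonzeroOn S f fun X => minorA Q (w 0 X) p).resolve_right
    fun h => ha ⟨p, h⟩
  have hc' := fun p => (forall_eq_zero_or_isNonzeroOn S f fun X => minorA Q (w 1 X) p).resolve_right
    fun h => hc ⟨p, h⟩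
  by_cases hb : ∃ p, IsNonzeroOn S fun X => f X * minorB Q (w 0 X) (w 1 X) p
  · obtain ⟨p, A, hA, hp⟩ := hb
    refine lead p (hw.changeBasis (s := 1) (t := 1) (r := 0) (q := 1) (by norm_num)) ⟨A, hA, ?_⟩
    have e := minorA_combination Q (w 0 A.vec) (w 1 A.vec) 1 1 p
    simp only [ha' p A hA (left_ne_zero_of_mul hp), hc' p A hA (left_ne_zero_of_mul hp)] at e
    simp only [Matrix.cons_val_zero]
    rw [e]
    simpa using hp
  have hb' := fun p =>
    (forall_eq_zero_or_isNonzeroOn S f fun X => minorB Q (w 0 X) (w 1 X) p).resolve_right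
      fun h => hb ⟨p, h⟩
  refine ⟨f, w, hw, hf, .inl fun A hA hfA s t hst => ⟨hst, fun p => ?_⟩⟩
  have e1 := ha' p A hA hfA
  have e2 := hb' p A hA hfA
  have e3 := hc' p A hA hfA
  rw [minorA_combination, e1, e2, e3]
  ring

/-! ### The possible numbers of focal line directions -/

theorem allDirections (hw : IsTangentChart S P Q f w) (h : AllFocal S Q f w) {A : Frame}
    (hA : A.plane ∈ S) (hf : f A.vec ≠ 0) : AllDirections S A := by
  intro φ hφ hφ0
  obtain ⟨s, t, rfl⟩ := hw.exists_eq_charMap hA hf hφ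
  refine (hw.isFocalLineDirection_iff hA hf s t).2 (h A hA hf s t ?_)
  by_contra! h0
  exact hφ0 (by rw [h0.1, h0.2, zero_smul, zero_smul, add_zero, map_zero])

theorem not_isFocalLineDirection (hw : IsTangentChart S P Q f w) (h : NoFocal S Q f w) {A : Frame}
    (hA : A.plane ∈ S) (hf : f A.vec ≠ 0) (φ : NormalSection A) : ¬ IsFocalLineDirection S A φ := by
  intro hφ
  obtain ⟨s, t, rfl⟩ := hw.exists_eq_charMap hA hf hφ.1
  exact h A hA hf s t ((hw.isFocalLineDirection_iff hA hf s t).1 hφ)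

/-- A unique candidate is simple for the general plane, or multiple for the general plane. -/
theorem general_of_uniqueFocal (hw : IsTangentChart S P Q f w) (hf : IsNonzeroOn S f)
    {n d : (Fin 3 → V) → ℂ} (h : UniqueFocal S Q f w n d) :
    General S (OneDirection S) ∨ General S (TwoCoincidentDirections S) := by
  obtain ⟨hn, hd, h⟩ := h
  have key : ∀ A : Frame, A.plane ∈ S → f A.vec ≠ 0 →
      IsFocalLineDirection S A (charMap A (n A.vec • w 0 A.vec + d A.vec • w 1 A.vec)) ∧
      ∀ ψ, IsFocalLineDirection S A ψ →
        ∃ c : ℂ, ψ = c • charMap A (n A.vec • w 0 A.vec + d A.vec • w 1 A.vec) := by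
    intro A hA hfA
    obtain ⟨hd0, h1⟩ := h A hA hfA
    refine ⟨(hw.isFocalLineDirection_iff hA hfA _ _).2 ((h1 _ _).2 ⟨.inr hd0, mul_comm _ _⟩),
      fun ψ hψ => ?_⟩
    obtain ⟨s, t, rfl⟩ := hw.exists_eq_charMap hA hfA hψ.1
    have h2 := ((h1 s t).1 ((hw.isFocalLineDirection_iff hA hfA s t).1 hψ)).2
    refine ⟨t / d A.vec, ?_⟩
    have h3 : t / d A.vec * n A.vec = s := by field_simp; rw [← h2, mul_comm]
    rw [smul_charMap_combination, div_mul_cancel₀ _ hd0, h3]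
  -- the derivatives of the minors at the focal line direction
  let e : (Fin 3 × Fin 3) × Fin 2 → (Fin 3 → V) → ℂ := fun q X => ![
    2 * minorA Q (w 0 X) q.1 * n X + minorB Q (w 0 X) (w 1 X) q.1 * d X,
    minorB Q (w 0 X) (w 1 X) q.1 * n X + 2 * minorA Q (w 1 X) q.1 * d X] q.2
  have he : ∀ q, IsPoly (e q) := by
    rintro ⟨p, k⟩
    fin_cases k
    · exact (((IsPoly.const 2).mul (hw.isPoly_minorA 0 p)).mul hn).add ((hw.isPoly_minorB p).mul hd)
    · exact ((hw.isPoly_minorB p).mul hn).add (((IsPoly.const 2).mul (hw.isPoly_minorA 1 p)).mul hd)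
  by_cases hq : ∃ q, IsNonzeroOn S fun X => f X * e q X
  · obtain ⟨q, hq⟩ := hq
    refine .inl (general_of_isPoly (hw.isPoly.mul (he q)) hq (fun A hA hfA => ?_)
      fun A g h => h.act g)
    obtain ⟨h1, h2⟩ := key A hA (left_ne_zero_of_mul hfA)
    refine ⟨_, h1, fun hm => right_ne_zero_of_mul hfA ?_, h2⟩
    have := (hw.isMultipleDirection_iff hA (left_ne_zero_of_mul hfA) _ _).1 hm q.1
    obtain ⟨p, k⟩ := q
    fin_cases k
    · exact this.1
    · exact this.2
  · have hq' := fun q => (forall_eq_zero_or_isNonzeroOn S f (e q)).resolve_right fun h => hq ⟨q, h⟩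
    refine .inr (general_of_isPoly hw.isPoly hf (fun A hA hfA => ?_) fun A g h => h.act g)
    obtain ⟨h1, h2⟩ := key A hA hfA
    exact ⟨_, h1, (hw.isMultipleDirection_iff hA hfA _ _).2 fun p =>
      ⟨hq' (p, 0) A hA hfA, hq' (p, 1) A hA hfA⟩, h2⟩

theorem twoDistinctDirections (hw : IsTangentChart S P Q f w) {p : Fin 3 × Fin 3}
    (h : TwoFocal S Q f w p) {A : Frame} (hA : A.plane ∈ S) (hf : f A.vec ≠ 0) :
    TwoDistinctDirections S A := by
  obtain ⟨ha, hΔ, h⟩ := h A hA hf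
  simp only [minorA_combination] at h
  generalize minorA Q (w 0 A.vec) p = a at *
  generalize minorA Q (w 1 A.vec) p = c at *
  generalize minorB Q (w 0 A.vec) (w 1 A.vec) p = b at *
  obtain ⟨r, hr⟩ := IsAlgClosed.exists_pow_nat_eq (b ^ 2 - 4 * a * c) (n := 2) (by norm_num)
  have hr0 : r ≠ 0 := by
    rintro rfl; exact hΔ (by rw [← hr]; norm_num)
  have hfoc : ∀ r, r ^ 2 = b ^ 2 - 4 * a * c → IsFocalLineDirection S A
      (charMap A (((-b + r) / (2 * a)) • w 0 A.vec + (1 : ℂ) • w 1 A.vec)) := fun r hr =>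
    (hw.isFocalLineDirection_iff hA hf _ _).2 ((h _ _).2 ⟨.inr one_ne_zero, by
      field_simp; linear_combination hr⟩)
  refine ⟨_, _, LinearIndependent.pair_iff.2 fun s t hst => ?_, hfoc r hr,
    hfoc (-r) (by rw [neg_sq, hr]), fun ψ hψ => ?_⟩
  · rw [smul_charMap_combination, smul_charMap_combination, ← map_add] at hst
    have h1 : (s * ((-b + r) / (2 * a)) + t * ((-b + -r) / (2 * a))) • w 0 A.vec +
        (s + t) • w 1 A.vec = 0 := by
      rw [← hw.charMap_eq_zero_iff_of_proj hf (hw.proj_combination _ _ _), ← hst]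
      congr 1
      module
    rw [hw.combination_eq_zero_iff hf] at h1
    obtain ⟨h1, h2⟩ := h1
    obtain rfl : t = -s := by linear_combination h2
    have h3 : s * r = 0 := by
      field_simp at h1
      linear_combination (1 / 2) * h1
    have hs := (mul_eq_zero.1 h3).resolve_right hr0
    exact ⟨hs, by rw [hs, neg_zero]⟩
  · obtain ⟨s, t, rfl⟩ := hw.exists_eq_charMap hA hf hψ.1
    have h2 := ((h s t).1 ((hw.isFocalLineDirection_iff hA hf s t).1 hψ)).2
    have h3 : (2 * a * s - (-b + r) * t) * (2 * a * s - (-b + -r) * t) = 0 := by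
      linear_combination 4 * a * h2 - t ^ 2 * hr
    rcases mul_eq_zero.1 h3 with h3 | h3
    · refine .inl ⟨t, ?_⟩
      rw [smul_charMap_combination, mul_one, show t * ((-b + r) / (2 * a)) = s by
        field_simp; linear_combination -h3]
    · refine .inr ⟨t, ?_⟩
      rw [smul_charMap_combination, mul_one, show t * ((-b + -r) / (2 * a)) = s by
        field_simp; linear_combination -h3]

end IsTangentChart

/-! ### Families of planes in a tangent chart -/

theorem IsPoly.analyticAt {f : (Fin 3 → V) → ℂ} (hf : IsPoly f) (X : Fin 3 → V) :
    AnalyticAt ℂ f X :=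
  (contDiff_omega_iff_analyticOnNhd.1 hf.contDiff) X (Set.mem_univ X)

theorem analyticAt_linear_comp {E F : Type*} [NormedAddCommGroup E] [NormedSpace ℂ E]
    [FiniteDimensional ℂ E] [NormedAddCommGroup F] [NormedSpace ℂ F] (ℓ : E →ₗ[ℂ] F) {u : ℂ → E}
    {t : ℂ} (hu : AnalyticAt ℂ u t) : AnalyticAt ℂ (fun s => ℓ (u s)) t :=
  ((LinearMap.toContinuousLinearMap ℓ).analyticAt _).comp hu

theorem hasDerivAt_linear_comp {E F : Type*} [NormedAddCommGroup E] [NormedSpace ℂ E]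
    [FiniteDimensional ℂ E] [NormedAddCommGroup F] [NormedSpace ℂ F] (ℓ : E →ₗ[ℂ] F) {u : ℂ → E}
    {u' : E} {t : ℂ} (hu : HasDerivAt u u' t) : HasDerivAt (fun s => ℓ (u s)) (ℓ u') t :=
  (LinearMap.toContinuousLinearMap ℓ).hasFDerivAt.comp_hasDerivAt t hu

theorem analyticAt_det {n : Type*} [Fintype n] [DecidableEq n] {M : ℂ → Matrix n n ℂ} {t : ℂ}
    (hM : ∀ i j, AnalyticAt ℂ (fun s => M s i j) t) : AnalyticAt ℂ (fun s => (M s).det) t := by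
  simp only [Matrix.det_apply']
  exact Finset.analyticAt_fun_sum _ fun σ _ => analyticAt_const.mul
    (Finset.analyticAt_fun_prod _ fun i _ => hM _ _)

theorem analyticAt_inv {n : Type*} [Fintype n] [DecidableEq n] {M : ℂ → Matrix n n ℂ} {t : ℂ}
    (hM : ∀ i j, AnalyticAt ℂ (fun s => M s i j) t) (h : (M t).det ≠ 0) (i j : n) :
    AnalyticAt ℂ (fun s => (M s)⁻¹ i j) t := by
  simp only [Matrix.inv_def, Ring.inverse_eq_inv', Matrix.smul_apply, smul_eq_mul,
    Matrix.adjugate_apply]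
  refine ((analyticAt_det hM).inv h).mul (analyticAt_det fun i' j' => ?_)
  by_cases hi : i' = j
  · subst hi; simpa using analyticAt_const
  · simpa [Matrix.updateRow_ne hi] using hM _ _

/-- A family can be normalized by a change of frames, depending on the parameter, such that the
projections of the vectors of the frame are constant. The derivative of the change of frames
contributes to the velocity vectors in the plane only, which the characteristic map ignores. -/
theorem exists_normalized_family {S : Set Plane} {P : V →ₗ[ℂ] (Fin 3 → ℂ)} {A : Frame}
    (hP : (projMatrix P A.vec).det ≠ 0) {γ : ℂ → Frame} (hγ : IsFamilyThrough S A γ) :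
    ∃ u : ℂ → (Fin 3 → V), AnalyticAt ℂ u 0 ∧ u 0 = A.vec ∧
      charMap A (deriv u 0) = initialTangent A γ ∧
      (∀ᶠ t in 𝓝 (0 : ℂ), ∀ i, P (deriv u t i) = 0) ∧
      ∀ᶠ t in 𝓝 (0 : ℂ), ∃ B : Frame, B.vec = u t ∧ B.plane ∈ S ∧ B.plane = (γ t).plane ∧
        (IsFocalLine (γ t) (velocity γ t) ↔ IsFocalLine B (charMap B (deriv u t))) := by
  obtain ⟨ha, rfl, hmem, -⟩ := hγ
  let M : ℂ → Matrix (Fin 3) (Fin 3) ℂ := fun t => projMatrix P (γ t).vec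
  let N : ℂ → Matrix (Fin 3) (Fin 3) ℂ := fun t => M 0 * (M t)⁻¹
  have hM : ∀ i j, AnalyticAt ℂ (fun t => M t i j) 0 := fun i j =>
    analyticAt_linear_comp (LinearMap.proj j ∘ₗ P ∘ₗ LinearMap.proj i) ha
  have hN : ∀ i j, AnalyticAt ℂ (fun t => N t i j) 0 := fun i j => by
    change AnalyticAt ℂ (fun t => ∑ k, M 0 i k * (M t)⁻¹ k j) 0
    exact Finset.analyticAt_fun_sum _ fun k _ => analyticAt_const.mul (analyticAt_inv hM hP k j)
  have hc : ∀ i, AnalyticAt ℂ (fun t => (γ t).vec i) 0 := fun i =>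
    analyticAt_linear_comp (LinearMap.proj i) ha
  let u : ℂ → (Fin 3 → V) := fun t => act (N t) (γ t).vec
  have hu : AnalyticAt ℂ u 0 := analyticAt_pi_iff.2 fun i => by
    have : AnalyticAt ℂ (fun t => ∑ j, N t i j • (γ t).vec j) 0 :=
      Finset.analyticAt_fun_sum _ fun j _ => (hN i j).smul (hc j)
    simpa only [u, act_apply] using this
  have hN0 : N 0 = 1 := Matrix.mul_nonsing_inv _ (isUnit_iff_ne_zero.2 hP)
  have hu0 : u 0 = (γ 0).vec := by simp only [u, hN0, act_one]
  let N' : ℂ → Matrix (Fin 3) (Fin 3) ℂ := fun t => Matrix.of fun i j => deriv (fun s => N s i j) t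
  have hN' : ∀ᶠ t in 𝓝 (0 : ℂ), ∀ i j, HasDerivAt (fun s => N s i j) (N' t i j) t :=
    eventually_all.2 fun i => eventually_all.2 fun j =>
      (hN i j).eventually_analyticAt.mono fun t ht => ht.differentiableAt.hasDerivAt
  have hu' : ∀ᶠ t in 𝓝 (0 : ℂ), deriv u t =
      act (N' t) (γ t).vec + act (N t) (deriv (fun s => (γ s).vec) t) := by
    filter_upwards [hN', ha.eventually_analyticAt] with t h1 h2
    have h3 := hasDerivAt_pi.1 h2.differentiableAt.hasDerivAt
    refine HasDerivAt.deriv (hasDerivAt_pi.2 fun i => ?_)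
    have h4 := HasDerivAt.fun_sum (u := Finset.univ) fun j _ => (h1 i j).smul (h3 j)
    refine h4.congr_deriv ?_
    rw [Pi.add_apply, act_apply, act_apply, ← Finset.sum_add_distrib]
    exact Finset.sum_congr rfl fun j _ => add_comm _ _
  have hdet : ∀ᶠ t in 𝓝 (0 : ℂ), (M t).det ≠ 0 :=
    (analyticAt_det hM).continuousAt.eventually_ne hP
  have hPu : ∀ᶠ t in 𝓝 (0 : ℂ), ∀ i, P (u t i) = M 0 i := by
    filter_upwards [hdet] with t ht i
    exact act_mul_inv_of_det_ne_zero ht (M 0) i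
  have hfr : ∀ᶠ t in 𝓝 (0 : ℂ), ∃ g : GL (Fin 3) ℂ, (g : Matrix (Fin 3) (Fin 3) ℂ) = N t := by
    filter_upwards [hdet] with t ht
    refine ⟨Matrix.GeneralLinearGroup.mkOfDetNeZero (N t) ?_, rfl⟩
    rw [Matrix.det_mul, Matrix.det_nonsing_inv, Ring.inverse_eq_inv']
    exact mul_ne_zero hP (inv_ne_zero ht)
  refine ⟨u, hu, hu0, ?_, ?_, ?_⟩
  · rw [hu'.self_of_nhds, hN0, act_one, map_add,
      (charMap_eq_zero_iff _ _).2 fun i => act_mem_span _ _ i, zero_add]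
    rfl
  · filter_upwards [hPu.eventually_nhds, hu.eventually_analyticAt] with t h1 h2 i
    have h3 := hasDerivAt_linear_comp (P ∘ₗ LinearMap.proj i) h2.differentiableAt.hasDerivAt
    exact h3.unique ((hasDerivAt_const t (M 0 i)).congr_of_eventuallyEq (h1.mono fun s hs => hs i))
  · filter_upwards [hfr, hu', hmem] with t ⟨g, hg⟩ h1 h2
    refine ⟨(γ t).act g, by rw [Frame.act_vec, hg], by rwa [Frame.plane_act],
      Frame.plane_act _ _, ?_⟩
    have hz : charMap ((γ t).act g) (act (N' t) (γ t).vec) = 0 :=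
      (charMap_eq_zero_iff _ _).2 fun i => by
        rw [Frame.span_act]
        exact act_mem_span _ _ i
    rw [← isFocalLine_transport g, velocity, transport_charMap, h1, map_add, hz, zero_add, ← hg]

theorem velocity_ne_zero_iff {A : Frame} {γ : ℂ → Frame} (h : γ 0 = A) :
    velocity γ 0 ≠ 0 ↔ initialTangent A γ ≠ 0 := by
  subst h; rfl

/-- A holomorphic curve of triples which are frames of planes of `S` defines a family. -/
theorem exists_family_of_curve {S : Set Plane} {A : Frame} {u : ℂ → (Fin 3 → V)}
    (hu : AnalyticAt ℂ u 0) (hu0 : u 0 = A.vec)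
    (huS : ∀ᶠ z in 𝓝 (0 : ℂ), ∃ B : Frame, B.vec = u z ∧ B.plane ∈ S)
    (hreg : charMap A (deriv u 0) ≠ 0) : ∃ γ : ℂ → Frame, IsFamilyThrough S A γ ∧
      (∀ᶠ t in 𝓝 (0 : ℂ), (γ t).vec = u t ∧ (γ t).plane ∈ S ∧
        velocity γ t = charMap (γ t) (deriv u t)) ∧
      initialTangent A γ = charMap A (deriv u 0) := by
  classical
  let γ : ℂ → Frame := fun t => if h : ∃ B : Frame, B.vec = u t then h.choose else A
  have hγ : ∀ t, (∃ B : Frame, B.vec = u t) → (γ t).vec = u t := fun t h => by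
    simp only [γ, dif_pos h]; exact h.choose_spec
  have hγu : (fun t => (γ t).vec) =ᶠ[𝓝 0] u := huS.mono fun t ⟨B, hB, _⟩ => hγ t ⟨B, hB⟩
  have hstart : γ 0 = A := Frame.vec_injective ((hγ 0 ⟨A, hu0.symm⟩).trans hu0)
  have hmem : ∀ᶠ t in 𝓝 (0 : ℂ), (γ t).plane ∈ S := by
    filter_upwards [huS] with t ⟨B, hB, hBS⟩
    have : γ t = B := Frame.vec_injective ((hγ t ⟨B, hB⟩).trans hB.symm)
    rwa [this]
  have hvel : ∀ᶠ t in 𝓝 (0 : ℂ), velocity γ t = charMap (γ t) (deriv u t) :=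
    hγu.eventuallyEq_nhds.mono fun t ht => by rw [velocity, ht.deriv_eq]
  have hinit : initialTangent A γ = charMap A (deriv u 0) := by rw [initialTangent, hγu.deriv_eq]
  refine ⟨γ, ⟨hu.congr hγu.symm, hstart, hmem, ?_⟩, ?_, hinit⟩
  · rwa [velocity_ne_zero_iff hstart, hinit]
  · filter_upwards [hγu, hmem, hvel] with t h1 h2 h3 using ⟨h1, h2, h3⟩

namespace IsTangentChart

variable {S : Set Plane} {P : V →ₗ[ℂ] (Fin 3 → ℂ)} {Q : V →ₗ[ℂ] (Fin 2 → ℂ)}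
  {f : (Fin 3 → V) → ℂ} {w : Fin 2 → (Fin 3 → V) → (Fin 3 → V)}

/-- The velocity of a normalized family, in coordinates. -/
theorem exists_velocity_coordinates (hw : IsTangentChart S P Q f w) {A : Frame}
    (hf : f A.vec ≠ 0) {γ : ℂ → Frame} (hγ : IsFamilyThrough S A γ) :
    ∃ (u : ℂ → (Fin 3 → V)) (α β : ℂ → ℂ), AnalyticAt ℂ u 0 ∧ AnalyticAt ℂ α 0 ∧
      AnalyticAt ℂ β 0 ∧ u 0 = A.vec ∧
      (∀ᶠ t in 𝓝 (0 : ℂ), HasDerivAt u (α t • w 0 (u t) + β t • w 1 (u t)) t) ∧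
      initialTangent A γ = charMap A (α 0 • w 0 A.vec + β 0 • w 1 A.vec) ∧
      (α 0 ≠ 0 ∨ β 0 ≠ 0) ∧
      ∀ᶠ t in 𝓝 (0 : ℂ), ∃ B : Frame, B.vec = u t ∧ B.plane ∈ S ∧ f (u t) ≠ 0 ∧
        B.plane = (γ t).plane ∧
        (IsFocalLine (γ t) (velocity γ t) ↔ IsFocal Q w (u t) (α t) (β t)) := by
  obtain ⟨u, hu, hu0, hinit, hPu, hfr⟩ := exists_normalized_family (hw.det_ne_zero _ hf) hγ
  obtain ⟨ξ, δ, hδ, hδ0, -, hspan⟩ := hw.exists_coordinates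
  have hfu : ∀ᶠ t in 𝓝 (0 : ℂ), f (u t) ≠ 0 :=
    (ContinuousAt.comp (g := f) (hw.isPoly.analyticAt _).continuousAt hu.continuousAt).eventually_ne
      (by rw [Function.comp_apply, hu0]; exact hf)
  have hα : ∀ k, AnalyticAt ℂ (fun t => ξ k (deriv u t) / δ (u t)) 0 := fun k =>
    (analyticAt_linear_comp (ξ k) hu.deriv).div (AnalyticAt.comp (g := δ) (hδ.analyticAt _) hu)
      (by rw [hu0]; exact hδ0 _ hf)
  have hd : ∀ᶠ t in 𝓝 (0 : ℂ), deriv u t =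
      (ξ 0 (deriv u t) / δ (u t)) • w 0 (u t) + (ξ 1 (deriv u t) / δ (u t)) • w 1 (u t) := by
    filter_upwards [hPu, hfr.eventually_nhds, hfu, hu.eventually_analyticAt] with t h1 h2 h3 h4
    obtain ⟨B, hB, hBS, -⟩ := h2.self_of_nhds
    have hT : deriv u t ∈ frameTangentSpace S B :=
      mem_frameTangentSpace_of_hasDerivAt h4.differentiableAt.hasDerivAt hB.symm
        (h2.mono fun s ⟨C, hC, hCS, _⟩ => ⟨C, hC, hCS⟩)
    have h5 := hspan B hBS (by rwa [hB]) _ hT h1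
    have h6 := hδ0 _ h3
    rw [hB] at h5
    refine smul_right_injective _ h6 ?_
    simp only [h5, smul_add, smul_smul, mul_div_cancel₀ _ h6]
  have hinit' : initialTangent A γ = charMap A ((ξ 0 (deriv u 0) / δ (u 0)) • w 0 A.vec +
      (ξ 1 (deriv u 0) / δ (u 0)) • w 1 A.vec) := by
    rw [← hinit]
    conv_lhs => rw [hd.self_of_nhds, hu0]
    rw [hu0]
  refine ⟨u, _, _, hu, hα 0, hα 1, hu0, ?_, hinit', ?_, ?_⟩
  · filter_upwards [hd, hu.eventually_analyticAt] with t h1 h2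
    rw [← h1]; exact h2.differentiableAt.hasDerivAt
  · by_contra! h
    have h1 : initialTangent A γ ≠ 0 := by
      obtain ⟨-, rfl, -, hreg⟩ := hγ; exact hreg
    exact h1 (by rw [hinit', h.1, h.2, zero_smul, zero_smul, add_zero, map_zero])
  · filter_upwards [hfr, hfu, hd] with t ⟨B, hB, hBS, hBp, hBf⟩ h2 h3
    refine ⟨B, hB, hBS, h2, hBp, ?_⟩
    have e : charMap B (deriv u t) = charMap B ((ξ 0 (deriv u t) / δ (u t)) • w 0 B.vec +
        (ξ 1 (deriv u t) / δ (u t)) • w 1 B.vec) := by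
      rw [hB]; exact congrArg _ h3
    rw [hBf, e, hw.isFocalLine_combination_iff (by rwa [hB]), hB]

/-- A curve tangent to a field of combinations of `w 0` and `w 1` gives a family. -/
theorem exists_family (hw : IsTangentChart S P Q f w) {A : Frame} (hA : A.plane ∈ S)
    (hf : f A.vec ≠ 0) {s t : (Fin 3 → V) → ℂ} (hs : ContDiffAt ℂ 1 s A.vec)
    (ht : ContDiffAt ℂ 1 t A.vec) (h0 : s A.vec ≠ 0 ∨ t A.vec ≠ 0)
    (hfoc : ∀ᶠ X in 𝓝 A.vec, (∃ B : Frame, B.vec = X ∧ B.plane ∈ S) → IsFocal Q w X (s X) (t X)) :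
    ∃ γ, IsFamilyThrough S A γ ∧ IsDevelopable γ ∧
      initialTangent A γ = charMap A (s A.vec • w 0 A.vec + t A.vec • w 1 A.vec) := by
  obtain ⟨u, hua, hu0, hu, huS⟩ := hw.exists_curve hA hf hs ht
  have hd0 : deriv u 0 = s A.vec • w 0 A.vec + t A.vec • w 1 A.vec := by
    rw [hu.self_of_nhds.deriv, hu0]
  obtain ⟨γ, h1, h2, h3⟩ := exists_family_of_curve hua hu0 huS (by
    rw [hd0, Ne, hw.charMap_eq_zero_iff_of_proj hf (hw.proj_combination _ _ _),
      hw.combination_eq_zero_iff hf, not_and_or]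
    exact h0)
  refine ⟨γ, h1, Eventually.filter_mono nhdsWithin_le_nhds ?_, by rw [h3, hd0]⟩
  have hut : Tendsto u (𝓝 0) (𝓝 A.vec) := hu0 ▸ hua.continuousAt.tendsto
  have hfu : ∀ᶠ t in 𝓝 (0 : ℂ), f (u t) ≠ 0 :=
    hut.eventually ((hw.isPoly.analyticAt _).continuousAt.eventually_ne hf)
  filter_upwards [h2, hu, hfu, hut.eventually hfoc] with z ⟨e1, e2, e3⟩ e4 e5 e6
  rw [e3, e4.deriv, ← e1, hw.isFocalLine_combination_iff (by rwa [e1]), e1]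
  exact e6 ⟨_, e1, e2⟩

/-- The tangent vector of a developable family is a focal line direction, since the minors vanish
by continuity. -/
theorem isFocal_zero (hw : IsTangentChart S P Q f w) {γ : ℂ → Frame} (hd : IsDevelopable γ)
    {u : ℂ → (Fin 3 → V)} {α β : ℂ → ℂ} (hu : ContinuousAt u 0) (hα : ContinuousAt α 0)
    (hβ : ContinuousAt β 0) (h0 : α 0 ≠ 0 ∨ β 0 ≠ 0)
    (h : ∀ᶠ t in 𝓝 (0 : ℂ),
      IsFocalLine (γ t) (velocity γ t) ↔ IsFocal Q w (u t) (α t) (β t)) :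
    IsFocal Q w (u 0) (α 0) (β 0) := by
  refine ⟨h0, fun p => ?_⟩
  have hc : ContinuousAt (fun t => minorA Q (α t • w 0 (u t) + β t • w 1 (u t)) p) 0 := by
    simp only [minorA_combination]
    have ha := ContinuousAt.comp (g := fun X => minorA Q (w 0 X) p)
      ((hw.isPoly_minorA 0 p).analyticAt _).continuousAt hu
    have hb := ContinuousAt.comp (g := fun X => minorB Q (w 0 X) (w 1 X) p)
      ((hw.isPoly_minorB p).analyticAt _).continuousAt hu
    have hc := ContinuousAt.comp (g := fun X => minorA Q (w 1 X) p)
      ((hw.isPoly_minorA 1 p).analyticAt _).continuousAt hu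
    exact ((ha.mul (hα.pow 2)).add (hb.mul (hα.mul hβ))).add (hc.mul (hβ.pow 2))
  have h1 : (fun t => minorA Q (α t • w 0 (u t) + β t • w 1 (u t)) p) =ᶠ[𝓝[≠] 0] fun _ => 0 := by
    filter_upwards [hd, h.filter_mono nhdsWithin_le_nhds] with t h1 h2
    exact (h2.1 h1).2 p
  exact tendsto_nhds_unique (hc.tendsto.mono_left nhdsWithin_le_nhds)
    (tendsto_const_nhds.congr' h1.symm)

theorem isFocalLineDirection_initialTangent (hw : IsTangentChart S P Q f w) {A : Frame}
    (hA : A.plane ∈ S) (hf : f A.vec ≠ 0) {γ : ℂ → Frame} (hγ : IsFamilyThrough S A γ)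
    (hd : IsDevelopable γ) : IsFocalLineDirection S A (initialTangent A γ) := by
  obtain ⟨u, α, β, hu, hα, hβ, hu0, -, hinit, h0, hfr⟩ := hw.exists_velocity_coordinates hf hγ
  have := hw.isFocal_zero hd hu.continuousAt hα.continuousAt hβ.continuousAt h0
    (hfr.mono fun t ⟨B, _, _, _, _, h⟩ => h)
  rw [hinit, hw.isFocalLineDirection_iff hA hf, ← hu0]
  exact this

theorem developablesCorrespond_of_allFocal (hw : IsTangentChart S P Q f w) (h : AllFocal S Q f w)
    {A : Frame} (hA : A.plane ∈ S) (hf : f A.vec ≠ 0) : DevelopablesCorrespond S A where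
  isFocalLineDirection γ := hw.isFocalLineDirection_initialTangent hA hf
  exists_family φ hφ := by
    obtain ⟨s, t, rfl⟩ := hw.exists_eq_charMap hA hf hφ.1
    have h0 := ((hw.isFocalLineDirection_iff hA hf s t).1 hφ).1
    refine hw.exists_family hA hf (s := fun _ => s) (t := fun _ => t) contDiffAt_const
      contDiffAt_const h0 ?_
    filter_upwards [(hw.isPoly.analyticAt A.vec).continuousAt.eventually_ne hf] with X hX
    rintro ⟨B, rfl, hB⟩
    exact h B hB hX s t h0
  unique hn := absurd (hw.allDirections h hA hf) hn
  all _ γ hγ := by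
    obtain ⟨u, α, β, hu, hα, hβ, hu0, -, hinit, h0, hfr⟩ := hw.exists_velocity_coordinates hf hγ
    refine Eventually.filter_mono nhdsWithin_le_nhds ?_
    have h1 : ∀ᶠ t in 𝓝 (0 : ℂ), α t ≠ 0 ∨ β t ≠ 0 := by
      rcases h0 with h0 | h0
      · exact (hα.continuousAt.eventually_ne h0).mono fun t => .inl
      · exact (hβ.continuousAt.eventually_ne h0).mono fun t => .inr
    filter_upwards [hfr, h1] with t ⟨B, hB, hBS, hfB, _, hiff⟩ h2
    rw [hiff, ← hB]
    exact h B hBS (by rwa [hB]) _ _ h2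

end IsTangentChart

/-- The focal line directions near the frame `A` are the values of holomorphic functions, which do
not branch: `w 0` is not a focal line direction, and the focal line direction `σ w₀ + w₁` at `A` is
part of a holomorphic field, which contains all neighbouring focal line directions. -/
def HasFocalBranches (S : Set Plane) (Q : V →ₗ[ℂ] (Fin 2 → ℂ))
    (w : Fin 2 → (Fin 3 → V) → (Fin 3 → V)) (A : Frame) : Prop :=
  ¬ IsFocal Q w A.vec 1 0 ∧ ∀ σ, IsFocal Q w A.vec σ 1 → ∃ l : (Fin 3 → V) → ℂ,
    ContDiffAt ℂ 1 l A.vec ∧ ∀ᶠ x in 𝓝 (A.vec, σ), (∃ B : Frame, B.vec = x.1 ∧ B.plane ∈ S) →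
      (IsFocal Q w x.1 x.2 1 ↔ x.2 = l x.1)

theorem HasFocalBranches.ne_zero {S : Set Plane} {Q : V →ₗ[ℂ] (Fin 2 → ℂ)}
    {w : Fin 2 → (Fin 3 → V) → (Fin 3 → V)} {A : Frame} (h : HasFocalBranches S Q w A) {s t : ℂ}
    (hst : IsFocal Q w A.vec s t) : t ≠ 0 := by
  rintro rfl
  have hs : s ≠ 0 := hst.1.resolve_right fun h => h rfl
  have := hst.smul (inv_ne_zero hs)
  rw [inv_mul_cancel₀ hs, mul_zero] at this
  exact h.1 this

theorem IsFocal.div {Q : V →ₗ[ℂ] (Fin 2 → ℂ)} {w : Fin 2 → (Fin 3 → V) → (Fin 3 → V)}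
    {X : Fin 3 → V} {s t : ℂ} (h : IsFocal Q w X s t) (ht : t ≠ 0) : IsFocal Q w X (s / t) 1 := by
  have := h.smul (inv_ne_zero ht)
  rwa [inv_mul_cancel₀ ht, inv_mul_eq_div] at this

namespace IsTangentChart

variable {S : Set Plane} {P : V →ₗ[ℂ] (Fin 3 → ℂ)} {Q : V →ₗ[ℂ] (Fin 2 → ℂ)}
  {f : (Fin 3 → V) → ℂ} {w : Fin 2 → (Fin 3 → V) → (Fin 3 → V)}

theorem hasFocalBranches_of_noFocal (h : NoFocal S Q f w) {A : Frame}
    (hA : A.plane ∈ S) (hf : f A.vec ≠ 0) : HasFocalBranches S Q w A :=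
  ⟨h A hA hf 1 0, fun σ hσ => absurd hσ (h A hA hf σ 1)⟩

theorem hasFocalBranches_of_uniqueFocal (hw : IsTangentChart S P Q f w) {n d : (Fin 3 → V) → ℂ}
    (h : UniqueFocal S Q f w n d) {A : Frame} (hA : A.plane ∈ S) (hf : f A.vec ≠ 0) :
    HasFocalBranches S Q w A := by
  obtain ⟨hn, hd, h⟩ := h
  obtain ⟨hd0, h1⟩ := h A hA hf
  refine ⟨fun h2 => hd0 ?_, fun σ hσ => ⟨fun X => n X / d X,
    hn.contDiff.contDiffAt.div hd.contDiff.contDiffAt hd0, ?_⟩⟩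
  · simpa using ((h1 1 0).1 h2).2
  · have hfst : Tendsto Prod.fst (𝓝 (A.vec, σ)) (𝓝 A.vec) := continuousAt_fst
    filter_upwards [hfst.eventually
      ((hw.isPoly.analyticAt A.vec).continuousAt.eventually_ne hf)] with x hx
    rintro ⟨B, hB, hBS⟩
    rw [← hB] at hx ⊢
    obtain ⟨hd1, h2⟩ := h B hBS hx
    rw [h2, eq_div_iff hd1, one_mul]
    exact and_iff_right (.inr one_ne_zero)

/-- The two roots of a quadratic equation depend holomorphically on the coefficients where the
discriminant does not vanish. -/
theorem hasFocalBranches_of_twoFocal (hw : IsTangentChart S P Q f w) {p : Fin 3 × Fin 3}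
    (h : TwoFocal S Q f w p) {A : Frame} (hA : A.plane ∈ S) (hf : f A.vec ≠ 0) :
    HasFocalBranches S Q w A := by
  obtain ⟨ha, hΔ, h1⟩ := h A hA hf
  let a : (Fin 3 → V) → ℂ := fun X => minorA Q (w 0 X) p
  let b : (Fin 3 → V) → ℂ := fun X => minorB Q (w 0 X) (w 1 X) p
  let c : (Fin 3 → V) → ℂ := fun X => minorA Q (w 1 X) p
  let Δ : (Fin 3 → V) → ℂ := fun X => b X ^ 2 - 4 * a X * c X
  have hac : ContDiff ℂ 1 a := (hw.isPoly_minorA 0 p).contDiff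
  have hbc : ContDiff ℂ 1 b := (hw.isPoly_minorB p).contDiff
  have hcc : ContDiff ℂ 1 c := (hw.isPoly_minorA 1 p).contDiff
  have hΔc : ContDiff ℂ 1 Δ := (hbc.pow 2).sub ((contDiff_const.mul hac).mul hcc)
  have hΔ0 : Δ A.vec ≠ 0 := hΔ
  refine ⟨fun h2 => ha (by
    have := h2.2 p
    rw [minorA_combination] at this
    simpa using this), fun σ hσ => ?_⟩
  have e0 : a A.vec * σ ^ 2 + b A.vec * σ + c A.vec = 0 := by
    have := hσ.2 p
    rw [minorA_combination] at this
    simpa [a, b, c] using this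
  set r₀ := 2 * a A.vec * σ + b A.vec with hr₀
  have hr₀Δ : r₀ ^ 2 = Δ A.vec := by
    simp only [hr₀, Δ]; linear_combination 4 * a A.vec * e0
  have hr₀0 : r₀ ≠ 0 := by
    intro h0; rw [h0] at hr₀Δ; exact hΔ0 (by rw [← hr₀Δ]; norm_num)
  -- The branch of the square root of the discriminant with the value `r₀` at `A`. It is a square
  -- root wherever `Δ` does not vanish, and it is holomorphic near `A`, where the logarithm is taken
  -- near `1`.
  let r : (Fin 3 → V) → ℂ := fun X => r₀ * Complex.exp (Complex.log (Δ X / Δ A.vec) / 2)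
  have hrA : r A.vec = r₀ := by simp [r, div_self hΔ0]
  have hrc : ContDiffAt ℂ 1 r A.vec := by
    refine contDiffAt_const.mul (ContDiffAt.cexp (ContDiffAt.div_const ?_ 2))
    refine (Complex.contDiffAt_log ?_).comp A.vec (hΔc.contDiffAt.div_const (Δ A.vec))
    rw [div_self hΔ0]; exact Complex.one_mem_slitPlane
  have hr2 : ∀ X, Δ X ≠ 0 → r X ^ 2 = Δ X := fun X hX => by
    simp only [r]
    rw [mul_pow, ← Complex.exp_nat_mul, hr₀Δ]
    have : ((2 : ℕ) : ℂ) * (Complex.log (Δ X / Δ A.vec) / 2) = Complex.log (Δ X / Δ A.vec) := by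
      push_cast; ring
    rw [this, Complex.exp_log (div_ne_zero hX hΔ0), mul_div_cancel₀ _ hΔ0]
  refine ⟨fun X => (-b X + r X) / (2 * a X),
    (hbc.contDiffAt.neg.add hrc).div (contDiffAt_const.mul hac.contDiffAt)
      (mul_ne_zero two_ne_zero ha), ?_⟩
  have hfst : Tendsto Prod.fst (𝓝 (A.vec, σ)) (𝓝 A.vec) := continuousAt_fst
  have hsum : ContinuousAt (fun x : (Fin 3 → V) × ℂ => 2 * a x.1 * x.2 + b x.1 + r x.1)
      (A.vec, σ) := by
    have h3 := ContinuousAt.comp (g := a) (f := Prod.fst) (x := (A.vec, σ))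
      hac.continuous.continuousAt continuousAt_fst
    have h4 := ContinuousAt.comp (g := b) (f := Prod.fst) (x := (A.vec, σ))
      hbc.continuous.continuousAt continuousAt_fst
    have h5 := ContinuousAt.comp (g := r) (f := Prod.fst) (x := (A.vec, σ))
      hrc.continuousAt continuousAt_fst
    exact (((continuousAt_const.mul h3).mul continuousAt_snd).add h4).add h5
  filter_upwards [hfst.eventually ((hw.isPoly.analyticAt A.vec).continuousAt.eventually_ne hf),
    hsum.eventually_ne (y := (0 : ℂ)) (by
      simp only [hrA]
      rw [← hr₀, ← two_mul]
      exact mul_ne_zero two_ne_zero hr₀0)] with x hx hx0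
  rintro ⟨B, hB, hBS⟩
  rw [← hB] at hx hx0 ⊢
  obtain ⟨ha1, hΔ1, h2⟩ := h B hBS hx
  have hr2B := hr2 B.vec hΔ1
  rw [h2, and_iff_right (.inr one_ne_zero), minorA_combination,
    eq_div_iff (mul_ne_zero two_ne_zero ha1)]
  have ha1' : a B.vec ≠ 0 := ha1
  change a B.vec * x.2 ^ 2 + b B.vec * (x.2 * 1) + c B.vec * 1 ^ 2 = 0 ↔ _
  simp only [Δ] at hr2B
  constructor
  · intro h3
    have h4 : (2 * a B.vec * x.2 + b B.vec + r B.vec) *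
        (2 * a B.vec * x.2 + b B.vec - r B.vec) = 0 := by
      linear_combination 4 * a B.vec * h3 - hr2B
    linear_combination (mul_eq_zero.1 h4).resolve_left hx0
  · intro h3
    refine (mul_eq_zero.1 (?_ : (4 * a B.vec) * _ = 0)).resolve_left
      (mul_ne_zero (by norm_num : (4 : ℂ) ≠ 0) ha1')
    change x.2 * (2 * a B.vec) = -b B.vec + r B.vec at h3
    linear_combination (2 * a B.vec * x.2 + b B.vec + r B.vec) * h3 + hr2B

/-- Where the focal line directions do not branch, a developable family is an integral curve, up to
its parametrization, of the field of focal line directions. -/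
theorem exists_tangent_to_branch (hw : IsTangentChart S P Q f w) {A : Frame}
    (hf : f A.vec ≠ 0) {l : (Fin 3 → V) → ℂ} {σ : ℂ}
    (hbr : HasFocalBranches S Q w A)
    (hl : ∀ᶠ x in 𝓝 (A.vec, σ), (∃ B : Frame, B.vec = x.1 ∧ B.plane ∈ S) →
      (IsFocal Q w x.1 x.2 1 ↔ x.2 = l x.1)) {γ : ℂ → Frame} (hγ : IsFamilyThrough S A γ)
    (hd : IsDevelopable γ) {c : ℂ}
    (hσ : initialTangent A γ = c • charMap A (σ • w 0 A.vec + (1 : ℂ) • w 1 A.vec)) :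
    ∃ (u : ℂ → (Fin 3 → V)) (β : ℂ → ℂ), AnalyticAt ℂ u 0 ∧ AnalyticAt ℂ β 0 ∧ β 0 ≠ 0 ∧
      u 0 = A.vec ∧
      (∀ᶠ t in 𝓝 (0 : ℂ), HasDerivAt u (β t • (l (u t) • w 0 (u t) + w 1 (u t))) t) ∧
      ∀ᶠ t in 𝓝 (0 : ℂ), ∃ B : Frame, B.vec = u t ∧ B.plane = (γ t).plane := by
  obtain ⟨u, α, β, hu, hα, hβ, hu0, hder, hinit, h0, hfr⟩ := hw.exists_velocity_coordinates hf hγ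
  have hfoc0 := hw.isFocal_zero hd hu.continuousAt hα.continuousAt hβ.continuousAt h0
    (hfr.mono fun t ⟨B, _, _, _, _, h⟩ => h)
  rw [hu0] at hfoc0
  have hβ0 : β 0 ≠ 0 := hbr.ne_zero hfoc0
  have hσ' : α 0 / β 0 = σ := by
    rw [hinit, smul_charMap_combination, mul_one, ← sub_eq_zero, ← map_sub] at hσ
    have e : α 0 • w 0 A.vec + β 0 • w 1 A.vec - ((c * σ) • w 0 A.vec + c • w 1 A.vec) =
      (α 0 - c * σ) • w 0 A.vec + (β 0 - c) • w 1 A.vec := by module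
    rw [e, hw.charMap_eq_zero_iff_of_proj hf (hw.proj_combination _ _ _),
      hw.combination_eq_zero_iff hf] at hσ
    rw [div_eq_iff hβ0]
    linear_combination hσ.1 - σ * hσ.2
  have hβne : ∀ᶠ t in 𝓝 (0 : ℂ), β t ≠ 0 := hβ.continuousAt.eventually_ne hβ0
  have htend : Tendsto (fun t => (u t, α t / β t)) (𝓝 0) (𝓝 (A.vec, σ)) := by
    rw [← hσ', ← hu0]
    exact hu.continuousAt.prodMk (hα.continuousAt.div hβ.continuousAt hβ0)
  have hfoc : ∀ᶠ t in 𝓝 (0 : ℂ), IsFocalLine (γ t) (velocity γ t) := by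
    have hd' := eventually_nhdsWithin_iff.1 hd
    filter_upwards [hd'] with t ht
    by_cases h : t = 0
    · obtain ⟨B, hB, -, -, -, hiff⟩ := hfr.self_of_nhds
      rw [h, hiff, hu0]
      exact hfoc0
    · exact ht h
  refine ⟨u, β, hu, hβ, hβ0, hu0, ?_, hfr.mono fun t ⟨B, hB, _, _, hBp, _⟩ => ⟨B, hB, hBp⟩⟩
  filter_upwards [hder, hβne, htend.eventually hl, hfoc, hfr]
    with t e1 e2 e3 e4 ⟨B, hB, hBS, _, _, hiff⟩
  have e5 := (e3 ⟨B, hB, hBS⟩).1 ((hiff.1 e4).div e2)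
  rwa [smul_add, smul_smul, ← e5, mul_div_cancel₀ _ e2]

theorem developablesCorrespond_of_branches (hw : IsTangentChart S P Q f w) {A : Frame}
    (hA : A.plane ∈ S) (hf : f A.vec ≠ 0) (h : HasFocalBranches S Q w A) :
    DevelopablesCorrespond S A where
  isFocalLineDirection γ := hw.isFocalLineDirection_initialTangent hA hf
  exists_family φ hφ := by
    obtain ⟨s, t, rfl⟩ := hw.exists_eq_charMap hA hf hφ.1
    have h0 := (hw.isFocalLineDirection_iff hA hf s t).1 hφ
    have ht := h.ne_zero h0
    have h1 := h0.div ht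
    obtain ⟨l, hl, hbr⟩ := h.2 _ h1
    have hlA : s / t = l A.vec := (hbr.self_of_nhds ⟨A, rfl, hA⟩).1 h1
    obtain ⟨γ, e1, e2, e3⟩ := hw.exists_family hA hf (s := fun X => t * l X) (t := fun _ => t)
      (contDiffAt_const.mul hl) contDiffAt_const (.inr ht) (by
        have htend : Tendsto (fun X => (X, l X)) (𝓝 A.vec) (𝓝 (A.vec, s / t)) := by
          rw [hlA]; exact continuousAt_id.prodMk hl.continuousAt
        filter_upwards [htend.eventually hbr] with X hX hB
        simpa using ((hX hB).2 rfl).smul ht)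
    refine ⟨γ, e1, e2, ?_⟩
    rw [e3, ← hlA, mul_div_cancel₀ _ ht]
  unique _ γ δ hγ hγd hδ hδd := by
    rintro ⟨c, hc⟩
    have hφ := hw.isFocalLineDirection_initialTangent hA hf hγ hγd
    obtain ⟨s, t, hst⟩ := hw.exists_eq_charMap hA hf hφ.1
    rw [hst] at hφ
    have h0 := (hw.isFocalLineDirection_iff hA hf s t).1 hφ
    have ht := h.ne_zero h0
    obtain ⟨l, hl, hbr⟩ := h.2 _ (h0.div ht)
    have hst' : initialTangent A γ = t • charMap A ((s / t) • w 0 A.vec + (1 : ℂ) • w 1 A.vec) := by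
      rw [smul_charMap_combination, mul_one, mul_div_cancel₀ _ ht, hst]
    obtain ⟨u, α, hu, hα, hα0, hu0, hu', huB⟩ :=
      hw.exists_tangent_to_branch hf h hbr hγ hγd hst'
    obtain ⟨v, β, hv, hβ, hβ0, hv0, hv', hvB⟩ :=
      hw.exists_tangent_to_branch hf h hbr hδ hδd (c := c * t) (by rw [hc, hst', mul_smul])
    obtain ⟨r, hr, hr0, hr1, hruv⟩ := exists_reparametrization
      (F := fun X => l X • w 0 X + w 1 X)
      ((hl.smul (hw.isPolyField 0).contDiff.contDiffAt).add (hw.isPolyField 1).contDiff.contDiffAt)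
      hα hβ hα0 hβ0 hu hv hu0 hv0 hu' hv'
    refine ⟨r, hr, hr0, hr1, ?_⟩
    have hrt : Tendsto r (𝓝 0) (𝓝 0) := by
      have := hr.continuousAt.tendsto; rwa [hr0] at this
    filter_upwards [hruv, hvB, hrt.eventually huB] with t e1 ⟨B, hB, hBp⟩ ⟨C, hC, hCp⟩
    rw [← hBp, ← hCp, Frame.vec_injective (hB.trans (e1.trans hC.symm))]
  all hall := absurd ((hw.isFocalLineDirection_iff hA hf 1 0).1 (hall _
    ⟨_, hw.combination_mem_frameTangentSpace hA hf 1 0, rfl⟩ fun h0 => by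
      rw [hw.charMap_eq_zero_iff_of_proj hf (hw.proj_combination _ _ _),
        hw.combination_eq_zero_iff hf] at h0
      exact one_ne_zero h0.1)) h.1

end IsTangentChart

/-! ### Tangent vectors from derivations of the function field -/

/-- A polynomial function which vanishes at all frames of a plane vanishes at all triples of vectors
of the plane, since the frames are dense. -/
theorem IsPoly.eq_zero_of_mem_span {f : (Fin 3 → V) → ℂ} (hf : IsPoly f) {A : Frame}
    (h : ∀ B : Frame, B.plane = A.plane → f B.vec = 0) {X : Fin 3 → V} (hX : ∀ i, X i ∈ A.span) :
    f X = 0 := by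
  obtain ⟨P, hP⟩ := A.exists_leftInverse
  obtain ⟨p, hp⟩ := hf.line A.vec (X - A.vec)
  obtain ⟨d, hd⟩ := (isPoly_det_projMatrix P).line A.vec (X - A.vec)
  have hd0 : d ≠ 0 := by
    rintro rfl; have := hd 0; simp [projMatrix_eq_one hP] at this
  have hpd : p * d = 0 := by
    refine Polynomial.funext fun t => ?_
    rw [Polynomial.eval_mul, ← hp, ← hd, Polynomial.eval_zero]
    by_cases hdet : (projMatrix P (A.vec + t • (X - A.vec))).det = 0
    · rw [hdet, mul_zero]
    · rw [h ⟨_, linearIndependent_of_det_ne_zero hdet⟩ (Frame.plane_eq_of_mem_span fun i =>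
        A.span.add_mem (A.vec_mem_span i) (A.span.smul_mem _
          (A.span.sub_mem (hX i) (A.vec_mem_span i)))), zero_mul]
  have h1 := hp 1
  rwa [(mul_eq_zero.1 hpd).resolve_right hd0, Polynomial.eval_zero, one_smul,
    add_sub_cancel] at h1

theorem eval_smul_of_isHomogeneous {σ : Type*} [Fintype σ] {F : MvPolynomial σ ℂ} {d : ℕ}
    (hF : F.IsHomogeneous d) (t : ℂ) (v : σ → ℂ) :
    MvPolynomial.eval (t • v) F = t ^ d * MvPolynomial.eval v F := by
  rw [MvPolynomial.eval_eq', MvPolynomial.eval_eq', Finset.mul_sum]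
  refine Finset.sum_congr rfl fun m hm => ?_
  have h1 : ∑ i, m i = d := by
    rw [← hF (MvPolynomial.mem_support_iff.1 hm), Finsupp.weight_apply, Finsupp.sum_fintype] <;>
      simp
  simp only [Pi.smul_apply, smul_eq_mul, mul_pow, Finset.prod_mul_distrib]
  rw [Finset.prod_pow_eq_pow_sum, h1]
  ring

/-- A polynomial which vanishes on the planes of a nondegenerate congruence is zero, also if it is
not homogeneous. -/
theorem IsNondegenerate.eq_zero {S : Set Plane} (hS : IsNondegenerate S)
    {F : MvPolynomial (Fin 5) ℂ}
    (h : ∀ σ ∈ S, ∀ v ∈ σ.toSubmodule, MvPolynomial.eval v F = 0) : F = 0 := by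
  rw [← MvPolynomial.sum_homogeneousComponent F]
  refine Finset.sum_eq_zero fun d hd => hS d _ (MvPolynomial.homogeneousComponent_isHomogeneous d F)
    fun σ hσ v hv => ?_
  let p : Polynomial ℂ := ∑ e ∈ Finset.range (F.totalDegree + 1),
    Polynomial.C (MvPolynomial.eval v (MvPolynomial.homogeneousComponent e F)) * Polynomial.X ^ e
  have hp : p = 0 := by
    refine Polynomial.funext fun t => ?_
    have h1 := h σ hσ (t • v) (σ.toSubmodule.smul_mem t hv)
    rw [← MvPolynomial.sum_homogeneousComponent F, map_sum] at h1
    simp only [eval_smul_of_isHomogeneous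
      (MvPolynomial.homogeneousComponent_isHomogeneous _ F)] at h1
    simp only [p, Polynomial.eval_finsetSum, Polynomial.eval_mul, Polynomial.eval_C,
      Polynomial.eval_pow, Polynomial.eval_X, Polynomial.eval_zero]
    rw [← h1]
    exact Finset.sum_congr rfl fun e _ => mul_comm _ _
  have h2 : p.coeff d = MvPolynomial.eval v (MvPolynomial.homogeneousComponent d F) := by
    simp only [p, Polynomial.finsetSum_coeff, Polynomial.coeff_C_mul_X_pow]
    rw [Finset.sum_ite_eq, if_pos hd]
  rw [← h2, hp, Polynomial.coeff_zero]

/-- The ideal of the set of all frames of the planes in `S`. -/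
def frameIdeal (S : Set Plane) : Ideal (MvPolynomial (Fin 3 × Fin 5) ℂ) where
  carrier := {f | ∀ B : Frame, B.plane ∈ S → MvPolynomial.eval (coords B.vec) f = 0}
  add_mem' hf hg B hB := by rw [map_add, hf B hB, hg B hB, add_zero]
  zero_mem' B _ := map_zero _
  smul_mem' c f hf B hB := by rw [smul_eq_mul, map_mul, hf B hB, mul_zero]

theorem mem_frameIdeal {S : Set Plane} {f : MvPolynomial (Fin 3 × Fin 5) ℂ} :
    f ∈ frameIdeal S ↔ ∀ B : Frame, B.plane ∈ S → MvPolynomial.eval (coords B.vec) f = 0 := Iff.rfl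

theorem isNonzeroOn_iff_notMem_frameIdeal {S : Set Plane} {f : MvPolynomial (Fin 3 × Fin 5) ℂ} :
    (IsNonzeroOn S fun X => MvPolynomial.eval (coords X) f) ↔ f ∉ frameIdeal S := by
  rw [mem_frameIdeal, IsNonzeroOn]
  push Not
  rfl

theorem isPrime_frameIdeal {S : Set Plane} (hS : IsIrreducible S) : (frameIdeal S).IsPrime := by
  constructor
  · rw [Ideal.ne_top_iff_one, mem_frameIdeal]
    intro h
    obtain ⟨σ, hσ⟩ := hS.1
    obtain ⟨B, rfl⟩ := σ.exists_frame
    simpa using h B hσ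
  · intro f g hfg
    by_contra! h
    obtain ⟨A, hA, h0⟩ := exists_frame_mul_ne_zero hS (.eval f) (.eval g)
      (isNonzeroOn_iff_notMem_frameIdeal.2 h.1) (isNonzeroOn_iff_notMem_frameIdeal.2 h.2)
    exact h0 (by rw [← map_mul]; exact hfg A hA)

/-- The chain rule for a derivation of an algebra over the polynomial ring. -/
theorem derivation_apply_eq_sum {ι K : Type*} [Fintype ι] [Field K] [Algebra ℂ K]
    (a : MvPolynomial ι ℂ →ₐ[ℂ] K) (D : Derivation ℂ K K) (f : MvPolynomial ι ℂ) :
    D (a f) = ∑ p, a (MvPolynomial.pderiv p f) * D (a (MvPolynomial.X p)) := by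
  classical
  induction f using MvPolynomial.induction_on with
  | C c => simp [← MvPolynomial.algebraMap_eq]
  | add p q hp hq => simp only [map_add, add_mul, Finset.sum_add_distrib, hp, hq]
  | mul_X p n hp =>
    simp only [map_mul, Derivation.leibniz, smul_eq_mul, hp, MvPolynomial.pderiv_X, map_add,
      add_mul, Finset.sum_add_distrib, Finset.mul_sum]
    congr 1
    · rw [Finset.sum_eq_single n]
      · simp
      · intro b _ hb; simp [hb.symm]
      · simp
    · exact Finset.sum_congr rfl fun _ _ => by ring

/-- A derivation of the field of fractions of the coordinate ring of an affine variety is, up to a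
common denominator, given by polynomials. -/
theorem exists_polynomial_derivation {ι : Type} [Fintype ι] {I : Ideal (MvPolynomial ι ℂ)}
    [I.IsPrime]
    (D : Derivation ℂ (FractionRing (MvPolynomial ι ℂ ⧸ I)) (FractionRing (MvPolynomial ι ℂ ⧸ I))) :
    ∃ (s : MvPolynomial ι ℂ) (Y : ι → MvPolynomial ι ℂ), s ∉ I ∧
      (∀ f ∈ I, ∑ p, MvPolynomial.pderiv p f * Y p ∈ I) ∧
      ∀ p, algebraMap (MvPolynomial ι ℂ ⧸ I) (FractionRing _) (Ideal.Quotient.mk I (Y p)) =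
        algebraMap _ (FractionRing _) (Ideal.Quotient.mk I s) *
          D (algebraMap _ (FractionRing _) (Ideal.Quotient.mk I (MvPolynomial.X p))) := by
  let R := MvPolynomial ι ℂ ⧸ I
  let K := FractionRing R
  let a : MvPolynomial ι ℂ →ₐ[ℂ] K := (IsScalarTower.toAlgHom ℂ R K).comp (Ideal.Quotient.mkₐ ℂ I)
  have ha : ∀ f, a f = 0 ↔ f ∈ I := fun f => by
    change algebraMap R K (Ideal.Quotient.mk I f) = 0 ↔ _
    rw [FaithfulSMul.algebraMap_eq_zero_iff, Ideal.Quotient.eq_zero_iff_mem]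
  obtain ⟨b, hb⟩ := IsLocalization.exist_integer_multiples_of_finite (nonZeroDivisors R)
    fun p => D (a (MvPolynomial.X p))
  choose y hy using hb
  choose Y hY using fun p => Ideal.Quotient.mk_surjective (y p)
  obtain ⟨s, hs⟩ := Ideal.Quotient.mk_surjective (b : R)
  have hYa : ∀ p, a (Y p) = a s * D (a (MvPolynomial.X p)) := fun p => by
    change algebraMap R K (Ideal.Quotient.mk I (Y p)) =
      algebraMap R K (Ideal.Quotient.mk I s) * D (a (MvPolynomial.X p))
    rw [hY, hy, hs, Algebra.smul_def]
  refine ⟨s, Y, fun h => ?_, fun f hf => ?_, hYa⟩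
  · refine nonZeroDivisors.ne_zero b.2 ?_
    rw [← hs, Ideal.Quotient.eq_zero_iff_mem.2 h]
  · rw [← ha, map_sum]
    have h1 : a s * D (a f) = 0 := by rw [(ha f).2 hf, map_zero, mul_zero]
    rw [derivation_apply_eq_sum, Finset.mul_sum] at h1
    rw [← h1]
    refine Finset.sum_congr rfl fun p _ => ?_
    rw [map_mul, hYa]
    ring

/-- The projection of the variety of frames to the first vector of the frame is dominant, and
therefore generically submersive: the coordinates of the first vector are algebraically independent
in the function field, and the partial derivatives with respect to them extend to it. -/
theorem exists_tangent_vector {S : Set Plane} (hS : IsIrreducible S) (hnd : IsNondegenerate S)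
    (j : Fin 5) : ∃ s : (Fin 3 → V) → ℂ, IsPoly s ∧ IsNonzeroOn S s ∧ ∀ A : Frame, A.plane ∈ S →
      s A.vec ≠ 0 → ∃ X ∈ frameTangentSpace S A, X 0 = Pi.single j 1 := by
  have hI := isPrime_frameIdeal hS
  let R := MvPolynomial (Fin 3 × Fin 5) ℂ ⧸ frameIdeal S
  let K := FractionRing R
  let a : MvPolynomial (Fin 3 × Fin 5) ℂ →ₐ[ℂ] K :=
    (IsScalarTower.toAlgHom ℂ R K).comp (Ideal.Quotient.mkₐ ℂ (frameIdeal S))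
  have ha : ∀ f, a f = 0 ↔ f ∈ frameIdeal S := fun f => by
    change algebraMap R K (Ideal.Quotient.mk _ f) = 0 ↔ _
    rw [FaithfulSMul.algebraMap_eq_zero_iff, Ideal.Quotient.eq_zero_iff_mem]
  let φ : MvPolynomial (Fin 5) ℂ →ₐ[ℂ] K := a.comp (MvPolynomial.rename fun k => ((0 : Fin 3), k))
  have hφ : Function.Injective φ := by
    rw [injective_iff_map_eq_zero]
    intro F hF
    have hF' : ∀ B : Frame, B.plane ∈ S → MvPolynomial.eval (B.vec 0) F = 0 := fun B hB => by
      have := mem_frameIdeal.1 ((ha (MvPolynomial.rename (fun k => ((0 : Fin 3), k)) F)).1 hF) B hB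
      rwa [MvPolynomial.eval_rename] at this
    refine hnd.eq_zero fun σ hσ v hv => ?_
    obtain ⟨A, rfl⟩ := σ.exists_frame
    have hpoly : IsPoly fun X => MvPolynomial.eval (X 0) F :=
      ⟨MvPolynomial.rename (fun k => ((0 : Fin 3), k)) F, fun X => by
        rw [MvPolynomial.eval_rename]; rfl⟩
    exact hpoly.eq_zero_of_mem_span (A := A) (X := fun _ => v)
      (fun B hB => hF' B (hB ▸ hσ)) fun _ => hv
  have : Algebra.EssFiniteType R K := .of_isLocalization K (nonZeroDivisors R)
  have : Algebra.EssFiniteType ℂ K := .comp ℂ R K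
  obtain ⟨D, hD⟩ := exists_derivation_of_injective φ hφ j
  obtain ⟨s, Y, hs, hY, hYD⟩ := exists_polynomial_derivation D
  refine ⟨_, .eval s, isNonzeroOn_iff_notMem_frameIdeal.2 hs, fun A hA hsA => ?_⟩
  refine ⟨(MvPolynomial.eval (coords A.vec) s)⁻¹ •
    fun i k => MvPolynomial.eval (coords A.vec) (Y (i, k)), Submodule.smul_mem _ _
      (mem_frameTangentSpace.2 fun f hf => ?_), ?_⟩
  · have := mem_frameIdeal.1 (hY f hf) A hA
    rw [differential_apply]
    simpa only [map_sum, map_mul] using this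
  · ext k
    have h1 : D (a (MvPolynomial.X ((0 : Fin 3), k))) =
        a (MvPolynomial.C ((Pi.single j 1 : V) k)) := by
      have := hD (MvPolynomial.X k)
      simp only [φ, AlgHom.comp_apply, MvPolynomial.rename_X, MvPolynomial.pderiv_X] at this
      rw [this]
      obtain rfl | h := eq_or_ne j k
      · simp
      · simp [h.symm]
    have h2 : Y (0, k) - s * MvPolynomial.C ((Pi.single j 1 : V) k) ∈ frameIdeal S := by
      rw [← ha, map_sub, map_mul, ← h1, sub_eq_zero]
      exact hYD (0, k)
    have h3 := mem_frameIdeal.1 h2 A hA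
    rw [map_sub, map_mul, MvPolynomial.eval_C, sub_eq_zero] at h3
    simp only [Pi.smul_apply, smul_eq_mul]
    rw [h3, inv_mul_cancel_left₀ hsA]

theorem isNonzeroOn_prod {S : Set Plane} (hS : IsIrreducible S) {ι : Type*} (t : Finset ι)
    {f : ι → (Fin 3 → V) → ℂ} (hf : ∀ i, IsPoly (f i)) (h : ∀ i, IsNonzeroOn S (f i)) :
    IsNonzeroOn S fun X => ∏ i ∈ t, f i X := by
  classical
  induction t using Finset.induction_on with
  | empty =>
    obtain ⟨σ, hσ⟩ := hS.1
    obtain ⟨A, rfl⟩ := σ.exists_frame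
    exact ⟨A, hσ, by simp⟩
  | insert i t hi ih =>
    simp only [Finset.prod_insert hi]
    exact exists_frame_mul_ne_zero hS (hf i) (.prod hf) (h i) ih

theorem IsTangentChart.finrank_tangentSpace {S : Set Plane} {P : V →ₗ[ℂ] (Fin 3 → ℂ)}
    {Q : V →ₗ[ℂ] (Fin 2 → ℂ)} {f : (Fin 3 → V) → ℂ} {w : Fin 2 → (Fin 3 → V) → (Fin 3 → V)}
    (hw : IsTangentChart S P Q f w) {A : Frame} (hA : A.plane ∈ S) (hf : f A.vec ≠ 0) :
    Module.finrank ℂ (tangentSpace S A) = 2 := by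
  have hcomb : ∀ s t : ℂ, s • charMap A (w 0 A.vec) + t • charMap A (w 1 A.vec) =
      charMap A (s • w 0 A.vec + t • w 1 A.vec) := fun s t => by
    rw [map_add, map_smul, map_smul]
  have hli : LinearIndependent ℂ ![charMap A (w 0 A.vec), charMap A (w 1 A.vec)] :=
    LinearIndependent.pair_iff.2 fun s t h => by
      rwa [hcomb, hw.charMap_eq_zero_iff_of_proj hf (hw.proj_combination _ _ _),
        hw.combination_eq_zero_iff hf] at h
  have hspan : tangentSpace S A =
      Submodule.span ℂ (Set.range ![charMap A (w 0 A.vec), charMap A (w 1 A.vec)]) := by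
    ext φ
    rw [Matrix.range_cons_cons_empty, Submodule.mem_span_pair]
    constructor
    · intro hφ
      obtain ⟨s, t, rfl⟩ := hw.exists_eq_charMap hA hf hφ
      exact ⟨s, t, hcomb s t⟩
    · rintro ⟨s, t, rfl⟩
      exact ⟨_, hw.combination_mem_frameTangentSpace hA hf s t, (hcomb s t).symm⟩
  rw [hspan, finrank_span_eq_card hli, Fintype.card_fin]

theorem injective_of_surjective_of_finrank {M N : Type*} [AddCommGroup M] [Module ℂ M]
    [AddCommGroup N] [Module ℂ N] (hM : Module.finrank ℂ M = 2) (hN : Module.finrank ℂ N = 2)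
    {ℓ : M →ₗ[ℂ] N} (h : Function.Surjective ℓ) : Function.Injective ℓ := by
  have : Module.Finite ℂ M := Module.finite_of_finrank_pos (by omega)
  have : Module.Finite ℂ N := Module.finite_of_finrank_pos (by omega)
  exact (LinearMap.injective_iff_surjective_of_finrank_eq_finrank (hM.trans hN.symm)).2 h

/-- The general plane has a nonfocal point. At a point of the plane, the characteristic map gives
the differential of the projection of the incidence variety to `ℙ⁴`, which is generically
surjective; it is then injective, since the spaces have the same dimension. -/
theorem IsNondegenerate.general_hasNonfocalPoint {S : Set Plane} (hnd : IsNondegenerate S)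
    (hS : IsIrreducible S) {P : V →ₗ[ℂ] (Fin 3 → ℂ)} {Q : V →ₗ[ℂ] (Fin 2 → ℂ)}
    {f : (Fin 3 → V) → ℂ} {w : Fin 2 → (Fin 3 → V) → (Fin 3 → V)} (hw : IsTangentChart S P Q f w)
    (hf : IsNonzeroOn S f) : General S (HasNonfocalPoint S) := by
  choose s hs hs0 hsX using exists_tangent_vector hS hnd
  refine general_of_isPoly (hw.isPoly.mul (.prod (s := Finset.univ) hs))
    (exists_frame_mul_ne_zero hS hw.isPoly (.prod hs) hf (isNonzeroOn_prod hS _ hs hs0))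
    (fun A hA h0 => ?_) fun A g h => h.act g
  have hT := hw.finrank_tangentSpace hA (left_ne_zero_of_mul h0)
  refine ⟨hT, Pi.single 0 1, ?_⟩
  choose X hX hX0 using fun j => hsX j A hA
    (Finset.prod_ne_zero_iff.1 (right_ne_zero_of_mul h0) j (Finset.mem_univ j))
  let ev : tangentSpace S A →ₗ[ℂ] (V ⧸ A.span) :=
    LinearMap.applyₗ (Pi.single 0 1) ∘ₗ (tangentSpace S A).subtype
  have hev : Function.Surjective ev := by
    intro q
    obtain ⟨v, rfl⟩ := A.span.mkQ_surjective q
    refine ⟨⟨charMap A (∑ j, v j • X j), _, Submodule.sum_mem _ fun j _ =>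
      Submodule.smul_mem _ _ (hX j), rfl⟩, ?_⟩
    change charMap A (∑ j, v j • X j) (Pi.single 0 1) = _
    rw [charMap_single]
    congr 1
    ext k
    simp [Finset.sum_apply, hX0, Pi.single_apply]
  have hinj := injective_of_surjective_of_finrank (M := tangentSpace S A) (N := V ⧸ A.span)
    (ℓ := ev) hT A.finrank_quotient hev
  intro φ hφ h
  exact congrArg Subtype.val (hinj (a₁ := ⟨φ, hφ⟩) (a₂ := 0) (h.trans (map_zero ev).symm))

/-! ### The general plane of a nondegenerate congruence -/

theorem IsTangentChart.general_developablesCorrespond {S : Set Plane} {P : V →ₗ[ℂ] (Fin 3 → ℂ)}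
    {Q : V →ₗ[ℂ] (Fin 2 → ℂ)} {f : (Fin 3 → V) → ℂ} {w : Fin 2 → (Fin 3 → V) → (Fin 3 → V)}
    (hw : IsTangentChart S P Q f w) (hf : IsNonzeroOn S f)
    (hk : AllFocal S Q f w ∨ NoFocal S Q f w ∨ (∃ n d, UniqueFocal S Q f w n d) ∨
      ∃ p, TwoFocal S Q f w p) : General S (DevelopablesCorrespond S) := by
  refine general_of_isPoly hw.isPoly hf (fun A hA h0 => ?_) fun A g h => h.act g
  obtain h | h | ⟨n, d, h⟩ | ⟨p, h⟩ := hk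
  · exact hw.developablesCorrespond_of_allFocal h hA h0
  · exact hw.developablesCorrespond_of_branches hA h0
      (IsTangentChart.hasFocalBranches_of_noFocal h hA h0)
  · exact hw.developablesCorrespond_of_branches hA h0 (hw.hasFocalBranches_of_uniqueFocal h hA h0)
  · exact hw.developablesCorrespond_of_branches hA h0 (hw.hasFocalBranches_of_twoFocal h hA h0)

theorem IsTangentChart.general_not_isFocalLineDirection {S : Set Plane} {P : V →ₗ[ℂ] (Fin 3 → ℂ)}
    {Q : V →ₗ[ℂ] (Fin 2 → ℂ)} {f : (Fin 3 → V) → ℂ} {w : Fin 2 → (Fin 3 → V) → (Fin 3 → V)}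
    (hw : IsTangentChart S P Q f w) (hf : IsNonzeroOn S f) (h : NoFocal S Q f w) :
    General S fun A => ∀ φ, ¬ IsFocalLineDirection S A φ := by
  refine general_of_isPoly hw.isPoly hf (fun A hA h0 => hw.not_isFocalLineDirection h hA h0)
    fun A g hg => (transport g A).surjective.forall.2 fun φ => ?_
  rw [isFocalLineDirection_transport]
  exact hg φ

end PlaneCongruence

end

open PlaneCongruence

theorem mainTheorem1 (S : Set Plane) (hS : IsPlaneCongruence S) (hnd : IsNondegenerate S) :
    -- the focal locus in the general plane is a conic
    General S (fun A => ∃ q, IsFocalConic S A q) ∧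
    -- developable families through the general plane exist iff the general focal conic degenerates
    (General S (fun A => ∃ γ, IsFamilyThrough S A γ ∧ IsDevelopable γ) ↔
      General S (HasDegenerateFocalConic S)) ∧
    -- developable families correspond to the directions whose focal locus is a line
    General S (DevelopablesCorrespond S) ∧
    -- the four possibilities
    (General S (HasDegenerateFocalConic S) →
      General S (OneDirection S) ∨ General S (TwoDistinctDirections S) ∨
        General S (TwoCoincidentDirections S) ∨ General S (AllDirections S)) := by
  have hirr := hS.isIrreducible
  obtain ⟨A₀, hA₀, hsm⟩ := hS.dim_two
  obtain ⟨P, Q, f₀, w₀, hw₀, hf₀⟩ := hsm.exists_isTangentChart hA₀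
  obtain ⟨f, w, hw, hf, hk⟩ := hw₀.exists_kind ⟨A₀, hA₀, hf₀⟩
  have hconic : General S (HasNonfocalPoint S) := hnd.general_hasNonfocalPoint hirr hw hf
  have hdev : General S (DevelopablesCorrespond S) :=
    hw.general_developablesCorrespond hf hk
  refine ⟨hconic.mono fun A _ h => exists_isFocalConic_iff.2 h, ⟨fun h => ?_, fun h => ?_⟩, hdev,
    fun hdeg => ?_⟩
  · exact ((hconic.and hirr hdev).and hirr h).mono fun A _ ⟨⟨h1, h2⟩, γ, h3, h4⟩ =>
      hasDegenerateFocalConic_iff.2 ⟨h1, _, h2.isFocalLineDirection γ h3 h4⟩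
  · refine (hdev.and hirr h).mono fun A _ ⟨h1, h2⟩ => ?_
    obtain ⟨-, φ, hφ⟩ := hasDegenerateFocalConic_iff.1 h2
    obtain ⟨γ, h3, h4, -⟩ := h1.exists_family φ hφ
    exact ⟨γ, h3, h4⟩
  · obtain h | h | ⟨n, d, h⟩ | ⟨p, h⟩ := hk
    · exact .inr (.inr (.inr (general_of_isPoly hw.isPoly hf
        (fun A hA h0 => hw.allDirections h hA h0) fun A g => (allDirections_act g).2)))
    · obtain ⟨A, -, h1, h2⟩ :=
        (hdeg.and hirr (hw.general_not_isFocalLineDirection hf h)).exists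
      obtain ⟨-, φ, hφ⟩ := hasDegenerateFocalConic_iff.1 h1
      exact absurd hφ (h2 φ)
    · exact (hw.general_of_uniqueFocal hf h).imp_right fun h => .inr (.inl h)
    · exact .inr (.inl (general_of_isPoly hw.isPoly hf
        (fun A hA h0 => hw.twoDistinctDirections h hA h0) fun A g h => h.act g))
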